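/- **Max-Weight Colorful Independent Set** is the following problem: given a finite simple graph $G=(V,E)$ with vertex weights $w\colon V\to\mathbb N$ (where $0\in\mathbb N$) and a coloring $\mathrm{col}\colon V\to\{0,\dots,c-1\}$ of its vertices (an arbitrary map, not necessarily a proper coloring), find an independent set $S\subseteq V$ whose vertices have pairwise distinct colors and whose weight $w(S)=\sum_{v\in S}w(v)$ is maximum among all such sets. A graph is *chordal* if it contains no cycle of length at least four as an induced subgraph. **Proposition.** Max-Weight Colorful Independent Set on chordal graphs is solvable in $O(3^c\cdot n^2)$ time, where $n=|V|$ and $c$ is the number of colors. In detail: there are a single program $P$ for the word RAM and a constant $K$ such that, for all $n,c\in\mathbb N$, every chordal graph $G$ on $V=\{0,\dots,n-1\}$, every $w\colon V\to\mathbb N$ and every $\mathrm{col}\colon V\to\{0,\dots,c-1\}$, the program $P$, started on the instance $(G,w,\mathrm{col})$, halts and outputs the characteristic vector of a maximum-weight independent set whose vertices have pairwise distinct colors; and if $n\ge 1$, it halts after at most $K\cdot 3^c\cdot n^2$ steps. Here the word RAM has random-access memories, and in one step it adds, subtracts (truncated at $0$), multiplies, divides with rounding down or with remainder, compares, loads or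 stores words of $L=K\cdot(c+\mathrm{bits}(n)+\mathrm{bits}(w(V))+1)$ bits, where $\mathrm{bits}(m)$ is the length of the binary representation of $m$ and $w(V)=\sum_{v\in V}w(v)$; no written word may overflow. The input consists of $n$, $c$, the list of weights, the list of colors and the adjacency matrix of $G$; all other cells are initially zero. -/

import Mathlib

/-! ### The graph problem -/

/-- A graph is chordal if no cycle of length at least four is an induced subgraph of it. -/
def IsChordal {V : Type*} (G : SimpleGraph V) : Prop :=
  ∀ k : ℕ, 4 ≤ k → ¬ (SimpleGraph.cycleGraph k).IsIndContained G

/-- An independent set of `G` whose vertices have pairwise distinct colors. -/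
def IsColorfulIndepSet {V C : Type*} (G : SimpleGraph V) (col : V → C) (S : Finset V) : Prop :=
  G.IsIndepSet (S : Set V) ∧ Set.InjOn col (S : Set V)

/-- `S` is a solution of Max-Weight Colorful Independent Set on the instance `(G, w, col)`. -/
def IsMaxWeightColorfulIndepSet {V C : Type*} (G : SimpleGraph V) (w : V → ℕ) (col : V → C)
    (S : Finset V) : Prop :=
  IsColorfulIndepSet G col S ∧
    ∀ S' : Finset V, IsColorfulIndepSet G col S' → ∑ v ∈ S', w v ≤ ∑ v ∈ S, w v

/-! ### Word random-access machines

A program works on registers (`reg i` is the content of register `i`) and on random-access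
memories (`arr m a` is the content of cell `a` of memory `m`). A program names its registers and
memories explicitly, so it uses only a fixed finite number of them. -/

namespace WordRAM

/-- A configuration: contents of all registers and of all cells of all memories. -/
structure State where
  reg : ℕ → ℕ
  arr : ℕ → ℕ → ℕ

/-- An operand: a constant or a register. -/
inductive Atom where
  | const (k : ℕ)
  | reg (i : ℕ)

def Atom.val (s : State) : Atom → ℕ
  | .const k => k
  | .reg i => s.reg i

/-- The arithmetic operations of unit cost: addition, truncated subtraction, multiplication,
division with rounding down, remainder. -/
inductive Op where
  | add | sub | mul | div | mod

def Op.eval : Op → ℕ → ℕ → ℕ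
  | .add, x, y => x + y
  | .sub, x, y => x - y
  | .mul, x, y => x * y
  | .div, x, y => x / y
  | .mod, x, y => x % y

/-- The tests of unit cost: comparisons of two operands. -/
inductive Test where
  | lt (a b : Atom)
  | eq (a b : Atom)

def Test.Holds (s : State) : Test → Prop
  | .lt a b => a.val s < b.val s
  | .eq a b => a.val s = b.val s

/-- Programs. `op d f a b` writes `f a b` to register `d`; `load d m i` writes the content of cell
`i` of memory `m` to register `d`; `store m i v` writes `v` to cell `i` of memory `m`. -/
inductive Prog where
  | skip
  | op (d : ℕ) (f : Op) (a b : Atom)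
  | load (d m : ℕ) (i : Atom)
  | store (m : ℕ) (i v : Atom)
  | seq (p q : Prog)
  | ite (b : Test) (p q : Prog)
  | while (b : Test) (p : Prog)

def State.setReg (s : State) (d x : ℕ) : State :=
  { s with reg := Function.update s.reg d x }

def State.setArr (s : State) (m a x : ℕ) : State :=
  { s with arr := Function.update s.arr m (Function.update (s.arr m) a x) }

/-- `Exec L p s t s'`: on the machine with words of `L` bits, the program `p` started in `s` halts
in `s'` after exactly `t` steps. Each elementary instruction and each evaluation of a test is one
step. Each word that is written has to be less than `2 ^ L`; an overflow blocks the execution. -/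
inductive Exec (L : ℕ) : Prog → State → ℕ → State → Prop where
  | skip (s : State) : Exec L .skip s 1 s
  | op (s : State) (d : ℕ) (f : Op) (a b : Atom) (h : f.eval (a.val s) (b.val s) < 2 ^ L) :
      Exec L (.op d f a b) s 1 (s.setReg d (f.eval (a.val s) (b.val s)))
  | load (s : State) (d m : ℕ) (i : Atom) (h : s.arr m (i.val s) < 2 ^ L) :
      Exec L (.load d m i) s 1 (s.setReg d (s.arr m (i.val s)))
  | store (s : State) (m : ℕ) (i v : Atom) (h : v.val s < 2 ^ L) :
      Exec L (.store m i v) s 1 (s.setArr m (i.val s) (v.val s))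
  | seq {p q : Prog} {s s' s'' : State} {t t' : ℕ} (h : Exec L p s t s')
      (h' : Exec L q s' t' s'') : Exec L (.seq p q) s (t + t') s''
  | ite_true {b : Test} {p q : Prog} {s s' : State} {t : ℕ} (hb : b.Holds s)
      (h : Exec L p s t s') : Exec L (.ite b p q) s (1 + t) s'
  | ite_false {b : Test} {p q : Prog} {s s' : State} {t : ℕ} (hb : ¬ b.Holds s)
      (h : Exec L q s t s') : Exec L (.ite b p q) s (1 + t) s'
  | while_true {b : Test} {p : Prog} {s s' s'' : State} {t t' : ℕ} (hb : b.Holds s)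
      (h : Exec L p s t s') (h' : Exec L (.while b p) s' t' s'') :
      Exec L (.while b p) s (1 + t + t') s''
  | while_false {b : Test} {p : Prog} {s : State} (hb : ¬ b.Holds s) :
      Exec L (.while b p) s 1 s

end WordRAM

/-! ### Input and output of the problem on the machine -/

open Classical in
/-- The initial configuration for the instance `(G, w, col)`: registers 0 and 1 hold the numbers
of vertices and of colors; memory 0 holds the weights, memory 1 the colors, memory 2 the adjacency
matrix, row by row; everything else is zero. -/
noncomputable def instanceState {n c : ℕ} (G : SimpleGraph (Fin n)) (w : Fin n → ℕ)
    (col : Fin n → Fin c) : WordRAM.State where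
  reg i := if i = 0 then n else if i = 1 then c else 0
  arr m a :=
    if m = 0 then (if h : a < n then w ⟨a, h⟩ else 0)
    else if m = 1 then (if h : a < n then (col ⟨a, h⟩ : ℕ) else 0)
    else if m = 2 then (if ∃ u v : Fin n, a = u * n + v ∧ G.Adj u v then 1 else 0)
    else 0

/-- Memory 3 holds the characteristic vector of the vertex set `S`. -/
def OutputsSet {n : ℕ} (s : WordRAM.State) (S : Finset (Fin n)) : Prop :=
  ∀ v : Fin n, s.arr 3 v = if v ∈ S then 1 else 0

/-- The order of the word length: `c`, plus the numbers of bits of `n` and of the total weight,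
plus one. -/
def instanceBits {n : ℕ} (c : ℕ) (w : Fin n → ℕ) : ℕ :=
  c + Nat.size n + Nat.size (∑ v, w v) + 1

/-! ### Reasoning about programs -/

namespace WordRAM

/-! A maximum cardinality search visits the vertices of a chordal graph in an order in which the
earlier neighbors of every vertex form a clique (`IsSearchOrder.adj_of_adj`). Attach each vertex to
its last earlier neighbor, or to an artificial root `0` if it has none. In this elimination tree
every edge joins a vertex to one of its ancestors (`IsElimTree.desc_of_adj`), so the subtrees of
incomparable vertices are disjoint and have no edge between them (`IsElimTree.apart`). Moreover, if
a descendant of `v` is adjacent to `v`, so is every vertex between the two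
(`IsElimTree.adj_of_desc`). Hence deleting `v` from its subtree leaves the subtrees of its children,
and deleting `v` with its neighbors leaves the subtrees of those `u` that are not adjacent to `v`
but have a parent that is (`IsElimTree.mem_forest_children`, `IsElimTree.mem_forest_hangs`).

For every vertex `v` and every mask of colors, the program keeps a best colorful independent set in
the subtree of `v` with colors in the mask. Tables for two sets without edges between them are
combined by a max-plus subset convolution (`IsMaxConv.sound`, `IsMaxConv.complete`). Convolving the
tables of the children of `v` gives the best sets without `v`; convolving those of the hanging
subtrees, and then the table of `{v}`, gives the best sets with `v`; the table of `v` is the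
row-wise maximum (`IsMaxConv.complete_insert`).

Pairs of disjoint masks correspond to numbers below `3 ^ c` through their ternary digits. A solution
is a row with one slot per color, so the union of two solutions with disjoint colors is a slotwise
sum. A convolution first compares only the weights of all `3 ^ c` pairs, and then builds just one
row per mask; as `(c + 1) * 2 ^ c ≤ 2 * 3 ^ c`, this takes `O(3 ^ c)` steps. There are `O(n ^ 2)`
convolutions, at most one for each pair `v < u` and one for each `v`.

Straight-line code is verified by weakest preconditions (`Runs.of_wp`), loops by invariants
(`Runs.loop`). The same invariants bound all slots and addresses, so that no word overflows. -/

@[simp] theorem State.setReg_reg (s : State) (d x i : ℕ) :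
    (s.setReg d x).reg i = if i = d then x else s.reg i := by
  simp [State.setReg, Function.update_apply]

@[simp] theorem State.setReg_arr (s : State) (d x : ℕ) : (s.setReg d x).arr = s.arr := rfl

@[simp] theorem State.setArr_reg (s : State) (m a x : ℕ) : (s.setArr m a x).reg = s.reg := rfl

@[simp] theorem State.setArr_arr (s : State) (m a x k b : ℕ) :
    (s.setArr m a x).arr k b = if k = m then (if b = a then x else s.arr k b) else s.arr k b := by
  by_cases h : k = m
  · subst h; simp [State.setArr, Function.update_apply]
  · simp [State.setArr, h]

@[simp] theorem Atom.val_const (s : State) (k : ℕ) : (Atom.const k).val s = k := rfl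

@[simp] theorem Atom.val_reg (s : State) (i : ℕ) : (Atom.reg i).val s = s.reg i := rfl

/-- The program `p` started in `s` halts after at most `T` steps in a state satisfying `Q`. -/
def Runs (L : ℕ) (p : Prog) (s : State) (T : ℕ) (Q : State → Prop) : Prop :=
  ∃ t s', Exec L p s t s' ∧ t ≤ T ∧ Q s'

/-- The weakest precondition of a loop-free program. -/
def wp (L : ℕ) : Prog → (State → Prop) → State → Prop
  | .skip, Q, s => Q s
  | .op d f a b, Q, s =>
      f.eval (a.val s) (b.val s) < 2 ^ L ∧ Q (s.setReg d (f.eval (a.val s) (b.val s)))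
  | .load d m i, Q, s => s.arr m (i.val s) < 2 ^ L ∧ Q (s.setReg d (s.arr m (i.val s)))
  | .store m i v, Q, s => v.val s < 2 ^ L ∧ Q (s.setArr m (i.val s) (v.val s))
  | .seq p q, Q, s => wp L p (wp L q Q) s
  | .ite b p q, Q, s => (b.Holds s → wp L p Q s) ∧ (¬ b.Holds s → wp L q Q s)
  | .while _ _, _, _ => False

/-- The maximal running time of a loop-free program. -/
def cost : Prog → ℕ
  | .skip => 1
  | .op _ _ _ _ => 1
  | .load _ _ _ => 1
  | .store _ _ _ => 1
  | .seq p q => cost p + cost q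
  | .ite _ p q => 1 + max (cost p) (cost q)
  | .while _ _ => 0

/-- Sequential composition of a list of programs. -/
def block : List Prog → Prog
  | [] => .skip
  | p :: l => .seq p (block l)

/-- `for r := r, ..., b - 1 do p`. -/
def loop (r : ℕ) (b : Atom) (p : Prog) : Prog :=
  .while (.lt (.reg r) b) (.seq p (.op r .add (.reg r) (.const 1)))

/-- Unfolding `wp` on straight-line code leaves word-size inequalities and the final condition,
mostly within reach of `simp` and `omega`. -/
theorem Runs.of_wp {L : ℕ} {p : Prog} {Q : State → Prop} {s : State} (h : wp L p Q s) :
    Runs L p s (cost p) Q := by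
  induction p generalizing Q s with
  | skip => exact ⟨_, _, .skip s, le_rfl, h⟩
  | op d f a b => exact ⟨_, _, .op s d f a b h.1, le_rfl, h.2⟩
  | load d m i => exact ⟨_, _, .load s d m i h.1, le_rfl, h.2⟩
  | store m i v => exact ⟨_, _, .store s m i v h.1, le_rfl, h.2⟩
  | seq p q ihp ihq =>
    obtain ⟨t, s', e, ht, hs⟩ := ihp h
    obtain ⟨t', s'', e', ht', hs'⟩ := ihq hs
    exact ⟨_, _, e.seq e', Nat.add_le_add ht ht', hs'⟩
  | ite b p q ihp ihq =>
    by_cases hb : b.Holds s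
    · obtain ⟨t, s', e, ht, hs⟩ := ihp (h.1 hb)
      exact ⟨_, _, .ite_true hb e, Nat.add_le_add_left (ht.trans (le_max_left _ _)) _, hs⟩
    · obtain ⟨t, s', e, ht, hs⟩ := ihq (h.2 hb)
      exact ⟨_, _, .ite_false hb e, Nat.add_le_add_left (ht.trans (le_max_right _ _)) _, hs⟩
  | _ => exact h.elim

theorem Runs.mono {L : ℕ} {p : Prog} {s : State} {T T' : ℕ} {Q Q' : State → Prop}
    (h : Runs L p s T Q) (hT : T ≤ T') (hQ : ∀ s', Q s' → Q' s') : Runs L p s T' Q' := by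
  obtain ⟨t, s', e, ht, hs⟩ := h
  exact ⟨t, s', e, ht.trans hT, hQ _ hs⟩

theorem Runs.seq {L : ℕ} {p q : Prog} {s : State} {T T' : ℕ} {Q R : State → Prop}
    (h : Runs L p s T R) (h' : ∀ s', R s' → Runs L q s' T' Q) :
    Runs L (.seq p q) s (T + T') Q := by
  obtain ⟨t, s', e, ht, hs⟩ := h
  obtain ⟨t', s'', e', ht', hs'⟩ := h' s' hs
  exact ⟨_, _, e.seq e', Nat.add_le_add ht ht', hs'⟩

theorem Runs.ite {L : ℕ} {b : Test} {p q : Prog} {s : State} {T : ℕ} {Q : State → Prop}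
    (h : b.Holds s → Runs L p s T Q) (h' : ¬ b.Holds s → Runs L q s T Q) :
    Runs L (.ite b p q) s (1 + T) Q := by
  by_cases hb : b.Holds s
  · obtain ⟨t, s', e, ht, hs⟩ := h hb
    exact ⟨_, _, .ite_true hb e, Nat.add_le_add_left ht _, hs⟩
  · obtain ⟨t, s', e, ht, hs⟩ := h' hb
    exact ⟨_, _, .ite_false hb e, Nat.add_le_add_left ht _, hs⟩

/-- The invariant is demanded after the increment of the counter, hence the `setReg` in `hbody`. The
`2` in each round pays for the test and the increment, the final `1` for the failing test. -/
theorem Runs.loop {L : ℕ} {r : ℕ} {b : Atom} {p : Prog} {T N : ℕ} (I : ℕ → State → Prop)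
    (hN : N < 2 ^ L) (hI : ∀ k s, I k s → s.reg r = k ∧ b.val s = N)
    (hbody : ∀ k s, k < N → I k s →
      Runs L p s T fun s' => s'.reg r = k ∧ I (k + 1) (s'.setReg r (k + 1)))
    {k : ℕ} {s : State} (hk : k ≤ N) (hs : I k s) :
    Runs L (loop r b p) s ((N - k) * (T + 2) + 1) (I N) := by
  obtain ⟨d, rfl⟩ := Nat.exists_eq_add_of_le hk
  induction d generalizing k s with
  | zero =>
    refine ⟨_, _, .while_false ?_, ?_, hs⟩
    · have := hI _ _ hs
      simp [Test.Holds, this]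
    · omega
  | succ d ih =>
    obtain ⟨t, s', e, ht, hr, hs'⟩ := hbody k s (by omega) hs
    have hkd : k + 1 + d = k + (d + 1) := by omega
    obtain ⟨t', s'', e', ht', hs''⟩ := @ih (k + 1) (s'.setReg r (k + 1)) hs' (by rwa [hkd])
      (by rwa [hkd]) (by rwa [hkd]) (by omega)
    have hex : Exec L (.op r .add (.reg r) (.const 1)) s' 1 (s'.setReg r (k + 1)) := by
      have := Exec.op (L := L) s' r .add (.reg r) (.const 1)
        (by simp only [Op.eval, Atom.val, hr]; omega)
      simpa only [Op.eval, Atom.val, hr] using this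
    refine ⟨_, _, .while_true ?_ (e.seq hex) e', ?_, ?_⟩
    · have := hI _ _ hs
      simp [Test.Holds, this]
    · have h1 : k + (d + 1) - k = d + 1 := by omega
      have h2 : k + 1 + d - (k + 1) = d := by omega
      rw [h1]; rw [h2] at ht'
      have : (d + 1) * (T + 2) = d * (T + 2) + (T + 2) := by ring
      omega
    · rwa [hkd] at hs''

end WordRAM

/-! ### Search orders of chordal graphs -/

section Chordal

variable {V : Type*} {G : SimpleGraph V}

/-- `p 0, ..., p k` is an induced path of `G`. -/
def IsInducedPath (G : SimpleGraph V) (p : ℕ → V) (k : ℕ) : Prop :=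
  ∀ i j, i < j → j ≤ k → p i ≠ p j ∧ (G.Adj (p i) (p j) ↔ j = i + 1)

theorem IsInducedPath.reverse {p : ℕ → V} {k : ℕ} (h : IsInducedPath G p k) :
    IsInducedPath G (fun i => p (k - i)) k := by
  intro i j hij hj
  obtain ⟨h1, h2⟩ := h (k - j) (k - i) (by omega) (by omega)
  refine ⟨h1.symm, ?_⟩
  rw [G.adj_comm, h2]
  omega

theorem IsInducedPath.shift {p : ℕ → V} {k : ℕ} (h : IsInducedPath G p k) {i : ℕ} (hi : i ≤ k) :
    IsInducedPath G (fun j => p (i + j)) (k - i) := by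
  intro a b hab hb
  obtain ⟨h1, h2⟩ := h (i + a) (i + b) (by omega) (by omega)
  exact ⟨h1, h2.trans (by omega)⟩

/-- An induced path with at least three vertices cannot be closed to an induced cycle by one
vertex. -/
theorem IsChordal.not_adj_ends (hG : IsChordal G) {p : ℕ → V} {k : ℕ} (h : IsInducedPath G p k)
    (hk : 2 ≤ k) {d : V} (hd : ∀ i ≤ k, p i ≠ d) (h0 : G.Adj d (p 0)) (hdk : G.Adj d (p k)) :
    ∃ i, 0 < i ∧ i < k ∧ G.Adj d (p i) := by
  by_contra! hno
  have key : ∀ i ≤ k, G.Adj d (p i) ↔ i = 0 ∨ i = k := by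
    intro i hi
    refine ⟨fun ha => ?_, ?_⟩
    · by_contra hne
      exact hno i (by omega) (by omega) ha
    · rintro (rfl | rfl) <;> assumption
  -- The cycle follows the path in positions `0, ..., k` and closes through `d` in position `k + 1`.
  refine hG (k + 2) (by omega) ⟨⟨⟨fun i => if (i : ℕ) ≤ k then p i else d, ?_⟩, ?_⟩⟩
  · intro i j hij
    simp only at hij
    rw [Fin.ext_iff]
    by_contra hne
    have := i.2
    have := j.2
    split_ifs at hij with hi hj hj
    · rcases Nat.lt_or_gt_of_ne hne with hlt | hlt
      · exact (h _ _ hlt hj).1 hij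
      · exact (h _ _ hlt hi).1 hij.symm
    · exact hd _ hi hij
    · exact hd _ hj hij.symm
    · omega
  · intro i j
    obtain ⟨i, hi⟩ := i
    obtain ⟨j, hj⟩ := j
    rw [SimpleGraph.cycleGraph_adj']
    simp only [Fin.sub_def]
    change G.Adj (if i ≤ k then p i else d) (if j ≤ k then p j else d) ↔ _
    -- A difference of `1` modulo `k + 2` means consecutive positions or the wrap from `k + 1` to
    -- `0`.
    have hmod : ∀ a b : ℕ, a < k + 2 → b < k + 2 →
        ((k + 2 - b + a) % (k + 2) = 1 ↔ a = b + 1 ∨ (a = 0 ∧ b = k + 1)) := by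
      intro a b ha hb
      rcases Nat.lt_or_ge a b with hab | hab
      · rw [Nat.mod_eq_of_lt (by omega)]; omega
      · rw [show k + 2 - b + a = a - b + (k + 2) by omega, Nat.add_mod_right,
          Nat.mod_eq_of_lt (by omega)]
        omega
    rw [hmod _ _ hi hj, hmod _ _ hj hi]
    split_ifs with h1 h2 h2
    · rcases Nat.lt_trichotomy i j with hlt | rfl | hlt
      · rw [(h _ _ hlt h2).2]; omega
      · simp; omega
      · rw [G.adj_comm, (h _ _ hlt h1).2]; omega
    · rw [G.adj_comm, key i h1]; omega
    · rw [key j h2]; omega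
    · simp; omega

/-- The property of the visiting times of a maximal neighborhood search. -/
def IsSearchOrder (G : SimpleGraph V) (τ : V → ℕ) : Prop :=
  ∀ a b c, τ a < τ b → τ b < τ c → G.Adj a c → ¬ G.Adj a b →
    ∃ d, τ d < τ b ∧ G.Adj d b ∧ ¬ G.Adj d c

/-- An induced path whose inner vertices are all later than both ends can be traded for another one
whose later end is earlier still; induction on the time `m` of the later end therefore excludes it.
The trade prepends to a final stretch of the path a vertex supplied by the search property. -/
theorem IsSearchOrder.not_isInducedPath {τ : V → ℕ} (hG : IsChordal G) (hτ : τ.Injective)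
    (h : IsSearchOrder G τ) (m : ℕ) : ∀ (p : ℕ → V) (k : ℕ), 2 ≤ k → max (τ (p 0)) (τ (p k)) = m →
      (∀ i, 0 < i → i < k → m < τ (p i)) → ¬ IsInducedPath G p k := by
  induction m using Nat.strong_induction_on with
  | _ m ih =>
  have main : ∀ (p : ℕ → V) (k : ℕ), 2 ≤ k → τ (p 0) = m → τ (p k) < m →
      (∀ i, 0 < i → i < k → m < τ (p i)) → ¬ IsInducedPath G p k := by
    intro p k hk h0 hm hin hp
    -- The vertex `p 0` was visited before `p (k - 1)`, although of the two only `p (k - 1)` is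
    -- adjacent to `p k`. So some earlier `d` favors `p 0`.
    obtain ⟨d, hd, hd0, hdk⟩ := h (p k) (p 0) (p (k - 1)) (by rw [h0]; exact hm)
      (by rw [h0]; exact hin _ (by omega) (by omega))
      ((hp (k - 1) k (by omega) le_rfl).2.2 (by omega)).symm
      (fun ha => by have := (hp 0 k (by omega) le_rfl).2.1 ha.symm; omega)
    classical
    -- Starting from the last neighbor of `d` before `p k` removes all chords from `d` to later
    -- inner vertices.
    set i := Nat.findGreatest (fun i => G.Adj d (p i)) (k - 1) with hi
    have hi1 : G.Adj d (p i) := Nat.findGreatest_spec (P := fun i => G.Adj d (p i))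
      (Nat.zero_le _) hd0
    have hik : i ≤ k - 1 := Nat.findGreatest_le _
    have hik' : i ≠ k - 1 := fun e => hdk (e ▸ hi1)
    have hgt : ∀ j, i < j → j < k → ¬ G.Adj d (p j) := fun j h1 h2 =>
      Nat.findGreatest_is_greatest h1 (by omega)
    have hτp : ∀ j < k, τ d < τ (p j) := by
      intro j hj
      rcases Nat.eq_zero_or_pos j with rfl | hj0
      · exact hd
      · have := hin j hj0 hj; omega
    have hne : ∀ j ≤ k, p j ≠ d := by
      rintro j hj rfl
      rcases hj.lt_or_eq with hj | rfl
      · exact lt_irrefl _ (hτp j hj)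
      · have := (hp 0 j (by omega) le_rfl).2.1 hd0.symm; omega
    have hs := hp.shift (i := i) (by omega)
    -- Otherwise `d` would close `p i, ..., p k` to an induced cycle; this path has at least three
    -- vertices because `i < k - 1`.
    have hki : ¬ G.Adj d (p k) := by
      intro ha
      obtain ⟨j, hj0, hj, hj'⟩ := hG.not_adj_ends hs (by omega) (d := d)
        (fun j hj => hne _ (by omega)) (by simpa using hi1)
        (by simpa [show i + (k - i) = k by omega] using ha)
      exact hgt (i + j) (by omega) (by omega) hj'
    -- The path `d, p i, ..., p k` has both ends earlier than `m`, while its inner vertices,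
    -- possibly including `p 0`, have time at least `m`.
    refine ih (max (τ d) (τ (p k))) (by omega) (fun j => if j = 0 then d else p (i + (j - 1)))
      (k - i + 1) (by omega) ?_ ?_ ?_
    · simp [show i + (k - i) = k by omega]
    · intro j hj0 hj
      have h1 := hτp (i + (j - 1)) (by omega)
      have h2 : m ≤ τ (p (i + (j - 1))) := by
        rcases Nat.eq_zero_or_pos (i + (j - 1)) with e | e
        · rw [e, h0]
        · exact (hin _ e (by omega)).le
      rw [if_neg (by omega)]
      omega
    · intro a b hab hb
      simp only [if_neg (show b ≠ 0 by omega)]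
      by_cases ha : a = 0
      · subst ha
        simp only [if_true]
        refine ⟨(hne _ (by omega)).symm, fun hadj => ?_, ?_⟩
        · by_contra hb1
          rcases Nat.lt_or_ge (i + (b - 1)) k with hlt | hge
          · exact hgt _ (by omega) hlt hadj
          · exact hki (by rwa [show k = i + (b - 1) by omega])
        · rintro rfl
          simpa using hi1
      · rw [if_neg ha]
        obtain ⟨h1, h2⟩ := hs (a - 1) (b - 1) (by omega) (by omega)
        exact ⟨h1, h2.trans (by omega)⟩
  intro p k hk hm hin hp
  rcases Nat.lt_trichotomy (τ (p 0)) (τ (p k)) with hlt | heq | hlt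
  · refine main (fun i => p (k - i)) k hk ?_ ?_ ?_ hp.reverse
    · simpa [hlt.le] using hm
    · simpa [← hm] using hlt
    · intro i h1 h2
      exact hin _ (by omega) (by omega)
  · exact (hp 0 k (by omega) le_rfl).1 (hτ heq)
  · exact main p k hk (by simpa [hlt.le] using hm) (by rw [← hm, max_eq_left hlt.le]; exact hlt)
      hin hp

/-- In a search order of a chordal graph, the earlier neighbors of a vertex form a clique. -/
theorem IsSearchOrder.adj_of_adj {τ : V → ℕ} (hG : IsChordal G) (hτ : τ.Injective)
    (h : IsSearchOrder G τ) {x y z : V} (hx : τ x < τ z) (hy : τ y < τ z) (hxz : G.Adj x z)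
    (hyz : G.Adj y z) (hxy : x ≠ y) : G.Adj x y := by
  by_contra hn
  -- Without the edge, `x, z, y` would be an induced path whose inner vertex is later than both
  -- ends.
  refine h.not_isInducedPath hG hτ _ (fun i => if i = 0 then x else if i = 1 then z else y) 2
    le_rfl rfl ?_ ?_
  · intro i h1 h2
    obtain rfl : i = 1 := by omega
    simp [hx, hy]
  · intro i j hij hj
    interval_cases j <;> interval_cases i <;> simp_all [hxz.ne, hyz.ne', hyz.symm]

end Chordal

/-! ### Tables and their max-plus subset convolution -/

namespace WordRAM

/-- `s` agrees with `s₀` on the registers below `r` and on the memories below `m`. -/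
def Frame (r m : ℕ) (s₀ s : State) : Prop :=
  (∀ i < r, s.reg i = s₀.reg i) ∧ ∀ k < m, ∀ a, s.arr k a = s₀.arr k a

theorem Frame.refl (r m : ℕ) (s : State) : Frame r m s s := ⟨fun _ _ => rfl, fun _ _ _ => rfl⟩

theorem Frame.trans {r m r' m' r'' m'' : ℕ} {s₀ s₁ s₂ : State} (h : Frame r m s₀ s₁)
    (h' : Frame r' m' s₁ s₂) (hr : r'' ≤ r) (hr' : r'' ≤ r') (hm : m'' ≤ m) (hm' : m'' ≤ m') :
    Frame r'' m'' s₀ s₂ :=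
  ⟨fun i hi => (h'.1 i (by omega)).trans (h.1 i (by omega)),
    fun k hk a => (h'.2 k (by omega) a).trans (h.2 k (by omega) a)⟩

@[simp] theorem frame_setReg {r m d x : ℕ} {s₀ s : State} (h : r ≤ d) :
    Frame r m s₀ (s.setReg d x) ↔ Frame r m s₀ s := by
  refine and_congr (forall₂_congr fun i hi => ?_) Iff.rfl
  rw [State.setReg_reg, if_neg (by omega)]

@[simp] theorem frame_setArr {r m k a x : ℕ} {s₀ s : State} (h : m ≤ k) :
    Frame r m s₀ (s.setArr k a x) ↔ Frame r m s₀ s := by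
  refine and_congr Iff.rfl (forall₂_congr fun i hi => forall_congr' fun b => ?_)
  rw [State.setArr_arr, if_neg (by omega)]

/-- The address of slot `j` of row `C` of the table `x`, for tables of `N` rows of `c + 1` slots. -/
def addr (N c x C j : ℕ) : ℕ := x * (N * (c + 1)) + (C * (c + 1) + j)

theorem slot_lt {N c C j : ℕ} (hC : C < N) (hj : j ≤ c) : C * (c + 1) + j < N * (c + 1) :=
  calc C * (c + 1) + j < (C + 1) * (c + 1) := by rw [Nat.succ_mul]; omega
    _ ≤ N * (c + 1) := Nat.mul_le_mul_right _ hC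

theorem table_disjoint {M x y q : ℕ} (h : y ≠ x) (hq : q < M) :
    y * M + q < x * M ∨ (x + 1) * M ≤ y * M + q := by
  rcases Nat.lt_or_gt_of_ne h with h | h
  · left
    calc y * M + q < (y + 1) * M := by rw [Nat.succ_mul]; omega
      _ ≤ x * M := Nat.mul_le_mul_right _ h
  · right
    exact (Nat.mul_le_mul_right _ h).trans (Nat.le_add_right _ _)

/-- The offsets of the three tables. -/
def convStart : Prog :=
  block [.op 23 .mul (.reg 20) (.reg 4), .op 24 .mul (.reg 21) (.reg 4),
    .op 25 .mul (.reg 22) (.reg 4), .op 26 .add (.const 0) (.const 0)]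

/-- The best values are initialized with those of `X`. -/
def convInitBody : Prog :=
  block [.op 27 .mul (.reg 26) (.reg 5), .op 27 .add (.reg 27) (.reg 1),
    .op 27 .add (.reg 23) (.reg 27), .load 28 12 (.reg 27), .store 13 (.reg 26) (.reg 28),
    .store 14 (.reg 26) (.reg 3)]

/-- The pair of masks in register 26 is compared with the best one for its union. -/
def convBestBody : Prog :=
  block [.load 27 5 (.reg 26), .load 28 6 (.reg 26),
    .op 29 .mul (.reg 27) (.reg 5), .op 29 .add (.reg 29) (.reg 1),
    .op 29 .add (.reg 24) (.reg 29), .load 29 12 (.reg 29),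
    .op 30 .mul (.reg 28) (.reg 5), .op 30 .add (.reg 30) (.reg 1),
    .op 30 .add (.reg 25) (.reg 30), .load 30 12 (.reg 30),
    .op 29 .add (.reg 29) (.reg 30), .op 27 .add (.reg 27) (.reg 28), .load 30 13 (.reg 27),
    .ite (.lt (.reg 30) (.reg 29))
      (block [.store 13 (.reg 27) (.reg 29), .store 14 (.reg 27) (.reg 26)]) .skip]

/-- Memory cell number `reg 26` of `X` is rewritten according to the best pair of masks. -/
def convCopyBody : Prog :=
  block [.op 27 .div (.reg 26) (.reg 5), .op 28 .mod (.reg 26) (.reg 5), .load 29 14 (.reg 27),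
    .ite (.lt (.reg 29) (.reg 3))
      (block [.load 30 5 (.reg 29), .op 30 .mul (.reg 30) (.reg 5),
        .op 30 .add (.reg 30) (.reg 28), .op 30 .add (.reg 24) (.reg 30), .load 30 12 (.reg 30),
        .load 31 6 (.reg 29), .op 31 .mul (.reg 31) (.reg 5),
        .op 31 .add (.reg 31) (.reg 28), .op 31 .add (.reg 25) (.reg 31), .load 31 12 (.reg 31),
        .op 30 .add (.reg 30) (.reg 31), .op 27 .add (.reg 23) (.reg 26),
        .store 12 (.reg 27) (.reg 30)]) .skip]

/-- Registers 1-5 hold `c`, `2 ^ c`, `3 ^ c`, the size of a table and the size of a row; memories 5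
and 6 hold the two parts of the ternary numbers; registers 20, 21, 22 hold the numbers of the tables
`X`, `Y`, `Z`, which lie in memory 12. The table `X` is replaced by the row-wise maximum of `X` and
of the subset convolution of `Y` and `Z`. -/
def conv : Prog :=
  .seq convStart (.seq (loop 26 (.reg 2) convInitBody)
    (.seq (.op 26 .add (.const 0) (.const 0)) (.seq (loop 26 (.reg 3) convBestBody)
      (.seq (.op 26 .add (.const 0) (.const 0)) (loop 26 (.reg 4) convCopyBody)))))

/-- The input conditions of `conv`. -/
structure ConvPre (L N N₃ c x y z H : ℕ) (D E : ℕ → ℕ) (s : State) : Prop where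
  r1 : s.reg 1 = c
  r2 : s.reg 2 = N
  r3 : s.reg 3 = N₃
  r4 : s.reg 4 = N * (c + 1)
  r5 : s.reg 5 = c + 1
  r20 : s.reg 20 = x
  r21 : s.reg 21 = y
  r22 : s.reg 22 = z
  hD : ∀ t < N₃, s.arr 5 t = D t
  hE : ∀ t < N₃, s.arr 6 t = E t
  hDE : ∀ t < N₃, D t + E t < N
  hyx : y ≠ x
  hzx : z ≠ x
  hx : (x + 1) * (N * (c + 1)) < 2 ^ L
  hy : (y + 1) * (N * (c + 1)) < 2 ^ L
  hz : (z + 1) * (N * (c + 1)) < 2 ^ L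
  hN₃ : N₃ < 2 ^ L
  hX : ∀ C < N, ∀ j ≤ c, s.arr 12 (addr N c x C j) ≤ H
  hY : ∀ C < N, ∀ j ≤ c, s.arr 12 (addr N c y C j) ≤ H
  hZ : ∀ C < N, ∀ j ≤ c, s.arr 12 (addr N c z C j) ≤ H
  hHL : 2 * H < 2 ^ L

/-- `X'` is the row-wise maximum of `X` and of the subset convolution of `Y` and `Z`; the last
slot of a row is its value. -/
structure IsMaxConv (N N₃ c : ℕ) (D E : ℕ → ℕ) (X Y Z X' : ℕ → ℕ → ℕ) : Prop where
  row : ∀ C < N, (∀ j ≤ c, X' C j = X C j) ∨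
    ∃ t < N₃, D t + E t = C ∧ ∀ j ≤ c, X' C j = Y (D t) j + Z (E t) j
  le : ∀ C < N, X C c ≤ X' C c
  conv_le : ∀ t < N₃, Y (D t) c + Z (E t) c ≤ X' (D t + E t) c

/-- The table with number `x` in state `s`. -/
def State.table (s : State) (N c x C j : ℕ) : ℕ := s.arr 12 (addr N c x C j)

/-- The bookkeeping of the second loop of `conv` after `k` iterations, `k = 0` being its start. -/
structure BestInv (N N₃ c : ℕ) (D E : ℕ → ℕ) (X Y Z : ℕ → ℕ → ℕ) (k : ℕ) (s : State) : Prop where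
  best : ∀ C < N, (s.arr 14 C = N₃ ∧ s.arr 13 C = X C c) ∨
    ∃ t < N₃, s.arr 14 C = t ∧ D t + E t = C ∧ s.arr 13 C = Y (D t) c + Z (E t) c
  le : ∀ C < N, X C c ≤ s.arr 13 C
  conv_le : ∀ t < k, Y (D t) c + Z (E t) c ≤ s.arr 13 (D t + E t)

/-! ### Correctness and cost of the convolution -/

section
variable {L N N₃ c x y z H : ℕ} {D E : ℕ → ℕ} {s₀ : State}

theorem addr_lt {N c x C j : ℕ} (hC : C < N) (hj : j ≤ c) :
    addr N c x C j < (x + 1) * (N * (c + 1)) := by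
  have := slot_lt hC hj
  rw [addr, Nat.succ_mul]; omega

/-- The value `N₃` put into memory 14 is not the number of a pair; it marks that the old row of `X`
is still the best. -/
theorem convInit_runs (h : ConvPre L N N₃ c x y z H D E s₀) {s : State} (hf : Frame 23 13 s₀ s)
    (h23 : s.reg 23 = x * (N * (c + 1))) (h26 : s.reg 26 = 0) :
    Runs L (loop 26 (.reg 2) convInitBody) s (N * 9 + 1) fun s' => Frame 26 13 s s' ∧
      BestInv N N₃ c D E (s₀.table N c x) (s₀.table N c y) (s₀.table N c z) 0 s' := by
  have hxN : N < 2 ^ L := by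
    refine lt_of_le_of_lt ?_ h.hx
    nlinarith [Nat.zero_le (x * (N * (c + 1))), Nat.zero_le (N * c)]
  have := Runs.loop (L := L) (r := 26) (b := .reg 2) (p := convInitBody) (T := 7) (N := N)
    (fun k s' => s'.reg 26 = k ∧ Frame 26 13 s s' ∧ ∀ C < k, s'.arr 14 C = N₃ ∧
      s'.arr 13 C = s₀.table N c x C c) hxN ?_ ?_ (Nat.zero_le N) (s := s) ?_
  · refine this.mono (by omega) fun s' ⟨_, hf', hC⟩ => ⟨hf', fun C hC' => .inl (hC C hC'),
      fun C hC' => (hC C hC').2.ge, fun t ht => absurd ht (Nat.not_lt_zero _)⟩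
  · rintro k s' ⟨hk, hf', _⟩
    exact ⟨hk, by simp [hf'.1, hf.1, h.r2]⟩
  · rintro k s' hkN ⟨hk, hf', hC⟩
    have hlt := addr_lt (x := x) hkN (le_refl c)
    have h0 := slot_lt hkN (le_refl c)
    have h12 : ∀ a, s'.arr 12 a = s₀.arr 12 a := fun a => by
      rw [hf'.2 12 (by norm_num), hf.2 12 (by norm_num)]
    have hb := h.hX k hkN c le_rfl
    have hx := h.hx
    have hHL := h.hHL
    have hN₃ := h.hN₃
    refine (Runs.of_wp (?_ : wp L convInitBody _ s')).mono (by simp [convInitBody, block, cost])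
      fun _ h => h
    simp [convInitBody, block, wp, Op.eval, hk, hf'.1, hf.1, h23, h.r1, h.r5, h.r3, h12]
    unfold addr at hlt hb
    refine ⟨by omega, by omega, by omega, by omega, by omega, hf', ?_⟩
    · intro C hCk
      by_cases e : C = k
      · subst e; simp [State.table, addr]
      · simp [e, hC C (by omega)]
  · exact ⟨h26, Frame.refl _ _ _, fun C hC => absurd hC (Nat.not_lt_zero _)⟩

/-- Only the value slot `c` of each row is inspected, so a pair costs a constant number of steps,
independent of `c`; whole rows are left to the last loop. -/
theorem convBest_runs (h : ConvPre L N N₃ c x y z H D E s₀) {s : State} (hf : Frame 23 13 s₀ s)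
    (h24 : s.reg 24 = y * (N * (c + 1))) (h25 : s.reg 25 = z * (N * (c + 1)))
    (h26 : s.reg 26 = 0)
    (hs : BestInv N N₃ c D E (s₀.table N c x) (s₀.table N c y) (s₀.table N c z) 0 s) :
    Runs L (loop 26 (.reg 3) convBestBody) s (N₃ * 20 + 1) fun s' => Frame 26 13 s s' ∧
      BestInv N N₃ c D E (s₀.table N c x) (s₀.table N c y) (s₀.table N c z) N₃ s' := by
  have := Runs.loop (L := L) (r := 26) (b := .reg 3) (p := convBestBody) (T := 18) (N := N₃)
    (fun k s' => s'.reg 26 = k ∧ Frame 26 13 s s' ∧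
      BestInv N N₃ c D E (s₀.table N c x) (s₀.table N c y) (s₀.table N c z) k s')
    h.hN₃ ?_ ?_ (Nat.zero_le _) (s := s) ?_
  · exact this.mono (by omega) fun s' h => h.2
  · rintro k s' ⟨hk, hf', _⟩
    exact ⟨hk, by simp [hf'.1, hf.1, h.r3]⟩
  · rintro k s' hkN ⟨hk, hf', hI⟩
    have hDEk := h.hDE k hkN
    have hD : D k < N := by omega
    have hE : E k < N := by omega
    have hlt := addr_lt (x := y) hD (le_refl c)
    have hlt' := addr_lt (x := z) hE (le_refl c)
    have h12 : ∀ a, s'.arr 12 a = s₀.arr 12 a := fun a => by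
      rw [hf'.2 12 (by norm_num), hf.2 12 (by norm_num)]
    have h5 : s'.arr 5 k = D k := by
      rw [hf'.2 5 (by norm_num), hf.2 5 (by norm_num), h.hD k hkN]
    have h6 : s'.arr 6 k = E k := by
      rw [hf'.2 6 (by norm_num), hf.2 6 (by norm_num), h.hE k hkN]
    have hb := h.hY (D k) hD c le_rfl
    have hb' := h.hZ (E k) hE c le_rfl
    have hbx := h.hX (D k + E k) hDEk c le_rfl
    have hy := h.hy
    have hz := h.hz
    have hHL := h.hHL
    have hN₃ := h.hN₃
    have hNL : N < 2 ^ L := by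
      refine lt_of_le_of_lt ?_ h.hx
      nlinarith [Nat.zero_le (x * (N * (c + 1))), Nat.zero_le (N * c)]
    -- The stored best value is a slot of `X` or a sum of two slots, so it is at most `2 * H`.
    have h13 : s'.arr 13 (D k + E k) < 2 ^ L := by
      rcases (hI.best _ hDEk) with ⟨_, e⟩ | ⟨t, ht, _, e', e⟩
      · rw [e, State.table]; omega
      · rw [e, State.table, State.table]
        have := h.hDE t ht
        have := h.hY (D t) (by omega) c le_rfl
        have := h.hZ (E t) (by omega) c le_rfl
        omega
    refine (Runs.of_wp (?_ : wp L convBestBody _ s')).mono (by simp [convBestBody, block, cost])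
      fun _ h => h
    have hty : s₀.arr 12 (y * (N * (c + 1)) + (D k * (c + 1) + c)) = s₀.table N c y (D k) c := rfl
    have htz : s₀.arr 12 (z * (N * (c + 1)) + (E k * (c + 1) + c)) = s₀.table N c z (E k) c := rfl
    simp [convBestBody, block, wp, Op.eval, hk, hf'.1, hf.1, h24, h25, h.r1, h.r5, h5, h6, h12,
      Test.Holds, hty, htz]
    change s₀.table N c y (D k) c ≤ H at hb
    change s₀.table N c z (E k) c ≤ H at hb'
    unfold addr at hlt hlt'
    have hub : s₀.table N c y (D k) c + s₀.table N c z (E k) c ≤ 2 * H := by omega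
    refine ⟨by omega, by omega, by omega, by omega, by omega, by omega, by omega, by omega,
      by omega, by omega, by omega, by omega, h13, fun hlt => ⟨by omega, by omega, hf', ?_⟩,
      fun hge => ⟨hf', ?_⟩⟩
    · constructor
      · intro C hC
        by_cases e : C = D k + E k
        · exact .inr ⟨k, hkN, by simp [e]⟩
        · simpa [e] using hI.best C hC
      · intro C hC
        by_cases e : C = D k + E k
        · have := hI.le C hC
          subst e
          simp; omega
        · simpa [e] using hI.le C hC
      · intro t ht
        by_cases e : D t + E t = D k + E k
        · rcases Nat.lt_succ_iff_lt_or_eq.1 ht with ht | rfl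
          · have := hI.conv_le t ht
            rw [e] at this
            simp [e]; omega
          · simp
        · have : t ≠ k := by rintro rfl; exact e rfl
          simpa [e] using hI.conv_le t (by omega)
    · constructor
      · simpa using hI.best
      · simpa using hI.le
      · intro t ht
        rcases Nat.lt_succ_iff_lt_or_eq.1 ht with ht | rfl
        · simpa using hI.conv_le t ht
        · simpa using hge
  · exact ⟨h26, Frame.refl _ _ _, hs⟩

/-- The content of memory 12 after `k` iterations of the last loop of `conv`. -/
def copied (N N₃ c x y z : ℕ) (D E bt F : ℕ → ℕ) (k a : ℕ) : ℕ :=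
  let q := a - x * (N * (c + 1))
  let t := bt (q / (c + 1))
  if x * (N * (c + 1)) ≤ a ∧ q < k ∧ t < N₃ then
    F (addr N c y (D t) (q % (c + 1))) + F (addr N c z (E t) (q % (c + 1)))
  else F a

/-- Different tables occupy disjoint address ranges, so `Y` and `Z` can still be read in their
original form while `X` is being overwritten. -/
theorem copied_of_ne {bt F : ℕ → ℕ} {k w C j : ℕ} (hC : C < N) (hj : j ≤ c) (hw : w ≠ x)
    (hk : k ≤ N * (c + 1)) :
    copied N N₃ c x y z D E bt F k (addr N c w C j) = F (addr N c w C j) := by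
  rw [copied]
  refine if_neg fun ⟨h1, h2, _⟩ => ?_
  have := table_disjoint hw (slot_lt hC hj)
  rw [Nat.succ_mul] at this
  unfold addr at h1 h2
  omega

/-- The loop runs over single cells of `X`; quotient and remainder by `c + 1` recover row and slot.
Rows still marked `N₃` are left alone. -/
theorem convCopy_runs (h : ConvPre L N N₃ c x y z H D E s₀) {s : State} (hf : Frame 23 12 s₀ s)
    (h12 : ∀ a, s.arr 12 a = s₀.arr 12 a)
    (h23 : s.reg 23 = x * (N * (c + 1)))
    (h24 : s.reg 24 = y * (N * (c + 1))) (h25 : s.reg 25 = z * (N * (c + 1)))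
    (h26 : s.reg 26 = 0) (hbt : ∀ C < N, s.arr 14 C ≤ N₃) :
    Runs L (loop 26 (.reg 4) convCopyBody) s (N * (c + 1) * 22 + 1) fun s' => Frame 23 12 s s' ∧
      ∀ a, s'.arr 12 a =
        copied N N₃ c x y z D E (s.arr 14) (s₀.arr 12) (N * (c + 1)) a := by
  have hxL : N * (c + 1) < 2 ^ L := by
    refine lt_of_le_of_lt ?_ h.hx
    rw [Nat.succ_mul]; omega
  have := Runs.loop (L := L) (r := 26) (b := .reg 4) (p := convCopyBody) (T := 20)
    (N := N * (c + 1))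
    (fun k s' => s'.reg 26 = k ∧ Frame 26 12 s s' ∧ (∀ a, s'.arr 14 a = s.arr 14 a) ∧
      ∀ a, s'.arr 12 a = copied N N₃ c x y z D E (s.arr 14) (s₀.arr 12) k a)
    hxL ?_ ?_ (Nat.zero_le _) (s := s) ?_
  · exact this.mono (by omega) fun s' h => ⟨h.2.1.trans (Frame.refl 26 12 _) (by norm_num)
      (by norm_num) (by norm_num) (by norm_num), h.2.2.2⟩
  · rintro k s' ⟨hk, hf', _⟩
    exact ⟨hk, by simp [hf'.1, hf.1, h.r4]⟩
  · rintro k s' hkN ⟨hk, hf', hI14, hI⟩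
    have hC : k / (c + 1) < N := Nat.div_lt_of_lt_mul (by rwa [mul_comm])
    have hj : k % (c + 1) ≤ c := Nat.lt_succ_iff.1 (Nat.mod_lt _ (Nat.succ_pos c))
    have hCk : k / (c + 1) ≤ k := Nat.div_le_self _ _
    have hx := h.hx
    have hx' : x * (N * (c + 1)) + N * (c + 1) < 2 ^ L := by rwa [Nat.succ_mul] at hx
    have hy := h.hy
    have hz := h.hz
    have hHL := h.hHL
    have hN₃ := h.hN₃
    have hbtC := hbt _ hC
    have hmod : k % (c + 1) ≤ k := Nat.mod_le _ _
    refine (Runs.of_wp (?_ : wp L convCopyBody _ s')).mono (by simp [convCopyBody, block, cost])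
      fun _ h => h
    simp [convCopyBody, block, wp, Op.eval, hk, hf'.1, hf.1, h23, h24, h25, h.r3, h.r5,
      Test.Holds, hI14]
    refine ⟨by omega, by omega, by omega, fun hlt => ?_, fun hge => ⟨hf', fun a => ?_⟩⟩
    · set t := s.arr 14 (k / (c + 1)) with ht
      have h5 : s'.arr 5 t = D t := by
        rw [hf'.2 5 (by norm_num), hf.2 5 (by norm_num), h.hD t hlt]
      have h6 : s'.arr 6 t = E t := by
        rw [hf'.2 6 (by norm_num), hf.2 6 (by norm_num), h.hE t hlt]
      have hDEk := h.hDE t hlt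
      have hD : D t < N := by omega
      have hE : E t < N := by omega
      have hlt1 := addr_lt (x := y) hD hj
      have hlt2 := addr_lt (x := z) hE hj
      have hb := h.hY (D t) hD (k % (c + 1)) hj
      have hb' := h.hZ (E t) hE (k % (c + 1)) hj
      have e1 : s'.arr 12 (y * (N * (c + 1)) + (D t * (c + 1) + k % (c + 1))) =
          s₀.arr 12 (addr N c y (D t) (k % (c + 1))) := by
        rw [hI]; exact copied_of_ne hD hj h.hyx hkN.le
      have e2 : s'.arr 12 (z * (N * (c + 1)) + (E t * (c + 1) + k % (c + 1))) =
          s₀.arr 12 (addr N c z (E t) (k % (c + 1))) := by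
        rw [hI]; exact copied_of_ne hE hj h.hzx hkN.le
      have hNL : N < 2 ^ L := by
        refine lt_of_le_of_lt ?_ hxL
        nlinarith [Nat.zero_le (N * c)]
      simp [h5, h6, e1, e2, hf']
      unfold addr at hlt1 hlt2
      refine ⟨by omega, by omega, by omega, by omega, by omega, by omega, by omega, by omega,
        by omega, by omega, by omega, by omega, by omega, fun a => ?_⟩
      by_cases ea : a = x * (N * (c + 1)) + k
      · subst ea
        simp [copied, ← ht, hlt]
      · simp only [ea, if_false, hI]
        unfold copied
        refine if_congr (and_congr_right fun h1 => and_congr_left fun _ => ?_) rfl rfl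
        omega
    · rw [hI]
      unfold copied
      refine if_congr (and_congr_right fun h1 => and_congr_left fun h2 => ?_) rfl rfl
      constructor
      · omega
      · intro h3
        by_contra h4
        have e : a - x * (N * (c + 1)) = k := by omega
        rw [e] at h2
        omega
  · refine ⟨h26, Frame.refl _ _ _, fun _ => rfl, fun a => ?_⟩
    rw [h12, copied, if_neg (by omega)]

/-- Besides preserving the other tables, the memory from table `x + 1` on is untouched cell by cell:
it has to stay zero to provide fresh tables later. -/
theorem conv_runs (h : ConvPre L N N₃ c x y z H D E s₀) :
    Runs L conv s₀ (N * (c + 1) * 22 + N * 9 + N₃ * 20 + 10) fun s' =>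
      Frame 23 12 s₀ s' ∧
      (∀ w ≠ x, ∀ C < N, ∀ j ≤ c, s'.table N c w C j = s₀.table N c w C j) ∧
      (∀ a, (x + 1) * (N * (c + 1)) ≤ a → s'.arr 12 a = s₀.arr 12 a) ∧
      IsMaxConv N N₃ c D E (s₀.table N c x) (s₀.table N c y) (s₀.table N c z)
        (s'.table N c x) := by
  have hx := h.hx
  have hy := h.hy
  have hz := h.hz
  have h0 : Runs L convStart s₀ 5 fun s => Frame 23 13 s₀ s ∧ s.reg 23 = x * (N * (c + 1)) ∧
      s.reg 24 = y * (N * (c + 1)) ∧ s.reg 25 = z * (N * (c + 1)) ∧ s.reg 26 = 0 := by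
    refine (Runs.of_wp (?_ : wp L convStart _ s₀)).mono (by simp [convStart, block, cost])
      fun _ h => h
    simp [convStart, block, wp, Op.eval, h.r20, h.r21, h.r22, h.r4, Frame.refl]
    rw [Nat.succ_mul] at hx hy hz
    omega
  have hpos : (0 : ℕ) < 2 ^ L := by positivity
  refine (h0.seq (T' := (N * 9 + 1) + (1 + ((N₃ * 20 + 1) + (1 + (N * (c + 1) * 22 + 1)))))
    fun s₁ ⟨f₁, a₁, b₁, c₁, d₁⟩ => (convInit_runs h f₁ a₁ d₁).seq fun s₂ ⟨f₂, i₂⟩ =>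
      Runs.seq (R := fun s => Frame 26 15 s₂ s ∧ s.reg 26 = 0)
        (Runs.of_wp (p := .op 26 .add (.const 0) (.const 0)) ?_) fun s₃ ⟨f₃, d₃⟩ => ?_).mono
      (by omega) fun _ h => h
  · simp [wp, Op.eval, Frame.refl, hpos]
  have f₀₂ : Frame 23 13 s₀ s₂ := f₁.trans f₂ (by norm_num) (by norm_num) (by norm_num)
    (by norm_num)
  have f₀₃ : Frame 23 13 s₀ s₃ := f₀₂.trans f₃ (by norm_num) (by norm_num) (by norm_num)
    (by norm_num)
  have r₃ : ∀ i < 26, s₃.reg i = s₁.reg i := fun i hi => by rw [f₃.1 i hi, f₂.1 i hi]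
  have i₃ : BestInv N N₃ c D E (s₀.table N c x) (s₀.table N c y) (s₀.table N c z) 0 s₃ := by
    constructor
    · simpa only [f₃.2 14 (by norm_num), f₃.2 13 (by norm_num)] using i₂.best
    · simpa only [f₃.2 14 (by norm_num), f₃.2 13 (by norm_num)] using i₂.le
    · simpa only [f₃.2 14 (by norm_num), f₃.2 13 (by norm_num)] using i₂.conv_le
  refine (convBest_runs h f₀₃ (by rw [r₃ _ (by norm_num), b₁]) (by rw [r₃ _ (by norm_num), c₁])
    d₃ i₃).seq fun s₄ ⟨f₄, i₄⟩ => ?_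
  refine Runs.seq (R := fun s => Frame 26 15 s₄ s ∧ s.reg 26 = 0)
        (Runs.of_wp (p := .op 26 .add (.const 0) (.const 0)) ?_) fun s₅ ⟨f₅, d₅⟩ => ?_
  · simp [wp, Op.eval, Frame.refl, hpos]
  have f₀₅ : Frame 23 13 s₀ s₅ := (f₀₃.trans f₄ (r'' := 23) (m'' := 13) (by norm_num) (by norm_num)
    (by norm_num) (by norm_num)).trans f₅ (by norm_num) (by norm_num) (by norm_num) (by norm_num)
  have r₅ : ∀ i < 26, s₅.reg i = s₁.reg i := fun i hi => by
    rw [f₅.1 i hi, f₄.1 i hi, r₃ i hi]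
  have b₅ : ∀ C, s₅.arr 14 C = s₄.arr 14 C := f₅.2 14 (by norm_num)
  refine (convCopy_runs h (f₀₅.trans (Frame.refl 23 13 _) (by norm_num) (by norm_num) (by norm_num)
    (by norm_num)) (f₀₅.2 12 (by norm_num)) (by rw [r₅ _ (by norm_num), a₁])
    (by rw [r₅ _ (by norm_num), b₁]) (by rw [r₅ _ (by norm_num), c₁]) d₅ ?_).mono le_rfl
    fun s₆ ⟨f₆, i₆⟩ => ⟨f₀₅.trans f₆ (by norm_num) (by norm_num) (by norm_num) (by norm_num),
      fun w hw C hC j hj => ?_, fun a ha => ?_, ?_⟩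
  · intro C hC
    rw [b₅]
    rcases i₄.best C hC with ⟨e, _⟩ | ⟨t, ht, e, _⟩ <;> omega
  · rw [State.table, i₆]
    exact copied_of_ne hC hj hw le_rfl
  · rw [i₆, copied, if_neg]
    rw [Nat.succ_mul] at ha
    omega
  · have key : ∀ C < N, ∀ j ≤ c, s₆.table N c x C j = if s₄.arr 14 C < N₃ then
        s₀.table N c y (D (s₄.arr 14 C)) j + s₀.table N c z (E (s₄.arr 14 C)) j
        else s₀.table N c x C j := by
      intro C hC j hj
      have hq := slot_lt hC hj
      have hj' : j < c + 1 := by omega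
      have e1 : (C * (c + 1) + j) / (c + 1) = C := by
        rw [mul_comm, Nat.mul_add_div (by omega), Nat.div_eq_of_lt hj', add_zero]
      have e2 : (C * (c + 1) + j) % (c + 1) = j := by
        rw [mul_comm, Nat.mul_add_mod, Nat.mod_eq_of_lt hj']
      rw [State.table, i₆, copied]
      simp only [addr, Nat.add_sub_cancel_left, Nat.le_add_right, true_and, hq, e1, e2, b₅,
        State.table]
    have hval : ∀ C < N, s₆.table N c x C c = s₄.arr 13 C := by
      intro C hC
      rw [key C hC c le_rfl]
      rcases i₄.best C hC with ⟨e, e'⟩ | ⟨t, ht, e, _, e'⟩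
      · rw [e, if_neg (lt_irrefl _), e']
      · rw [e, if_pos ht, e']
    constructor
    · intro C hC
      rcases i₄.best C hC with ⟨e, e'⟩ | ⟨t, ht, e, eC, e'⟩
      · left
        intro j hj
        rw [key C hC j hj, e, if_neg (lt_irrefl _)]
      · right
        refine ⟨t, ht, eC, fun j hj => ?_⟩
        rw [key C hC j hj, e, if_pos ht]
    · intro C hC
      rw [hval C hC]
      exact i₄.le C hC
    · intro t ht
      rw [hval _ (h.hDE t ht)]
      exact i₄.conv_le t ht

end
end WordRAM

/-! ### Ternary numbers as pairs of disjoint bit masks -/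

/-- The mask of the ternary digits 1 of `t`. -/
def ternFst (t : ℕ) : ℕ := if t = 0 then 0 else 2 * ternFst (t / 3) + t % 3 % 2
decreasing_by omega

/-- The mask of the ternary digits 2 of `t`. -/
def ternSnd (t : ℕ) : ℕ := if t = 0 then 0 else 2 * ternSnd (t / 3) + t % 3 / 2
decreasing_by omega

theorem ternFst_eq (t : ℕ) : ternFst t = 2 * ternFst (t / 3) + t % 3 % 2 := by
  by_cases h : t = 0
  · subst h; simp [ternFst]
  · rw [ternFst, if_neg h]

theorem ternSnd_eq (t : ℕ) : ternSnd t = 2 * ternSnd (t / 3) + t % 3 / 2 := by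
  by_cases h : t = 0
  · subst h; simp [ternSnd]
  · rw [ternSnd, if_neg h]

theorem ternFst_zero : ternFst 0 = 0 := by simp [ternFst]

theorem ternSnd_zero : ternSnd 0 = 0 := by simp [ternSnd]

/-- A ternary digit puts at most a single `1` into its position in the two masks together. -/
theorem tern_add_lt {c t : ℕ} (h : t < 3 ^ c) : ternFst t + ternSnd t < 2 ^ c := by
  induction c generalizing t with
  | zero =>
    obtain rfl : t = 0 := by simpa using h
    simp [ternFst_zero, ternSnd_zero]
  | succ c ih =>
    have := @ih (t / 3) (by rw [pow_succ] at h; omega)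
    rw [ternFst_eq, ternSnd_eq, pow_succ]
    have : t % 3 < 3 := Nat.mod_lt _ (by norm_num)
    omega

/-- No position is set in both masks, so their sum has no carries and is their union. -/
theorem tern_testBit (t j : ℕ) :
    ((ternFst t + ternSnd t).testBit j ↔ (ternFst t).testBit j ∨ (ternSnd t).testBit j) ∧
      ¬ ((ternFst t).testBit j ∧ (ternSnd t).testBit j) := by
  induction j generalizing t with
  | zero =>
    rw [ternFst_eq, ternSnd_eq]
    simp only [Nat.testBit_zero, decide_eq_true_eq]
    have : t % 3 < 3 := Nat.mod_lt _ (by norm_num)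
    omega
  | succ j ih =>
    have h := ih (t / 3)
    have : t % 3 < 3 := Nat.mod_lt _ (by norm_num)
    have e1 : ternFst t / 2 = ternFst (t / 3) := by rw [ternFst_eq t]; omega
    have e2 : ternSnd t / 2 = ternSnd (t / 3) := by rw [ternSnd_eq t]; omega
    have e3 : (ternFst t + ternSnd t) / 2 = ternFst (t / 3) + ternSnd (t / 3) := by
      rw [ternFst_eq t, ternSnd_eq t]; omega
    simpa only [Nat.testBit_succ, e1, e2, e3] using h

/-- Every partition of the bits of `C` into two parts is given by a ternary number. -/
theorem exists_tern {c C : ℕ} (hC : C < 2 ^ c) (p : ℕ → Prop) :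
    ∃ t < 3 ^ c, ternFst t + ternSnd t = C ∧
      (∀ j, (ternFst t).testBit j ↔ C.testBit j ∧ p j) ∧
      ∀ j, (ternSnd t).testBit j ↔ C.testBit j ∧ ¬ p j := by
  -- The second mask is the complement of the first in `C`, by `tern_testBit`.
  suffices h : ∃ t < 3 ^ c, ternFst t + ternSnd t = C ∧
      ∀ j, (ternFst t).testBit j ↔ C.testBit j ∧ p j by
    obtain ⟨t, ht, hs, hb⟩ := h
    refine ⟨t, ht, hs, hb, fun j => ?_⟩
    have := tern_testBit t j
    rw [hs, hb] at this
    tauto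
  induction c generalizing C p with
  | zero =>
    obtain rfl : C = 0 := by simpa using hC
    exact ⟨0, by simp [ternFst_zero, ternSnd_zero]⟩
  | succ c ih =>
    obtain ⟨t, ht, hs, hb⟩ := @ih (C / 2) (by rw [pow_succ] at hC; omega) fun j => p (j + 1)
    classical
    -- The lowest digit says whether bit `0` is absent, in the first part or in the second part.
    let b := if C % 2 = 0 then 0 else if p 0 then 1 else 2
    have hb3 : b < 3 := by simp only [b]; split_ifs <;> norm_num
    have e : (3 * t + b) / 3 = t := by omega
    have e' : (3 * t + b) % 3 = b := by omega
    refine ⟨3 * t + b, by rw [pow_succ]; omega, ?_, ?_⟩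
    · rw [ternFst_eq, ternSnd_eq, e, e']
      have : b % 2 + b / 2 = C % 2 := by
        simp only [b]; split_ifs <;> omega
      omega
    · intro j
      rw [ternFst_eq, e, e']
      cases j with
      | zero =>
        simp only [Nat.testBit_zero, decide_eq_true_eq, b]
        split_ifs with h1 h2
        · omega
        · simp [h2]; omega
        · simp [h2]
      | succ j =>
        rw [Nat.testBit_succ, Nat.testBit_succ, ← hb, show (2 * ternFst t + b % 2) / 2 = ternFst t
          by omega]

/-! ### Colorful independent sets and tables -/

namespace WordRAM

section Tables

variable {H : SimpleGraph ℕ} {cl wt : ℕ → ℕ} {c : ℕ}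

/-- `S` is a colorful independent subset of `P` with colors in the mask `C`. -/
def Feasible (H : SimpleGraph ℕ) (cl : ℕ → ℕ) (P : Set ℕ) (C : ℕ) (S : Finset ℕ) : Prop :=
  (S : Set ℕ) ⊆ P ∧ IsColorfulIndepSet H cl S ∧ ∀ v ∈ S, C.testBit (cl v)

/-- Slot `j < c` of `r` holds the element of `S` of color `j`, or zero; slot `c` holds the weight. -/
def Encodes (cl wt : ℕ → ℕ) (c : ℕ) (r : ℕ → ℕ) (S : Finset ℕ) : Prop :=
  (∀ j < c, ∀ v, v ≠ 0 → (r j = v ↔ v ∈ S ∧ cl v = j)) ∧ r c = ∑ v ∈ S, wt v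

/-- Every row of the table `X` encodes a feasible set. -/
def Sound (H : SimpleGraph ℕ) (cl wt : ℕ → ℕ) (c : ℕ) (P : Set ℕ) (X : ℕ → ℕ → ℕ) : Prop :=
  ∀ C < 2 ^ c, ∃ S, Feasible H cl P C S ∧ Encodes cl wt c (X C) S

/-- The values of the rows of `X` are upper bounds. -/
def Complete (H : SimpleGraph ℕ) (cl wt : ℕ → ℕ) (c : ℕ) (P : Set ℕ) (X : ℕ → ℕ → ℕ) : Prop :=
  ∀ C < 2 ^ c, ∀ S, Feasible H cl P C S → ∑ v ∈ S, wt v ≤ X C c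

/-- No element of `P` is equal or adjacent to an element of `Q`. -/
def Apart (H : SimpleGraph ℕ) (P Q : Set ℕ) : Prop :=
  ∀ x ∈ P, ∀ y ∈ Q, x ≠ y ∧ ¬ H.Adj x y

theorem Feasible.mono {P Q : Set ℕ} {C : ℕ} {S : Finset ℕ} (h : Feasible H cl P C S)
    (hPQ : P ⊆ Q) : Feasible H cl Q C S :=
  ⟨h.1.trans hPQ, h.2⟩

theorem Sound.mono {P Q : Set ℕ} {X : ℕ → ℕ → ℕ} (h : Sound H cl wt c P X)
    (hPQ : P ⊆ Q) : Sound H cl wt c Q X := fun C hC => by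
  obtain ⟨S, h1, h2⟩ := h C hC
  exact ⟨S, h1.mono hPQ, h2⟩

theorem Sound.congr {P : Set ℕ} {X X' : ℕ → ℕ → ℕ} (h : Sound H cl wt c P X)
    (hX : ∀ C < 2 ^ c, ∀ j ≤ c, X' C j = X C j) : Sound H cl wt c P X' := fun C hC => by
  obtain ⟨S, h1, h2⟩ := h C hC
  refine ⟨S, h1, fun j hj v hv => ?_, ?_⟩
  · rw [hX C hC j hj.le, h2.1 j hj v hv]
  · rw [hX C hC c le_rfl, h2.2]

theorem Complete.congr {P : Set ℕ} {X X' : ℕ → ℕ → ℕ} (h : Complete H cl wt c P X)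
    (hX : ∀ C < 2 ^ c, ∀ j ≤ c, X' C j = X C j) : Complete H cl wt c P X' := fun C hC S hS => by
  rw [hX C hC c le_rfl]
  exact h C hC S hS

theorem feasible_empty {P : Set ℕ} {C : ℕ} : Feasible H cl P C ∅ := by
  simp [Feasible, IsColorfulIndepSet, SimpleGraph.IsIndepSet]

/-- Zero rows encode the empty set, so untouched memory already is a legitimate table. -/
theorem sound_zero {P : Set ℕ} {X : ℕ → ℕ → ℕ} (hX : ∀ C < 2 ^ c, ∀ j ≤ c, X C j = 0) :
    Sound H cl wt c P X := fun C hC => by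
  refine ⟨∅, feasible_empty, fun j hj v hv => ?_, ?_⟩
  · simp [hX C hC j hj.le, hv.symm]
  · simp [hX C hC c le_rfl]

theorem complete_empty {X : ℕ → ℕ → ℕ} : Complete H cl wt c ∅ X := fun C _ S hS => by
  obtain rfl : S = ∅ := by simpa using hS.1
  simp

/-- Independence survives because `P` and `Q` are apart, distinctness of colors because the two
masks are disjoint. -/
theorem Feasible.union {P Q : Set ℕ} {t : ℕ} {S S' : Finset ℕ} (hPQ : Apart H P Q)
    (h : Feasible H cl P (ternFst t) S) (h' : Feasible H cl Q (ternSnd t) S') :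
    Feasible H cl (P ∪ Q) (ternFst t + ternSnd t) (S ∪ S') := by
  have hd : ∀ x ∈ S, ∀ y ∈ S', cl x ≠ cl y := fun x hx y hy e =>
    (tern_testBit t (cl x)).2 ⟨h.2.2 x hx, e ▸ h'.2.2 y hy⟩
  refine ⟨?_, ⟨?_, ?_⟩, ?_⟩
  · rw [Finset.coe_union]
    exact Set.union_subset_union h.1 h'.1
  · intro x hx y hy hxy
    simp only [Finset.coe_union, Set.mem_union, Finset.mem_coe] at hx hy
    rcases hx with hx | hx <;> rcases hy with hy | hy
    · exact h.2.1.1 hx hy hxy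
    · exact (hPQ x (h.1 hx) y (h'.1 hy)).2
    · exact fun e => (hPQ y (h.1 hy) x (h'.1 hx)).2 e.symm
    · exact h'.2.1.1 hx hy hxy
  · intro x hx y hy hxy
    simp only [Finset.coe_union, Set.mem_union, Finset.mem_coe] at hx hy
    rcases hx with hx | hx <;> rcases hy with hy | hy
    · exact h.2.1.2 hx hy hxy
    · exact (hd x hx y hy hxy).elim
    · exact (hd y hy x hx hxy.symm).elim
    · exact h'.2.1.2 hx hy hxy
  · intro x hx
    rw [(tern_testBit t _).1]
    rcases Finset.mem_union.1 hx with hx | hx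
    · exact .inl (h.2.2 x hx)
    · exact .inr (h'.2.2 x hx)

theorem Encodes.eq_zero {r : ℕ → ℕ} {S : Finset ℕ} (h : Encodes cl wt c r S) {j : ℕ} (hj : j < c)
    (hS : ∀ v ∈ S, cl v ≠ j) : r j = 0 := by
  by_contra h0
  obtain ⟨h1, h2⟩ := (h.1 j hj (r j) h0).1 rfl
  exact hS _ h1 h2

/-- For each color at most one of the two slots is nonzero, so their sum is the slot of the union.
The weights add since the sets are disjoint. -/
theorem Encodes.add {r r' : ℕ → ℕ} {S S' : Finset ℕ} (h : Encodes cl wt c r S)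
    (h' : Encodes cl wt c r' S') (hd : ∀ x ∈ S, ∀ y ∈ S', cl x ≠ cl y) :
    Encodes cl wt c (fun j => r j + r' j) (S ∪ S') := by
  refine ⟨fun j hj v hv => ?_, ?_⟩
  · have h1 := h.1 j hj v hv
    have h2 := h'.1 j hj v hv
    simp only [Finset.mem_union]
    by_cases hS : ∀ v ∈ S, cl v ≠ j
    · rw [h.eq_zero hj hS, zero_add, h2]
      refine ⟨fun e => ⟨.inr e.1, e.2⟩, fun ⟨e, e'⟩ => ⟨e.resolve_left fun e => hS v e e', e'⟩⟩
    · push Not at hS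
      obtain ⟨u, hu, hj'⟩ := hS
      have hS' : ∀ v ∈ S', cl v ≠ j := fun y hy e => hd u hu y hy (hj'.trans e.symm)
      rw [h'.eq_zero hj hS', add_zero, h1]
      refine ⟨fun e => ⟨.inl e.1, e.2⟩, fun ⟨e, e'⟩ => ⟨e.resolve_right fun e => hS' v e e', e'⟩⟩
  · show r c + r' c = _
    rw [Finset.sum_union, h.2, h'.2]
    exact Finset.disjoint_left.2 fun x hx hx' => hd x hx x hx' rfl

/-- A row is either inherited from `X` or encodes a union over disjoint masks. `R` may exceed `P ∪
Q`, which is needed when `X` also uses neighbors of the vertex being added. -/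
theorem IsMaxConv.sound {P Q R : Set ℕ} {X Y Z X' : ℕ → ℕ → ℕ}
    (h : IsMaxConv (2 ^ c) (3 ^ c) c ternFst ternSnd X Y Z X') (hX : Sound H cl wt c R X)
    (hY : Sound H cl wt c P Y) (hZ : Sound H cl wt c Q Z) (hPQ : Apart H P Q)
    (hR : P ∪ Q ⊆ R) : Sound H cl wt c R X' := by
  intro C hC
  rcases h.row C hC with e | ⟨t, ht, rfl, e⟩
  · obtain ⟨S, h1, h2⟩ := hX C hC
    exact ⟨S, h1, fun j hj v hv => by rw [e j hj.le, h2.1 j hj v hv], by rw [e c le_rfl, h2.2]⟩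
  · obtain ⟨S, h1, h2⟩ := hY (ternFst t) (by omega)
    obtain ⟨S', h1', h2'⟩ := hZ (ternSnd t) (by omega)
    have h3 := h2.add h2' fun x hx y hy e =>
      (tern_testBit t (cl x)).2 ⟨h1.2.2 x hx, e ▸ h1'.2.2 y hy⟩
    exact ⟨S ∪ S', (h1.union hPQ h1').mono hR,
      fun j hj v hv => by rw [e j hj.le, ← h3.1 j hj v hv], by rw [e c le_rfl, ← h3.2]⟩

theorem Feasible.subset {P Q : Set ℕ} {C C' : ℕ} {S S' : Finset ℕ} (h : Feasible H cl P C S)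
    (hS : S' ⊆ S) (hQ : (S' : Set ℕ) ⊆ Q) (hC : ∀ v ∈ S', C'.testBit (cl v)) :
    Feasible H cl Q C' S' :=
  ⟨hQ, ⟨fun _ hx _ hy hxy => h.2.1.1 (hS hx) (hS hy) hxy,
    fun _ hx _ hy hxy => h.2.1.2 (hS hx) (hS hy) hxy⟩, hC⟩

/-- The colors of `S` inside `P` form the first mask, the rest of `C` the second. Since colors are
not repeated in `S`, the elements outside `P` have their colors in the second mask. -/
theorem IsMaxConv.complete {P Q : Set ℕ} {X Y Z X' : ℕ → ℕ → ℕ}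
    (h : IsMaxConv (2 ^ c) (3 ^ c) c ternFst ternSnd X Y Z X')
    (hY : Complete H cl wt c P Y) (hZ : Complete H cl wt c Q Z) :
    Complete H cl wt c (P ∪ Q) X' := by
  intro C hC S hS
  classical
  obtain ⟨t, ht, rfl, h1, h2⟩ := exists_tern hC fun j => ∃ v ∈ S, v ∈ P ∧ cl v = j
  refine le_trans ?_ (h.conv_le t ht)
  rw [← Finset.sum_filter_add_sum_filter_not S (· ∈ P)]
  refine add_le_add (hY _ (by omega) _ (hS.subset (Finset.filter_subset _ _) ?_ ?_))
    (hZ _ (by omega) _ (hS.subset (Finset.filter_subset _ _) ?_ ?_))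
  · intro x hx
    exact (Finset.mem_filter.1 hx).2
  · intro x hx
    rw [Finset.mem_filter] at hx
    exact (h1 _).2 ⟨hS.2.2 x hx.1, x, hx.1, hx.2, rfl⟩
  · intro x hx
    rw [Finset.mem_coe, Finset.mem_filter] at hx
    exact (hS.1 hx.1).resolve_left hx.2
  · intro x hx
    rw [Finset.mem_filter] at hx
    refine (h2 _).2 ⟨hS.2.2 x hx.1, ?_⟩
    rintro ⟨y, hy, hyP, e⟩
    exact hx.2 (hS.2.1.2 hx.1 hy e.symm ▸ hyP)

/-- The table whose only nonzero row represents `{v}`. -/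
def IsSingletonTable (cl wt : ℕ → ℕ) (c v : ℕ) (Z : ℕ → ℕ → ℕ) : Prop :=
  ∀ C < 2 ^ c, ∀ j ≤ c, Z C j =
    if C = 2 ^ cl v then (if j = c then wt v else if j = cl v then v else 0) else 0

/-- Larger masks containing the color of `v` get the empty set as well; this is sound, and the
convolution can always be made to use the exact mask. -/
theorem IsSingletonTable.sound {v : ℕ} {Z : ℕ → ℕ → ℕ} (h : IsSingletonTable cl wt c v Z)
    (hv : cl v < c) : Sound H cl wt c {v} Z := by
  intro C hC
  by_cases e : C = 2 ^ cl v
  · refine ⟨{v}, ⟨by simp, ⟨by simp [SimpleGraph.IsIndepSet], by simp⟩, ?_⟩, ?_, ?_⟩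
    · simp [e]
    · intro j hj u hu
      rw [h C hC j hj.le, if_pos e, if_neg hj.ne]
      split_ifs with hj'
      · simp only [Finset.mem_singleton]
        constructor
        · rintro rfl; exact ⟨rfl, hj'.symm⟩
        · exact fun h => h.1.symm
      · simp only [Finset.mem_singleton]
        refine ⟨fun h0 => (hu h0.symm).elim, ?_⟩
        rintro ⟨rfl, h'⟩
        exact (hj' h'.symm).elim
    · rw [h C hC c le_rfl, if_pos e, if_pos rfl]
      simp
  · refine ⟨∅, feasible_empty, fun j hj u hu => ?_, ?_⟩
    · rw [h C hC j hj.le, if_neg e]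
      simpa using hu.symm
    · rw [h C hC c le_rfl, if_neg e]
      simp

/-- If `Y` solves the problem on the non-neighbors of `v`, and `X` on the set without `v`, then the
maximum of `X` and of the convolution of `Y` with the singleton table of `v` solves it. -/
theorem IsMaxConv.complete_insert {P Q : Set ℕ} {v : ℕ} {X Y Z X' : ℕ → ℕ → ℕ}
    (h : IsMaxConv (2 ^ c) (3 ^ c) c ternFst ternSnd X Y Z X')
    (hX : Complete H cl wt c P X) (hY : Complete H cl wt c Q Y)
    (hZ : IsSingletonTable cl wt c v Z) (hv : cl v < c)
    (hQ : ∀ x ∈ P, ¬ H.Adj v x → x ≠ v → x ∈ Q) :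
    Complete H cl wt c (insert v P) X' := by
  intro C hC S hS
  by_cases hvS : v ∈ S
  -- The color of `v` alone forms the second mask, so the singleton table is read in the row of
  -- `{v}`.
  · obtain ⟨t, ht, rfl, h1, h2⟩ := exists_tern hC fun j => j ≠ cl v
    have hE : ternSnd t = 2 ^ cl v := by
      refine Nat.eq_of_testBit_eq fun j => ?_
      rw [Bool.eq_iff_iff, h2, Nat.testBit_two_pow, decide_eq_true_eq, not_not]
      refine ⟨fun h => h.2.symm, ?_⟩
      rintro rfl
      exact ⟨hS.2.2 v hvS, rfl⟩
    refine le_trans ?_ (h.conv_le t ht)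
    rw [hZ _ (by omega) c le_rfl, if_pos hE, if_pos rfl, ← Finset.sum_erase_add _ _ hvS]
    refine Nat.add_le_add_right (hY _ (by omega) _ (hS.subset (Finset.erase_subset _ _) ?_ ?_)) _
    · intro x hx
      obtain ⟨hxv, hx⟩ := Finset.mem_erase.1 hx
      exact hQ x ((hS.1 hx).resolve_left hxv) (hS.2.1.1 hvS hx hxv.symm) hxv
    · intro x hx
      obtain ⟨hxv, hx⟩ := Finset.mem_erase.1 hx
      exact (h1 _).2 ⟨hS.2.2 x hx, fun e => hxv (hS.2.1.2 hx hvS e)⟩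
  · refine le_trans (hX C hC S ⟨fun x hx => (hS.1 hx).resolve_left ?_, hS.2⟩) (h.le C hC)
    rintro rfl
    exact hvS hx

/-- A color slot is zero or a vertex of `P`, and the value slot is the weight of a subset; one
common bound for both serves against overflow. -/
theorem Sound.le {P : Set ℕ} {X : ℕ → ℕ → ℕ} (h : Sound H cl wt c P X) {n : ℕ}
    (hP : ∀ x ∈ P, 0 < x ∧ x ≤ n) {C j : ℕ} (hC : C < 2 ^ c) (hj : j ≤ c) :
    X C j ≤ n + ∑ v ∈ Finset.Icc 1 n, wt v := by
  obtain ⟨S, h1, h2⟩ := h C hC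
  rcases hj.lt_or_eq with hj | rfl
  · by_cases h0 : X C j = 0
    · omega
    · have := (hP _ (h1.1 ((h2.1 j hj _ h0).1 rfl).1)).2
      omega
  · rw [h2.2]
    refine le_trans (Finset.sum_le_sum_of_subset fun x hx => ?_) (Nat.le_add_left _ _)
    exact Finset.mem_Icc.2 (hP x (h1.1 hx))

end Tables

/-! ### Elimination trees -/

section Tree

variable {H : SimpleGraph ℕ} {par : ℕ → ℕ} {n : ℕ}

/-- The earlier neighbors of every vertex form a clique, and `par i` is the last earlier neighbor
of `i`, or zero. -/
structure IsElimTree (H : SimpleGraph ℕ) (par : ℕ → ℕ) : Prop where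
  par_lt : ∀ i, 0 < i → par i < i
  adj_par : ∀ i, par i ≠ 0 → H.Adj (par i) i
  le_par : ∀ i j, H.Adj j i → j < i → j ≤ par i
  clique : ∀ i j k, j < i → k < i → H.Adj j i → H.Adj k i → j ≠ k → H.Adj j k
  pos : ∀ i j, H.Adj i j → 0 < i

/-- `u` is `v` or a descendant of `v`. -/
def Desc (par : ℕ → ℕ) : ℕ → ℕ → Prop :=
  Relation.ReflTransGen fun a b => 0 < b ∧ par b = a

/-- The vertices up to `n` of the subtree rooted at `v`. -/
def subtree (par : ℕ → ℕ) (n v : ℕ) : Set ℕ := {x | 0 < x ∧ x ≤ n ∧ Desc par v x}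

theorem desc_iff {v u : ℕ} : Desc par v u ↔ u = v ∨ (0 < u ∧ Desc par v (par u)) := by
  constructor
  · intro h
    rcases h.cases_tail with h | ⟨w, h, h0, rfl⟩
    · exact .inl h
    · exact .inr ⟨h0, h⟩
  · rintro (rfl | ⟨h0, h⟩)
    · exact .refl
    · exact h.tail ⟨h0, rfl⟩

theorem Desc.le (h : IsElimTree H par) {v u : ℕ} (hd : Desc par v u) : v ≤ u := by
  induction hd with
  | refl => exact le_rfl
  | tail _ hab ih =>
    have := h.par_lt _ hab.1
    omega

/-- All ancestors of `u` lie on the single path obtained by iterating `par`. -/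
theorem Desc.comparable {a b u : ℕ} (ha : Desc par a u) (hb : Desc par b u) :
    Desc par a b ∨ Desc par b a := by
  induction ha with
  | refl => exact .inr hb
  | tail hxy hyz ih =>
    rcases desc_iff.1 hb with rfl | ⟨h0, hb⟩
    · exact .inl (hxy.tail hyz)
    · exact ih (hyz.2 ▸ hb)

theorem desc_zero (h : IsElimTree H par) (u : ℕ) : Desc par 0 u := by
  induction u using Nat.strong_induction_on with
  | _ u ih =>
    rw [desc_iff]
    by_cases h0 : u = 0
    · exact .inl h0
    · exact .inr ⟨by omega, ih _ (h.par_lt u (by omega))⟩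

/-- Both `j` and `par i` are earlier neighbors of `i`, hence equal or adjacent, and induction
applies to `par i`. -/
theorem IsElimTree.desc_of_adj (h : IsElimTree H par) {i j : ℕ} (hadj : H.Adj j i) (hji : j < i) :
    Desc par j i := by
  induction i using Nat.strong_induction_on with
  | _ i ih =>
    have h1 := h.le_par i j hadj hji
    have hj := h.pos j i hadj
    have hlt := h.par_lt i (by omega)
    refine desc_iff.2 (.inr ⟨by omega, ?_⟩)
    rcases h1.lt_or_eq with h1 | h1
    · exact ih _ hlt (h.clique i j (par i) hji hlt hadj (h.adj_par i (by omega)) h1.ne) h1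
    · rw [← h1]; exact .refl

/-- The neighbors of `v` among its descendants are closed under taking parents. -/
theorem IsElimTree.adj_of_desc (h : IsElimTree H par) {v x y : ℕ} (hyx : Desc par y x)
    (hadj : H.Adj x v) (hvy : v < y) : H.Adj y v := by
  induction hyx with
  | refl => exact hadj
  | @tail a x hya hax ih =>
    obtain ⟨hx0, rfl⟩ := hax
    have h1 := Desc.le h hya
    have hlt := h.par_lt x hx0
    -- The parent of `x` and `v` are distinct earlier neighbors of `x`, hence adjacent.
    exact ih (h.clique x _ v hlt (by omega) (h.adj_par x (by omega)) hadj.symm (by omega))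

/-- A common vertex, or the later end of an edge between the subtrees, would have both `u` and `u'`
as ancestors, making them comparable. -/
theorem IsElimTree.apart (h : IsElimTree H par) {u u' : ℕ} (h1 : ¬ Desc par u u')
    (h2 : ¬ Desc par u' u) : Apart H (subtree par n u) (subtree par n u') := by
  intro x hx y hy
  constructor
  · rintro rfl
    rcases hx.2.2.comparable hy.2.2 with h | h
    · exact h1 h
    · exact h2 h
  · intro hadj
    rcases Nat.lt_trichotomy x y with hlt | rfl | hlt
    · rcases Desc.comparable (hx.2.2.trans (h.desc_of_adj hadj hlt)) hy.2.2 with h | h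
      · exact h1 h
      · exact h2 h
    · exact H.loopless.irrefl _ hadj
    · rcases hx.2.2.comparable (hy.2.2.trans (h.desc_of_adj hadj.symm hlt)) with h | h
      · exact h1 h
      · exact h2 h

/-- The roots of the components of the subtree of `v` without `v` and its neighbors. -/
def Hangs (H : SimpleGraph ℕ) (par : ℕ → ℕ) (v u : ℕ) : Prop :=
  v < par u ∧ H.Adj (par u) v ∧ ¬ H.Adj u v

/-- The vertices in the subtrees rooted at the vertices below `m` with property `p`. -/
def forest (par : ℕ → ℕ) (n : ℕ) (p : ℕ → Prop) (m : ℕ) : Set ℕ :=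
  {x | ∃ u, 0 < u ∧ u < m ∧ p u ∧ x ∈ subtree par n u}

theorem forest_succ_of_pos {p : ℕ → Prop} {u : ℕ} (hu : 0 < u) (hp : p u) :
    forest par n p (u + 1) = forest par n p u ∪ subtree par n u := by
  ext x
  constructor
  · rintro ⟨w, h0, hw, hpw, hx⟩
    rcases Nat.lt_succ_iff_lt_or_eq.1 hw with hw | rfl
    · exact .inl ⟨w, h0, hw, hpw, hx⟩
    · exact .inr hx
  · rintro (⟨w, h0, hw, hpw, hx⟩ | hx)
    · exact ⟨w, h0, by omega, hpw, hx⟩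
    · exact ⟨u, hu, by omega, hp, hx⟩

theorem forest_succ_of_neg {p : ℕ → Prop} {u : ℕ} (hp : ¬ p u) :
    forest par n p (u + 1) = forest par n p u := by
  ext x
  constructor
  · rintro ⟨w, h0, hw, hpw, hx⟩
    rcases Nat.lt_succ_iff_lt_or_eq.1 hw with hw | rfl
    · exact ⟨w, h0, hw, hpw, hx⟩
    · exact (hp hpw).elim
  · rintro ⟨w, h0, hw, hpw, hx⟩
    exact ⟨w, h0, by omega, hpw, hx⟩

theorem forest_eq_empty {p : ℕ → Prop} {m : ℕ} (h : ∀ u < m, 0 < u → ¬ p u) :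
    forest par n p m = ∅ := by
  refine Set.eq_empty_of_forall_notMem ?_
  rintro x ⟨w, h0, hw, hpw, hx⟩
  exact h w hw h0 hpw

/-- Siblings are incomparable: a sibling `b` properly below `a` would give `a ≤ par b = par a < a`.
-/
theorem IsElimTree.apart_forest_children (h : IsElimTree H par) {v u : ℕ} (hu : 0 < u)
    (hp : par u = v) : Apart H (forest par n (fun w => par w = v) u) (subtree par n u) := by
  rintro x ⟨w, hw0, hw, hpw, hx⟩ y hy
  subst hpw
  have key : ∀ a b, 0 < a → 0 < b → a ≠ b → par a = par b → ¬ Desc par a b := by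
    intro a b ha hb hab e hd
    rcases desc_iff.1 hd with rfl | ⟨_, hd⟩
    · exact hab rfl
    · have := Desc.le h hd
      have := h.par_lt a ha
      omega
  exact h.apart (key w u hw0 hu hw.ne hp.symm) (key u w hu hw0 hw.ne' hp) x hx y hy

/-- If `a` were a proper ancestor of `b`, it would be `par b` or an ancestor of it, beyond `v`, and
so adjacent to `v` along with `par b`. -/
theorem IsElimTree.apart_forest_hangs (h : IsElimTree H par) {v u : ℕ} (hu : 0 < u)
    (hp : Hangs H par v u) : Apart H (forest par n (Hangs H par v) u) (subtree par n u) := by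
  rintro x ⟨w, hw0, hw, hpw, hx⟩ y hy
  have key : ∀ a b, 0 < a → a ≠ b → Hangs H par v a → Hangs H par v b → ¬ Desc par a b := by
    intro a b ha hab hpa hpb hd
    rcases desc_iff.1 hd with rfl | ⟨_, hd⟩
    · exact hab rfl
    · have := h.par_lt a ha
      have := hpa.1
      exact hpa.2.2 (h.adj_of_desc hd hpb.2.1 (by omega))
  exact h.apart (key w u hw0 hw.ne hpw hp) (key u w hu hw.ne' hp hpw) x hx y hy

theorem IsElimTree.mem_forest_children (h : IsElimTree H par) {v x : ℕ} :
    x ∈ forest par n (fun w => par w = v) (n + 1) ↔ x ∈ subtree par n v ∧ x ≠ v := by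
  constructor
  · rintro ⟨u, h0, hu, rfl, hx⟩
    have h1 := Desc.le h hx.2.2
    have h2 := h.par_lt u h0
    exact ⟨⟨hx.1, hx.2.1, Relation.ReflTransGen.head ⟨h0, rfl⟩ hx.2.2⟩, by omega⟩
  · rintro ⟨⟨h0, hn, hd⟩, hne⟩
    obtain rfl | ⟨u, hu, hd⟩ := hd.cases_head
    · exact (hne rfl).elim
    · have := Desc.le h hd
      exact ⟨u, hu.1, by omega, hu.2, h0, hn, hd⟩

/-- Climbing from a non-neighbor of `v` towards `v`, one meets a first vertex whose parent is
adjacent to `v`, at the latest below a child of `v`; that vertex hangs. Conversely, `adj_of_desc`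
forbids neighbors of `v` below a hanging vertex. -/
theorem IsElimTree.mem_forest_hangs (h : IsElimTree H par) {v x : ℕ} (hv : 0 < v) :
    x ∈ forest par n (Hangs H par v) (n + 1) ↔
      x ∈ subtree par n v ∧ x ≠ v ∧ ¬ H.Adj v x := by
  constructor
  · rintro ⟨u, h0, hu, hp, hx⟩
    have h1 := Desc.le h hx.2.2
    have h2 := h.par_lt u h0
    have h3 := hp.1
    have hvu : Desc par v u :=
      desc_iff.2 (.inr ⟨h0, h.desc_of_adj hp.2.1.symm hp.1⟩)
    exact ⟨⟨hx.1, hx.2.1, hvu.trans hx.2.2⟩, by omega,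
      fun hadj => hp.2.2 (h.adj_of_desc hx.2.2 hadj.symm (by omega))⟩
  · rintro ⟨⟨h0, hn, hd⟩, hne, hadj⟩
    suffices hs : ∃ u, 0 < u ∧ Hangs H par v u ∧ Desc par u x by
      obtain ⟨u, hu, hp, hd⟩ := hs
      have := Desc.le h hd
      exact ⟨u, hu, by omega, hp, h0, hn, hd⟩
    clear hn
    induction x using Nat.strong_induction_on with
    | _ x ih =>
      rcases desc_iff.1 hd with rfl | ⟨_, hd'⟩
      · exact (hne rfl).elim
      · have hle := Desc.le h hd'
        have hpx : par x ≠ v := by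
          intro e
          exact hadj (e ▸ h.adj_par x (by omega))
        by_cases hadj' : H.Adj v (par x)
        · exact ⟨x, h0, ⟨by omega, hadj'.symm, fun e => hadj e.symm⟩, .refl⟩
        · obtain ⟨u, hu, hp, hd''⟩ := ih (par x) (h.par_lt x h0) (by omega) hd' hpx hadj'
          exact ⟨u, hu, hp, desc_iff.2 (.inr ⟨h0, hd''⟩)⟩

end Tree

end WordRAM

/-! ### The dynamic program

The vertices are numbered `1, ..., n` in the order of a search, and `0` is an artificial root. For
`v = n, ..., 0`, a table for the subtree of `v` is computed from those of the roots of the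
components that remain after the removal of `v` (register 10), and of `v` and its neighbors
(register 11). Register 7 counts the vertices, register 8 holds `v`, register 9 the number of tables
in use; memory 4 holds the order, memory 7 the parents, memory 8 the adjacency matrix in search
order, memory 9 the powers of two, memory 11 the numbers of the tables of the vertices. -/

namespace WordRAM

/-- The table of the vertex in register 12 is merged into the table in register `r`. -/
def mergeInto (r : ℕ) : Prog :=
  .seq (block [.op 20 .add (.reg 9) (.const 0), .op 21 .add (.reg r) (.const 0),
      .load 22 11 (.reg 12)])
    (.seq conv (block [.op r .add (.reg 20) (.const 0), .op 9 .add (.reg 9) (.const 1)]))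

/-- The vertex in register 12 is treated on behalf of the vertex in register 8. -/
def vertexBody : Prog :=
  .seq (.load 13 7 (.reg 12)) (.ite (.eq (.reg 13) (.reg 8)) (mergeInto 10)
    (.ite (.lt (.reg 8) (.reg 13))
      (.seq (block [.op 14 .mul (.reg 13) (.reg 6), .op 14 .add (.reg 14) (.reg 8),
          .load 14 8 (.reg 14), .op 15 .mul (.reg 12) (.reg 6), .op 15 .add (.reg 15) (.reg 8),
          .load 15 8 (.reg 15)])
        (.ite (.lt (.reg 15) (.reg 14)) (mergeInto 11) .skip)) .skip))

/-- The table of `{v}` is written, and the arguments of `conv` are set. -/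
def selectStart : Prog :=
  block [.load 13 4 (.reg 8), .load 14 1 (.reg 13), .load 15 0 (.reg 13), .load 16 9 (.reg 14),
    .op 16 .mul (.reg 16) (.reg 5), .op 17 .mul (.reg 9) (.reg 4), .op 16 .add (.reg 17) (.reg 16),
    .op 17 .add (.reg 16) (.reg 14), .store 12 (.reg 17) (.reg 8),
    .op 17 .add (.reg 16) (.reg 1), .store 12 (.reg 17) (.reg 15),
    .op 20 .add (.reg 10) (.const 0), .op 21 .add (.reg 11) (.const 0),
    .op 22 .add (.reg 9) (.const 0), .op 9 .add (.reg 9) (.const 1)]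

/-- Two empty tables are allocated. -/
def rootStart : Prog :=
  block [.op 8 .sub (.reg 0) (.reg 7), .op 10 .add (.reg 9) (.const 0),
    .op 11 .add (.reg 9) (.const 1), .op 9 .add (.reg 9) (.const 2),
    .op 12 .add (.reg 8) (.const 1)]

/-- The table of the subtree of one vertex is computed. -/
def rootBody : Prog :=
  .seq rootStart (.seq (loop 12 (.reg 6) vertexBody)
    (.seq (.ite (.lt (.const 0) (.reg 8)) (.seq selectStart conv) .skip)
      (.store 11 (.reg 8) (.reg 10))))

/-- The tables of all subtrees are computed. -/
def solve : Prog :=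
  .seq (block [.op 9 .add (.const 0) (.const 0), .op 7 .add (.const 0) (.const 0)])
    (loop 7 (.reg 6) rootBody)

/-- The table `X` solves the problem on `P` for all color sets. -/
def Solves (H : SimpleGraph ℕ) (cl wt : ℕ → ℕ) (c : ℕ) (P : Set ℕ) (X : ℕ → ℕ → ℕ) : Prop :=
  Sound H cl wt c P X ∧ Complete H cl wt c P X

/-- The words have enough bits. -/
structure Bounds (L n c W : ℕ) : Prop where
  table : ((n + 1) * (n + 3) + 1) * (2 ^ c * (c + 1)) < 2 ^ L
  pow : 3 ^ c < 2 ^ L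
  weight : 2 * (n + W) < 2 ^ L

/-- The state after the preprocessing of the instance. -/
structure Ready (L n c : ℕ) (H : SimpleGraph ℕ) (par cl wt : ℕ → ℕ) (s : State) : Prop where
  bounds : Bounds L n c (∑ v ∈ Finset.Icc 1 n, wt v)
  tree : IsElimTree H par
  r0 : s.reg 0 = n
  r1 : s.reg 1 = c
  r2 : s.reg 2 = 2 ^ c
  r3 : s.reg 3 = 3 ^ c
  r4 : s.reg 4 = 2 ^ c * (c + 1)
  r5 : s.reg 5 = c + 1
  r6 : s.reg 6 = n + 1
  fst : ∀ t < 3 ^ c, s.arr 5 t = ternFst t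
  snd : ∀ t < 3 ^ c, s.arr 6 t = ternSnd t
  par : ∀ u, 0 < u → u ≤ n → s.arr 7 u = par u
  adj : ∀ i j, i ≤ n → j < i → H.Adj i j → s.arr 8 (i * (n + 1) + j) = 1
  not_adj : ∀ i j, i ≤ n → j < i → ¬ H.Adj i j → s.arr 8 (i * (n + 1) + j) = 0
  pow : ∀ j < c, s.arr 9 j = 2 ^ j
  ord : ∀ v, 0 < v → v ≤ n → s.arr 4 v < n
  col : ∀ v, 0 < v → v ≤ n → s.arr 1 (s.arr 4 v) = cl v
  weight : ∀ v, 0 < v → v ≤ n → s.arr 0 (s.arr 4 v) = wt v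
  col_lt : ∀ v, 0 < v → v ≤ n → cl v < c
  tables : ∀ a, s.arr 12 a = 0

/-- An upper bound for the running time of `conv`. -/
def convTime (c : ℕ) : ℕ := 2 ^ c * (c + 1) * 22 + 2 ^ c * 9 + 3 ^ c * 20 + 10

/-! ### Merging the tables of subtrees -/

section
variable {L n c : ℕ} {H : SimpleGraph ℕ} {par cl wt : ℕ → ℕ} {s₀ : State}

@[simp] theorem State.setReg_table (s : State) (d r N c : ℕ) :
    (s.setReg d r).table N c = s.table N c := rfl

theorem Solves.congr {P : Set ℕ} {X X' : ℕ → ℕ → ℕ} (h : Solves H cl wt c P X)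
    (hX : ∀ C < 2 ^ c, ∀ j ≤ c, X' C j = X C j) : Solves H cl wt c P X' :=
  ⟨h.1.congr hX, h.2.congr hX⟩

theorem Bounds.id {W m : ℕ} (h : Bounds L n c W) (hm : m ≤ (n + 1) * (n + 3)) :
    (m + 1) * (2 ^ c * (c + 1)) < 2 ^ L :=
  (Nat.mul_le_mul_right _ (by omega)).trans_lt h.table

theorem Bounds.lt {W m : ℕ} (h : Bounds L n c W) (hm : m ≤ (n + 1) * (n + 3) + 1) : m < 2 ^ L := by
  refine lt_of_le_of_lt ?_ h.table
  calc m = m * 1 := by ring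
    _ ≤ _ := Nat.mul_le_mul hm (Nat.succ_le_of_lt (by positivity))

theorem table_eq_zero {s : State} {m x C j : ℕ} (hz : ∀ a, m * (2 ^ c * (c + 1)) ≤ a → s.arr 12 a = 0)
    (hx : m ≤ x) : s.table (2 ^ c) c x C j = 0 :=
  hz _ ((Nat.mul_le_mul_right _ hx).trans (Nat.le_add_right _ _))

theorem Ready.convPre (h : Ready L n c H par cl wt s₀) {s : State} (hf : Frame 7 10 s₀ s)
    {x y z : ℕ} {P Q R : Set ℕ} (hx : s.reg 20 = x) (hy : s.reg 21 = y) (hz : s.reg 22 = z)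
    (hyx : y ≠ x) (hzx : z ≠ x) (hxm : x ≤ (n + 1) * (n + 3)) (hym : y ≤ (n + 1) * (n + 3))
    (hzm : z ≤ (n + 1) * (n + 3))
    (hX : Sound H cl wt c R (s.table (2 ^ c) c x)) (hY : Sound H cl wt c P (s.table (2 ^ c) c y))
    (hZ : Sound H cl wt c Q (s.table (2 ^ c) c z)) (hR : ∀ v ∈ R, 0 < v ∧ v ≤ n)
    (hP : ∀ v ∈ P, 0 < v ∧ v ≤ n) (hQ : ∀ v ∈ Q, 0 < v ∧ v ≤ n) :
    ConvPre L (2 ^ c) (3 ^ c) c x y z (n + ∑ v ∈ Finset.Icc 1 n, wt v) ternFst ternSnd s where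
  r1 := by rw [hf.1 _ (by norm_num), h.r1]
  r2 := by rw [hf.1 _ (by norm_num), h.r2]
  r3 := by rw [hf.1 _ (by norm_num), h.r3]
  r4 := by rw [hf.1 _ (by norm_num), h.r4]
  r5 := by rw [hf.1 _ (by norm_num), h.r5]
  r20 := hx
  r21 := hy
  r22 := hz
  hD t ht := by rw [hf.2 _ (by norm_num), h.fst t ht]
  hE t ht := by rw [hf.2 _ (by norm_num), h.snd t ht]
  hDE _ := tern_add_lt
  hyx := hyx
  hzx := hzx
  hx := h.bounds.id hxm
  hy := h.bounds.id hym
  hz := h.bounds.id hzm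
  hN₃ := h.bounds.pow
  hX _ hC _ hj := hX.le hR hC hj
  hY _ hC _ hj := hY.le hP hC hj
  hZ _ hC _ hj := hZ.le hQ hC hj
  hHL := h.bounds.weight

/-- The result goes into the fresh zero table `m`, so taking the maximum with the old content is
harmless, and both arguments survive for later use. -/
theorem mergeInto_runs (h : Ready L n c H par cl wt s₀) {s : State} (hf : Frame 7 10 s₀ s)
    {r m : ℕ} {P Q : Set ℕ} (hr : r = 10 ∨ r = 11) (h9 : s.reg 9 = m)
    (hy : s.reg r < m) (hz : s.arr 11 (s.reg 12) < m) (hm : m < (n + 1) * (n + 3))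
    (hY : Solves H cl wt c P (s.table (2 ^ c) c (s.reg r)))
    (hZ : Solves H cl wt c Q (s.table (2 ^ c) c (s.arr 11 (s.reg 12))))
    (hP : ∀ v ∈ P, 0 < v ∧ v ≤ n) (hQ : ∀ v ∈ Q, 0 < v ∧ v ≤ n) (hPQ : Apart H P Q)
    (h0 : ∀ a, m * (2 ^ c * (c + 1)) ≤ a → s.arr 12 a = 0) :
    Runs L (mergeInto r) s (convTime c + 7) fun s' =>
      (∀ i < 20, i ≠ 9 → i ≠ r → s'.reg i = s.reg i) ∧ s'.reg 9 = m + 1 ∧ s'.reg r = m ∧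
      (∀ k < 12, ∀ a, s'.arr k a = s.arr k a) ∧
      (∀ w < m, ∀ C < 2 ^ c, ∀ j ≤ c, s'.table (2 ^ c) c w C j = s.table (2 ^ c) c w C j) ∧
      (∀ a, (m + 1) * (2 ^ c * (c + 1)) ≤ a → s'.arr 12 a = 0) ∧
      Solves H cl wt c (P ∪ Q) (s'.table (2 ^ c) c m) := by
  have hmL : m + 1 < 2 ^ L := h.bounds.lt (by omega)
  have hr20 : r < 20 := by omega
  have h1 : Runs L (block [.op 20 .add (.reg 9) (.const 0), .op 21 .add (.reg r) (.const 0),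
      .load 22 11 (.reg 12)]) s 4 fun s' => Frame 20 13 s s' ∧ s'.reg 20 = m ∧
        s'.reg 21 = s.reg r ∧ s'.reg 22 = s.arr 11 (s.reg 12) := by
    refine (Runs.of_wp ?_).mono (by simp [block, cost]) fun _ h => h
    have : r ≠ 20 := by omega
    simp [block, wp, Op.eval, h9, Frame.refl, this]
    omega
  refine (h1.seq fun s₁ ⟨f₁, a₁, b₁, c₁⟩ => ?_).mono (T := 4 + (convTime c + 3)) (by omega)
    fun _ h => h
  have t₁ : ∀ w C j, s₁.table (2 ^ c) c w C j = s.table (2 ^ c) c w C j := fun w C j =>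
    f₁.2 12 (by norm_num) _
  have hf₁ : Frame 7 10 s₀ s₁ := hf.trans f₁ (by norm_num) (by norm_num) (by norm_num)
    (by norm_num)
  have hX₁ : Sound H cl wt c ∅ (s₁.table (2 ^ c) c m) := sound_zero fun C _ j _ => by
    rw [t₁]; exact table_eq_zero h0 le_rfl
  have hY₁ := hY.congr (X' := s₁.table (2 ^ c) c (s.reg r)) fun C _ j _ => t₁ _ C j
  have hZ₁ := hZ.congr (X' := s₁.table (2 ^ c) c (s.arr 11 (s.reg 12))) fun C _ j _ => t₁ _ C j
  have hpre := h.convPre hf₁ a₁ b₁ c₁ (by omega) (by omega) (by omega) (by omega) (by omega)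
    hX₁ hY₁.1 hZ₁.1 (by simp) hP hQ
  refine (conv_runs hpre).seq fun s₂ ⟨f₂, u₂, z₂, k₂⟩ => ?_
  have r₂ : ∀ i < 20, s₂.reg i = s.reg i := fun i hi => by
    rw [f₂.1 i (by omega), f₁.1 i hi]
  have hsolve : Solves H cl wt c (P ∪ Q) (s₂.table (2 ^ c) c m) :=
    ⟨k₂.sound (sound_zero fun C _ j _ => by rw [t₁]; exact table_eq_zero h0 le_rfl) hY₁.1 hZ₁.1
      hPQ subset_rfl, k₂.complete hY₁.2 hZ₁.2⟩
  refine (Runs.of_wp ?_).mono (by simp [block, cost]) fun _ h => h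
  have e9 : 9 ≠ r := by omega
  simp [block, wp, Op.eval, r₂ 9 (by norm_num), h9, f₂.1 20 (by norm_num), a₁, e9, e9.symm]
  refine ⟨by omega, by omega, ?_, ?_, ?_, ?_, hsolve⟩
  · intro i hi h1 h2
    rw [if_neg h1, if_neg h2, r₂ i hi]
  · intro k hk a
    rw [f₂.2 k (by omega), f₁.2 k (by omega)]
  · intro w hw C hC j hj
    have := u₂ w hw.ne C hC j hj
    rw [t₁] at this
    exact this
  · intro a ha
    rw [z₂ a ha, f₁.2 12 (by norm_num), h0 a]
    exact (Nat.mul_le_mul_right _ (by omega)).trans ha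

/-- The numbers of the tables of the vertices beyond `v` are stored; all are below `m`. -/
structure SolvedBeyond (H : SimpleGraph ℕ) (par cl wt : ℕ → ℕ) (n c m v : ℕ) (s : State) :
    Prop where
  id_lt : ∀ u, v < u → u ≤ n → s.arr 11 u < m
  solves : ∀ u, v < u → u ≤ n →
    Solves H cl wt c (subtree par n u) (s.table (2 ^ c) c (s.arr 11 u))

theorem SolvedBeyond.congr {m v : ℕ} {s s' : State} (hs : SolvedBeyond H par cl wt n c m v s)
    (h11 : ∀ a, s'.arr 11 a = s.arr 11 a)
    (ht : ∀ w < m, ∀ C < 2 ^ c, ∀ j ≤ c, s'.table (2 ^ c) c w C j = s.table (2 ^ c) c w C j) :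
    SolvedBeyond H par cl wt n c m v s' where
  id_lt u h1 h2 := by rw [h11]; exact hs.id_lt u h1 h2
  solves u h1 h2 := by
    rw [h11]
    exact (hs.solves u h1 h2).congr fun C hC j hj => ht _ (hs.id_lt u h1 h2) C hC j hj

/-- The state of the loop over the vertices `u > v`. -/
structure MergeInv (s₀ : State) (H : SimpleGraph ℕ) (par cl wt : ℕ → ℕ) (n c i m v u : ℕ)
    (s : State) : Prop where
  frame : Frame 7 10 s₀ s
  r7 : s.reg 7 = i
  r8 : s.reg 8 = v
  r12 : s.reg 12 = u
  beyond : SolvedBeyond H par cl wt n c m v s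
  le_a : m ≤ s.reg 10
  le_b : m ≤ s.reg 11
  a_lt : s.reg 10 < s.reg 9
  b_lt : s.reg 11 < s.reg 9
  a_ne_b : s.reg 10 ≠ s.reg 11
  id_le : s.reg 9 + v + 1 ≤ m + 2 + u
  zero : ∀ a, s.reg 9 * (2 ^ c * (c + 1)) ≤ a → s.arr 12 a = 0
  solves_a : Solves H cl wt c (forest par n (fun w => par w = v) u)
    (s.table (2 ^ c) c (s.reg 10))
  solves_b : Solves H cl wt c (forest par n (Hangs H par v) u) (s.table (2 ^ c) c (s.reg 11))

theorem forest_subset {p : ℕ → Prop} {m : ℕ} : ∀ x ∈ forest par n p m, 0 < x ∧ x ≤ n := by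
  rintro x ⟨_, _, _, _, hx⟩
  exact ⟨hx.1, hx.2.1⟩

/-- A child of `v` does not hang, since the parent of a hanging vertex lies beyond `v`. So each `u`
costs at most one convolution and one new table, which `id_le` counts. -/
theorem vertexBody_runs (h : Ready L n c H par cl wt s₀) {s : State} {i m v u : ℕ}
    (hm : m + n + 3 ≤ (n + 1) * (n + 3)) (hvu : v < u) (hun : u ≤ n)
    (hs : MergeInv s₀ H par cl wt n c i m v u s) :
    Runs L vertexBody s (convTime c + 20) fun s' => s'.reg 12 = u ∧
      MergeInv s₀ H par cl wt n c i m v (u + 1) (s'.setReg 12 (u + 1)) := by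
  have hu : 0 < u := by omega
  have hmL : (n + 1) * (n + 3) < 2 ^ L := h.bounds.lt (by omega)
  have hpu := h.tree.par_lt u hu
  have hid := hs.id_le
  have hmn : ∀ a b, a ≤ n → b ≤ n → a * (n + 1) + b < (n + 1) * (n + 3) := by
    intro a b ha hb
    nlinarith
  have h7 : s.arr 7 u = par u := by rw [hs.frame.2 7 (by norm_num), h.par u hu hun]
  have hsub : ∀ x ∈ subtree par n u, 0 < x ∧ x ≤ n := fun x hx => ⟨hx.1, hx.2.1⟩
  have h1 : Runs L (.load 13 7 (.reg 12)) s 1 fun s' => s' = s.setReg 13 (par u) := by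
    refine (Runs.of_wp (p := .load 13 7 (.reg 12)) ?_).mono (by simp [cost]) fun _ h => h
    simp [wp, hs.r12, h7]
    nlinarith
  refine (h1.seq (T' := convTime c + 18) ?_).mono (by omega) fun _ h => h
  rintro s₁ rfl
  set s₁ := s.setReg 13 (par u) with hs₁
  have f₁ : Frame 13 16 s s₁ := by simp [hs₁, Frame.refl]
  -- Both merging cases share this; they differ in the target register and in the scratch registers
  -- from 13 on.
  have merge : ∀ (s₂ : State) (r : ℕ) (P : Set ℕ), Frame 13 16 s s₂ → (r = 10 ∨ r = 11) →
      s.reg r < s.reg 9 → Solves H cl wt c P (s.table (2 ^ c) c (s.reg r)) →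
      (∀ v ∈ P, 0 < v ∧ v ≤ n) → Apart H P (subtree par n u) →
      Runs L (mergeInto r) s₂ (convTime c + 7) fun s' =>
        (∀ i < 13, i ≠ 9 → i ≠ r → s'.reg i = s.reg i) ∧ s'.reg 9 = s.reg 9 + 1 ∧
        s'.reg r = s.reg 9 ∧
        (∀ k < 12, ∀ a, s'.arr k a = s.arr k a) ∧
        (∀ w < s.reg 9, ∀ C < 2 ^ c, ∀ j ≤ c,
          s'.table (2 ^ c) c w C j = s.table (2 ^ c) c w C j) ∧
        (∀ a, (s.reg 9 + 1) * (2 ^ c * (c + 1)) ≤ a → s'.arr 12 a = 0) ∧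
        Solves H cl wt c (P ∪ subtree par n u) (s'.table (2 ^ c) c (s.reg 9)) := by
    intro s₂ r P f₂ hr hrm hP hPn hPu
    have t₂ : ∀ w C j, s₂.table (2 ^ c) c w C j = s.table (2 ^ c) c w C j := fun w C j =>
      f₂.2 12 (by norm_num) _
    have er : s₂.reg r = s.reg r := f₂.1 r (by omega)
    have e12 : s₂.arr 11 (s₂.reg 12) = s.arr 11 u := by
      rw [f₂.2 11 (by norm_num), f₂.1 12 (by norm_num), hs.r12]
    have hlt := hs.beyond.id_lt u hvu hun
    have ha := hs.le_a
    have ha' := hs.a_lt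
    refine (mergeInto_runs h (hs.frame.trans f₂ (by norm_num) (by norm_num) (by norm_num)
      (by norm_num)) (P := P) (Q := subtree par n u) hr (f₂.1 9 (by norm_num)) (by omega)
      (by omega) (by omega) ?_ ?_ hPn hsub hPu ?_).mono le_rfl ?_
    · rw [er]; exact hP.congr fun C _ j _ => t₂ _ C j
    · rw [e12]; exact (hs.beyond.solves u hvu hun).congr fun C _ j _ => t₂ _ C j
    · intro a ha
      rw [f₂.2 12 (by norm_num), hs.zero a ha]
    · rintro s' ⟨k1, k2, k3, k4, k5, k6, k7⟩
      refine ⟨fun i hi h9 hr => ?_, k2, k3, fun k hk a => ?_, fun w hw C hC j hj => ?_, k6, k7⟩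
      · rw [k1 i (by omega) h9 hr, f₂.1 i hi]
      · rw [k4 k hk, f₂.2 k (by omega)]
      · rw [k5 w hw C hC j hj, t₂]
  have skip : ¬ par u = v → ¬ Hangs H par v u → ∀ s₂, Frame 13 16 s s₂ →
      s₂.reg 12 = u ∧ MergeInv s₀ H par cl wt n c i m v (u + 1) (s₂.setReg 12 (u + 1)) := by
    intro hpar hh s₂ f₂
    have t₂ : ∀ w C j, s₂.table (2 ^ c) c w C j = s.table (2 ^ c) c w C j := fun w C j =>
      f₂.2 12 (by norm_num) _
    refine ⟨by rw [f₂.1 12 (by norm_num), hs.r12], ?_⟩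
    have e9 := f₂.1 9 (by norm_num)
    have e10 := f₂.1 10 (by norm_num)
    have e11 := f₂.1 11 (by norm_num)
    constructor
    · simpa using hs.frame.trans f₂ (by norm_num) (by norm_num) (by norm_num) (by norm_num)
    · simp [f₂.1, hs.r7]
    · simp [f₂.1, hs.r8]
    · simp
    · exact hs.beyond.congr (f₂.2 11 (by norm_num)) fun w _ C _ j _ => t₂ w C j
    · simpa [e10] using hs.le_a
    · simpa [e11] using hs.le_b
    · simpa [e10, e9] using hs.a_lt
    · simpa [e11, e9] using hs.b_lt
    · simpa [e11, e10] using hs.a_ne_b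
    · simp [e9]; omega
    · intro a ha
      simp only [State.setReg_reg, State.setReg_arr] at ha ⊢
      rw [f₂.2 12 (by norm_num), hs.zero a (by simpa [e9] using ha)]
    · rw [forest_succ_of_neg (p := fun w => par w = v) hpar]
      simp only [State.setReg_reg]
      exact hs.solves_a.congr fun C _ j _ => by simpa [e10] using t₂ _ C j
    · rw [forest_succ_of_neg hh]
      simp only [State.setReg_reg]
      exact hs.solves_b.congr fun C _ j _ => by simpa [e11] using t₂ _ C j
  refine (Runs.ite (T := convTime c + 17) (fun hb => ?_) (fun hb => ?_)).mono (by omega)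
    fun _ h => h
  · have hpar : par u = v := by simpa [Test.Holds, hs₁, hs.r8] using hb
    have hh : ¬ Hangs H par v u := fun h => by have := h.1; omega
    refine (merge s₁ 10 _ f₁ (.inl rfl) hs.a_lt hs.solves_a forest_subset
      (h.tree.apart_forest_children hu hpar)).mono (by omega) ?_
    rintro s' ⟨k1, k2, k3, k4, k5, k6, k7⟩
    have ha := hs.le_a
    have ha' := hs.a_lt
    have hb := hs.le_b
    have hb' := hs.b_lt
    have e11 := k1 11 (by norm_num) (by norm_num) (by norm_num)
    refine ⟨by rw [k1 12 (by norm_num) (by norm_num) (by norm_num), hs.r12], ?_⟩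
    constructor
    · rw [frame_setReg (by norm_num)]
      exact ⟨fun i hi => by rw [k1 i (by omega) (by omega) (by omega), hs.frame.1 i hi],
        fun k hk a => by rw [k4 k (by omega), hs.frame.2 k hk]⟩
    · simp [k1, hs.r7]
    · simp [k1, hs.r8]
    · simp
    · exact hs.beyond.congr (k4 11 (by norm_num)) fun w hw C hC j hj => k5 w (by omega) C hC j hj
    · simp [k3]; omega
    · simp [e11]; omega
    · simp [k3, k2]
    · simp [e11, k2]; omega
    · simp [e11, k3]; omega
    · simp [k2]; omega
    · intro a ha
      exact k6 a (by simpa [k2] using ha)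
    · rw [forest_succ_of_pos hu hpar]
      simp only [State.setReg_reg]
      exact k7.congr fun C _ j _ => by simp [k3, State.table]
    · rw [forest_succ_of_neg hh]
      simp only [State.setReg_reg]
      exact hs.solves_b.congr fun C hC j hj => by
        simpa [e11] using k5 _ hb' C hC j hj
  · have hpar : ¬ par u = v := by simpa [Test.Holds, hs₁, hs.r8] using hb
    refine (Runs.ite (T := convTime c + 16) (fun hb => ?_) (fun hb => ?_)).mono (by omega)
      fun _ h => h
    swap
    · have hlt : ¬ v < par u := by simpa [Test.Holds, hs₁, hs.r8] using hb
      exact ⟨_, _, .skip _, by omega, skip hpar (fun h => hlt h.1) _ f₁⟩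
    have hlt : v < par u := by simpa [Test.Holds, hs₁, hs.r8] using hb
    -- For entries `0` and `1`, a strict inequality says that the parent is a neighbor of `v` and
    -- `u` is not.
    have h2 : Runs L (block [.op 14 .mul (.reg 13) (.reg 6), .op 14 .add (.reg 14) (.reg 8),
          .load 14 8 (.reg 14), .op 15 .mul (.reg 12) (.reg 6), .op 15 .add (.reg 15) (.reg 8),
          .load 15 8 (.reg 15)]) s₁ 7 fun s' => Frame 13 16 s s' ∧
          (s'.reg 15 < s'.reg 14 ↔ Hangs H par v u) := by
      refine (Runs.of_wp ?_).mono (by simp [block, cost]) fun _ h => h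
      have e8 := hs.frame.2 8 (by norm_num)
      have hA := hmn (par u) v (by omega) (by omega)
      have hB := hmn u v (by omega) (by omega)
      have hle1 : ∀ i, i ≤ n → v < i → s₀.arr 8 (i * (n + 1) + v) < 2 ^ L := by
        intro i hi hvi
        by_cases hadj : H.Adj i v
        · rw [h.adj i v hi hvi hadj]
          refine lt_of_le_of_lt ?_ hmL
          nlinarith
        · rw [h.not_adj i v hi hvi hadj]; positivity
      simp [block, wp, Op.eval, hs₁, hs.r8, hs.r12, hs.frame.1 6 (by norm_num), h.r6, e8,
        Frame.refl]
      refine ⟨by omega, by omega, hle1 _ (by omega) (by omega), by omega, by omega,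
        hle1 _ (by omega) (by omega), ?_⟩
      by_cases hadj : H.Adj u v
      · rw [h.adj u v hun hvu hadj]
        simp only [Hangs, hadj, not_true, and_false, iff_false, not_lt]
        by_cases hadj' : H.Adj (par u) v
        · rw [h.adj (par u) v (by omega) hlt hadj']
        · rw [h.not_adj (par u) v (by omega) hlt hadj']
          omega
      · rw [h.not_adj u v hun hvu hadj]
        simp only [Hangs, hadj, hlt, not_false_eq_true, and_true, true_and]
        by_cases hadj' : H.Adj (par u) v
        · rw [h.adj (par u) v (by omega) hlt hadj']
          simpa using hadj'
        · rw [h.not_adj (par u) v (by omega) hlt hadj']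
          simpa using hadj'
    refine (h2.seq (T' := convTime c + 8) fun s₂ ⟨f₂, hc₂⟩ => ?_).mono (by omega) fun _ h => h
    refine (Runs.ite (T := convTime c + 7) (fun hb => ?_) (fun hb => ?_)).mono (by omega)
      fun _ h => h
    swap
    · have hh : ¬ Hangs H par v u := fun hh => hb (hc₂.2 hh)
      exact ⟨_, _, .skip _, by omega, skip hpar hh _ f₂⟩
    have hh : Hangs H par v u := hc₂.1 hb
    refine (merge s₂ 11 _ f₂ (.inr rfl) hs.b_lt hs.solves_b forest_subset
      (h.tree.apart_forest_hangs hu hh)).mono (by omega) ?_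
    rintro s' ⟨k1, k2, k3, k4, k5, k6, k7⟩
    have ha := hs.le_a
    have ha' := hs.a_lt
    have hb := hs.le_b
    have hb' := hs.b_lt
    have e10 := k1 10 (by norm_num) (by norm_num) (by norm_num)
    refine ⟨by rw [k1 12 (by norm_num) (by norm_num) (by norm_num), hs.r12], ?_⟩
    constructor
    · rw [frame_setReg (by norm_num)]
      exact ⟨fun i hi => by rw [k1 i (by omega) (by omega) (by omega), hs.frame.1 i hi],
        fun k hk a => by rw [k4 k (by omega), hs.frame.2 k hk]⟩
    · simp [k1, hs.r7]
    · simp [k1, hs.r8]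
    · simp
    · exact hs.beyond.congr (k4 11 (by norm_num)) fun w hw C hC j hj => k5 w (by omega) C hC j hj
    · simp [e10]; omega
    · simp [k3]; omega
    · simp [e10, k2]; omega
    · simp [k3, k2]
    · simp [e10, k3]; omega
    · simp [k2]; omega
    · intro a ha
      exact k6 a (by simpa [k2] using ha)
    · rw [forest_succ_of_neg (p := fun w => par w = v) hpar]
      simp only [State.setReg_reg]
      exact hs.solves_a.congr fun C hC j hj => by
        simpa [e10] using k5 _ ha' C hC j hj
    · rw [forest_succ_of_pos hu hh]
      simp only [State.setReg_reg]
      exact k7.congr fun C _ j _ => by simp [k3, State.table]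

end
-- Taking or omitting a vertex, and the loop over all subtrees
section
variable {L n c : ℕ} {H : SimpleGraph ℕ} {par cl wt : ℕ → ℕ} {s₀ : State}

theorem addr_inj {N c x C C' j j' : ℕ} (hj : j ≤ c) (hj' : j' ≤ c) :
    addr N c x C j = addr N c x C' j' ↔ C = C' ∧ j = j' := by
  refine ⟨fun h => ?_, by rintro ⟨rfl, rfl⟩; rfl⟩
  have h : C * (c + 1) + j = C' * (c + 1) + j' := Nat.add_left_cancel h
  have e := congrArg (· / (c + 1)) h
  simp only [mul_comm _ (c + 1), Nat.mul_add_div (Nat.succ_pos c),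
    Nat.div_eq_of_lt (Nat.lt_succ_of_le hj), Nat.div_eq_of_lt (Nat.lt_succ_of_le hj'), add_zero] at e
  subst e
  omega

theorem Bounds.size_lt {W : ℕ} (h : Bounds L n c W) : 2 ^ c < 2 ^ L ∧ c + 1 < 2 ^ L := by
  have h0 := h.id (m := 0) (Nat.zero_le _)
  rw [zero_add, one_mul] at h0
  have h1 : 1 ≤ 2 ^ c := Nat.one_le_two_pow
  constructor
  · refine lt_of_le_of_lt ?_ h0
    exact Nat.le_mul_of_pos_right _ (Nat.succ_pos c)
  · refine lt_of_le_of_lt ?_ h0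
    exact Nat.le_mul_of_pos_left _ h1

/-- Two cells of a zero table suffice for `{v}`. The table of the children is passed to `conv` as
`X`, so that its old content is the option of omitting `v`. -/
theorem selectStart_runs (h : Ready L n c H par cl wt s₀) {s : State} {i m v : ℕ}
    (hm : m + n + 3 ≤ (n + 1) * (n + 3)) (hv : 0 < v) (hvn : v ≤ n)
    (hs : MergeInv s₀ H par cl wt n c i m v (n + 1) s) :
    Runs L selectStart s 16 fun s' => Frame 9 12 s s' ∧ s'.reg 10 = s.reg 10 ∧
      s'.reg 20 = s.reg 10 ∧ s'.reg 21 = s.reg 11 ∧ s'.reg 22 = s.reg 9 ∧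
      s'.reg 9 = s.reg 9 + 1 ∧
      (∀ w < s.reg 9, ∀ C < 2 ^ c, ∀ j ≤ c,
        s'.table (2 ^ c) c w C j = s.table (2 ^ c) c w C j) ∧
      IsSingletonTable cl wt c v (s'.table (2 ^ c) c (s.reg 9)) ∧
      ∀ a, (s.reg 9 + 1) * (2 ^ c * (c + 1)) ≤ a → s'.arr 12 a = 0 := by
  have hid := hs.id_le
  have hcl := h.col_lt v hv hvn
  have hC : 2 ^ cl v < 2 ^ c := Nat.pow_lt_pow_right (by norm_num) hcl
  have hL : s.reg 9 + 1 < 2 ^ L := h.bounds.lt (by omega)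
  have hidL := h.bounds.id (m := s.reg 9) (by omega)
  have hcL := h.bounds.size_lt
  have hlt := addr_lt (x := s.reg 9) hC (le_refl c)
  have hlt' := addr_lt (x := s.reg 9) hC hcl.le
  have e4 := hs.frame.2 4 (by norm_num) v
  have e1 : s.arr 1 (s₀.arr 4 v) = cl v := by rw [hs.frame.2 1 (by norm_num), h.col v hv hvn]
  have e0 : s.arr 0 (s₀.arr 4 v) = wt v := by rw [hs.frame.2 0 (by norm_num), h.weight v hv hvn]
  have e9 : s.arr 9 (cl v) = 2 ^ cl v := by rw [hs.frame.2 9 (by norm_num), h.pow _ hcl]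
  have hord := h.ord v hv hvn
  have hw : wt v ≤ ∑ v ∈ Finset.Icc 1 n, wt v :=
    Finset.single_le_sum (f := wt) (fun _ _ => Nat.zero_le _) (Finset.mem_Icc.2 ⟨hv, hvn⟩)
  have hwL := h.bounds.weight
  have ha := hs.a_lt
  have hb := hs.b_lt
  refine (Runs.of_wp (?_ : wp L selectStart _ s)).mono (by simp [selectStart, block, cost])
    fun _ h => h
  simp [selectStart, block, wp, Op.eval, hs.r8, e4, e1, e0, e9, hs.frame.1, h.r1, h.r5, h.r4,
    Frame.refl]
  rw [show s.reg 9 * (2 ^ c * (c + 1)) + 2 ^ cl v * (c + 1) + cl v =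
      addr (2 ^ c) c (s.reg 9) (2 ^ cl v) (cl v) from Nat.add_assoc _ _ _,
    show s.reg 9 * (2 ^ c * (c + 1)) + 2 ^ cl v * (c + 1) + c =
      addr (2 ^ c) c (s.reg 9) (2 ^ cl v) c from Nat.add_assoc _ _ _]
  have hle : s.reg 9 * (2 ^ c * (c + 1)) + 2 ^ cl v * (c + 1) ≤
      addr (2 ^ c) c (s.reg 9) (2 ^ cl v) c := by unfold addr; omega
  refine ⟨by omega, by omega, by omega, by omega, by omega, by omega, by omega, by omega,
    by omega, by omega, by omega, by omega, by omega, by omega, hL, ?_, ?_, ?_⟩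
  · intro w hwz C hC' j hj
    have hd := table_disjoint (x := s.reg 9) hwz.ne (slot_lt hC' hj)
    rw [State.table, State.table]
    simp only [State.setReg_arr, State.setArr_arr, if_true]
    unfold addr at hlt hlt' ⊢
    rw [if_neg (by omega), if_neg (by omega)]
  · intro C hC' j hj
    rw [State.table]
    simp only [State.setReg_arr, State.setArr_arr, if_true, addr_inj hj le_rfl, addr_inj hj hcl.le]
    have hz : s.arr 12 (addr (2 ^ c) c (s.reg 9) C j) = 0 :=
      hs.zero _ (Nat.le_add_right _ _)
    rw [hz]
    by_cases e : C = 2 ^ cl v <;> by_cases e' : j = c <;> simp [e, e']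
  · intro a ha'
    rw [if_neg (by omega), if_neg (by omega)]
    exact hs.zero a ((Nat.mul_le_mul_right _ (by omega)).trans ha')

theorem subtree_zero (h : IsElimTree H par) : subtree par n 0 = {x | 0 < x ∧ x ≤ n} :=
  Set.ext fun x => ⟨fun hx => ⟨hx.1, hx.2.1⟩, fun hx => ⟨hx.1, hx.2, desc_zero h x⟩⟩

/-- The state of the loop over the roots after `i` iterations. -/
structure RootInv (s₀ : State) (H : SimpleGraph ℕ) (par cl wt : ℕ → ℕ) (n c i : ℕ) (s : State) :
    Prop where
  frame : Frame 7 10 s₀ s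
  r7 : s.reg 7 = i
  id_le : s.reg 9 ≤ i * (n + 3)
  zero : ∀ a, s.reg 9 * (2 ^ c * (c + 1)) ≤ a → s.arr 12 a = 0
  id_lt : ∀ u ≤ n, n < u + i → s.arr 11 u < s.reg 9
  solves : ∀ u ≤ n, n < u + i →
    Solves H cl wt c (subtree par n u) (s.table (2 ^ c) c (s.arr 11 u))

theorem insert_forest_children (h : IsElimTree H par) {v : ℕ} (hv : 0 < v) (hvn : v ≤ n) :
    insert v (forest par n (fun w => par w = v) (n + 1)) = subtree par n v := by
  ext x
  rw [Set.mem_insert_iff, h.mem_forest_children]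
  constructor
  · rintro (rfl | hx)
    · exact ⟨hv, hvn, .refl⟩
    · exact hx.1
  · intro hx
    by_cases e : x = v
    · exact .inl e
    · exact .inr ⟨hx, e⟩

/-- After the loop over `u > v`, register 10 gets the number of a table for the subtree of `v`. -/
theorem select_runs (h : Ready L n c H par cl wt s₀) {s : State} {i m v : ℕ}
    (hm : m + n + 3 ≤ (n + 1) * (n + 3)) (hvn : v ≤ n)
    (hs : MergeInv s₀ H par cl wt n c i m v (n + 1) s) :
    Runs L (.ite (.lt (.const 0) (.reg 8)) (.seq selectStart conv) .skip) s (convTime c + 17)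
      fun s' => Frame 9 12 s s' ∧ s'.reg 10 < s'.reg 9 ∧ s'.reg 9 ≤ m + n + 3 ∧
        m ≤ s'.reg 10 ∧
        (∀ w < m, ∀ C < 2 ^ c, ∀ j ≤ c, s'.table (2 ^ c) c w C j = s.table (2 ^ c) c w C j) ∧
        (∀ a, s'.reg 9 * (2 ^ c * (c + 1)) ≤ a → s'.arr 12 a = 0) ∧
        Solves H cl wt c (subtree par n v) (s'.table (2 ^ c) c (s'.reg 10)) := by
  have hid := hs.id_le
  have ha := hs.le_a
  have ha' := hs.a_lt
  have hb := hs.le_b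
  have hb' := hs.b_lt
  have hne := hs.a_ne_b
  refine (Runs.ite (T := 16 + convTime c) (fun hpos => ?_) (fun hpos => ?_)).mono (by omega)
    fun _ h => h
  · have hv : 0 < v := by simpa [Test.Holds, hs.r8] using hpos
    have hcl := h.col_lt v hv hvn
    refine (selectStart_runs h hm hv hvn hs).seq
      fun s₁ ⟨f₁, g10, g20, g21, g22, g9, t₁, hz, z₁⟩ => ?_
    have hA := hs.solves_a.congr (t₁ _ ha')
    have hB := hs.solves_b.congr (t₁ _ hb')
    have hsub : ∀ x ∈ subtree par n v, 0 < x ∧ x ≤ n := fun x hx => ⟨hx.1, hx.2.1⟩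
    have hle : forest par n (fun w => par w = v) (n + 1) ⊆ subtree par n v := fun x hx =>
      ((h.tree.mem_forest_children).1 hx).1
    have hle' : forest par n (Hangs H par v) (n + 1) ⊆ subtree par n v := fun x hx =>
      ((h.tree.mem_forest_hangs hv).1 hx).1
    have hmem : v ∈ subtree par n v := ⟨hv, hvn, .refl⟩
    have hapart : Apart H (forest par n (Hangs H par v) (n + 1)) {v} := by
      rintro x hx y rfl
      have := (h.tree.mem_forest_hangs hv).1 hx
      exact ⟨this.2.1, fun e => this.2.2 e.symm⟩
    have hpre := h.convPre (hs.frame.trans f₁ (by norm_num) (by norm_num) (by norm_num)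
      (by norm_num)) g20 g21 g22 hne.symm ha'.ne' (by omega) (by omega) (by omega) hA.1 hB.1
      (hz.sound hcl) forest_subset forest_subset (by rintro x rfl; exact ⟨hv, hvn⟩)
    refine (conv_runs hpre).mono le_rfl fun s₂ ⟨f₂, t₂, z₂, k₂⟩ => ?_
    have e10 : s₂.reg 10 = s.reg 10 := by rw [f₂.1 10 (by norm_num), g10]
    have e9 : s₂.reg 9 = s.reg 9 + 1 := by rw [f₂.1 9 (by norm_num), g9]
    refine ⟨f₁.trans f₂ (by norm_num) (by norm_num) (by norm_num) (by norm_num), by omega,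
      by omega, by omega, fun w hw C hC j hj => ?_, fun a haa => ?_, ?_⟩
    · rw [t₂ w (by omega) C hC j hj, t₁ w (by omega) C hC j hj]
    · rw [e9] at haa
      rw [z₂ a ((Nat.mul_le_mul_right _ (by omega)).trans haa), z₁ a haa]
    · rw [e10]
      refine ⟨k₂.sound (hA.1.mono hle) hB.1 (hz.sound hcl) hapart
        (Set.union_subset hle' (by simpa using hmem)), ?_⟩
      rw [← insert_forest_children h.tree hv hvn]
      refine k₂.complete_insert hA.2 hB.2 hz hcl fun x hx hadj hxv => ?_
      exact (h.tree.mem_forest_hangs hv).2 ⟨hle hx, hxv, hadj⟩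
  -- The artificial root is not a vertex to be chosen, and its children's table already covers its
  -- subtree.
  · obtain rfl : v = 0 := by simpa [Test.Holds, hs.r8] using hpos
    refine ⟨_, _, .skip _, by omega, Frame.refl _ _ _, ha', by omega, ha,
      fun _ _ _ _ _ _ => rfl, hs.zero, ?_⟩
    convert hs.solves_a using 1
    ext x
    rw [h.tree.mem_forest_children]
    exact ⟨fun hx => ⟨hx, hx.1.ne'⟩, fun hx => hx.1⟩

/-- Round `i` treats `v = n - i`, after all its proper descendants. It uses two empty tables, at
most one for each `u > v` and at most one singleton table: at most `n + 3` in all. -/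
theorem rootBody_runs (h : Ready L n c H par cl wt s₀) {s : State} {i : ℕ} (hi : i < n + 1)
    (hs : RootInv s₀ H par cl wt n c i s) :
    Runs L rootBody s (n * (convTime c + 22) + convTime c + 25) fun s' => s'.reg 7 = i ∧
      RootInv s₀ H par cl wt n c (i + 1) (s'.setReg 7 (i + 1)) := by
  have hid := hs.id_le
  have hm : s.reg 9 + n + 3 ≤ (n + 1) * (n + 3) := by
    have : (i + 1) * (n + 3) ≤ (n + 1) * (n + 3) := Nat.mul_le_mul_right _ hi
    have : (i + 1) * (n + 3) = i * (n + 3) + (n + 3) := Nat.succ_mul _ _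
    omega
  have hL : s.reg 9 + 2 < 2 ^ L := h.bounds.lt (by omega)
  have hnL : n + 1 < 2 ^ L := h.bounds.lt (by nlinarith)
  obtain ⟨v, hv⟩ : ∃ v, v = n - i := ⟨_, rfl⟩
  have h1 : Runs L rootStart s 6 (MergeInv s₀ H par cl wt n c i (s.reg 9) v (v + 1)) := by
    refine (Runs.of_wp ?_).mono (by simp [rootStart, block, cost]) fun _ h => h
    simp [rootStart, block, wp, Op.eval, hs.r7, hs.frame.1 0 (by norm_num), h.r0, ← hv]
    refine ⟨by omega, by omega, by omega, by omega, by omega, ?_⟩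
    have hzero : ∀ x, s.reg 9 ≤ x → ∀ C < 2 ^ c, ∀ j ≤ c, s.table (2 ^ c) c x C j = 0 :=
      fun x hx C _ j _ => table_eq_zero hs.zero hx
    constructor <;> try simp
    · exact hs.frame
    · exact hs.r7
    · exact ⟨fun u h1 h2 => hs.id_lt u h2 (by omega), fun u h1 h2 => hs.solves u h2 (by omega)⟩
    · intro a ha
      exact hs.zero a ((Nat.mul_le_mul_right _ (by omega)).trans ha)
    -- Vertices up to `v` have their parents before `v`, so both forests start empty.
    · rw [forest_eq_empty]
      · exact ⟨sound_zero (hzero _ le_rfl), complete_empty⟩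
      · intro u hu hu0 e
        have := h.tree.par_lt u hu0
        omega
    · rw [forest_eq_empty]
      · exact ⟨sound_zero (hzero _ (by omega)), complete_empty⟩
      · intro u hu hu0 e
        have := h.tree.par_lt u hu0
        have := e.1
        omega
  have h2 : ∀ s₁, MergeInv s₀ H par cl wt n c i (s.reg 9) v (v + 1) s₁ →
      Runs L (loop 12 (.reg 6) vertexBody) s₁ (n * (convTime c + 22) + 1)
        (MergeInv s₀ H par cl wt n c i (s.reg 9) v (n + 1)) := by
    intro s₁ h₁
    have := Runs.loop (L := L) (r := 12) (b := .reg 6) (p := vertexBody) (T := convTime c + 20)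
      (N := n + 1) (fun k s' => v < k ∧ MergeInv s₀ H par cl wt n c i (s.reg 9) v k s') hnL ?_ ?_
      (k := v + 1) (by omega) (s := s₁) ⟨by omega, h₁⟩
    · refine this.mono ?_ fun s' h => h.2
      have : n + 1 - (v + 1) ≤ n := by omega
      exact Nat.add_le_add_right (Nat.mul_le_mul_right _ this) _
    · rintro k s' ⟨_, hk⟩
      exact ⟨hk.r12, by rw [Atom.val_reg, hk.frame.1 6 (by norm_num), h.r6]⟩
    · rintro k s' hkn ⟨hvk, hk⟩
      exact (vertexBody_runs h hm hvk (by omega) hk).mono le_rfl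
        fun s'' h => ⟨h.1, by omega, h.2⟩
  refine (h1.seq fun s₁ h₁ => (h2 s₁ h₁).seq fun s₂ h₂ =>
    (select_runs h hm (by omega) h₂).seq (T' := 1) fun s₃ ⟨f₃, k1, k2, k3, k4, k5, k6⟩ => ?_).mono
    (by omega) fun _ h => h
  refine (Runs.of_wp ?_).mono (by simp [cost]) fun _ h => h
  have e8 : s₃.reg 8 = v := by rw [f₃.1 8 (by norm_num), h₂.r8]
  have e7 : s₃.reg 7 = i := by rw [f₃.1 7 (by norm_num), h₂.r7]
  have hf := h₂.frame.trans f₃ (r'' := 7) (m'' := 10) (by norm_num) (by norm_num) (by norm_num)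
    (by norm_num)
  have hL' : s₃.reg 10 < 2 ^ L := h.bounds.lt (by omega)
  simp [wp, e8, e7, hL']
  have hB := h₂.beyond.congr (f₃.2 11 (by norm_num)) k4
  constructor
  · simpa using hf
  · simp
  · simp
    have : (i + 1) * (n + 3) = i * (n + 3) + (n + 3) := Nat.succ_mul _ _
    omega
  · intro a ha
    simpa using k5 a (by simpa using ha)
  · intro u hu hui
    simp
    split_ifs with e
    · exact k1
    · exact (hB.id_lt u (by omega) hu).trans (by omega)
  · intro u hu hui
    simp
    split_ifs with e
    · subst e
      exact k6.congr fun C _ j _ => by simp [State.table]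
    · exact (hB.solves u (by omega) hu).congr fun C _ j _ => by simp [State.table]

theorem solve_runs (h : Ready L n c H par cl wt s₀) :
    Runs L solve s₀ ((n + 1) * (n * (convTime c + 22) + convTime c + 27) + 4) fun s' =>
      Frame 7 10 s₀ s' ∧ s'.arr 11 0 < (n + 1) * (n + 3) ∧
      Solves H cl wt c {x | 0 < x ∧ x ≤ n} (s'.table (2 ^ c) c (s'.arr 11 0)) := by
  have hnL : n + 1 < 2 ^ L := h.bounds.lt (by nlinarith)
  have h1 : Runs L (block [.op 9 .add (.const 0) (.const 0), .op 7 .add (.const 0) (.const 0)]) s₀ 3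
      (RootInv s₀ H par cl wt n c 0) := by
    refine (Runs.of_wp ?_).mono (by simp [block, cost]) fun _ h => h
    simp [block, wp, Op.eval]
    constructor <;> simp [Frame.refl]
    · exact h.tables
    · omega
  refine (h1.seq (T' := (n + 1) * (n * (convTime c + 22) + convTime c + 27) + 1)
    fun s₁ h₁ => ?_).mono (by omega) fun _ h => h
  have := Runs.loop (L := L) (r := 7) (b := .reg 6) (p := rootBody)
      (T := n * (convTime c + 22) + convTime c + 25) (N := n + 1)
      (RootInv s₀ H par cl wt n c) hnL
      (fun k s' hk => ⟨hk.r7, by rw [Atom.val_reg, hk.frame.1 6 (by norm_num), h.r6]⟩)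
      (fun k s' hk hs => rootBody_runs h hk hs) (Nat.zero_le _) h₁
  refine this.mono (by simp) fun s' hs => ⟨hs.frame, ?_, ?_⟩
  · exact (hs.id_lt 0 (by omega) (by omega)).trans_le hs.id_le
  · have := hs.solves 0 (by omega) (by omega)
    rwa [subtree_zero h.tree] at this

end
end WordRAM

/-! ### Preprocessing -/

namespace WordRAM

/-- `s` agrees with `s₀` on the registers below `r` and on the memories outside `K`. -/
def Keeps (r : ℕ) (K : List ℕ) (s₀ s : State) : Prop :=
  (∀ i < r, s.reg i = s₀.reg i) ∧ ∀ k, k ∉ K → ∀ a, s.arr k a = s₀.arr k a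

theorem Keeps.refl (r : ℕ) (K : List ℕ) (s : State) : Keeps r K s s :=
  ⟨fun _ _ => rfl, fun _ _ _ => rfl⟩

theorem Keeps.trans {r r' r'' : ℕ} {K K' K'' : List ℕ} {s₀ s₁ s₂ : State} (h : Keeps r K s₀ s₁)
    (h' : Keeps r' K' s₁ s₂) (hr : r'' ≤ r) (hr' : r'' ≤ r') (hK : K ⊆ K'') (hK' : K' ⊆ K'') :
    Keeps r'' K'' s₀ s₂ :=
  ⟨fun i hi => (h'.1 i (by omega)).trans (h.1 i (by omega)),
    fun k hk a => (h'.2 k (fun e => hk (hK' e)) a).trans (h.2 k (fun e => hk (hK e)) a)⟩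

@[simp] theorem keeps_setReg {r d x : ℕ} {K : List ℕ} {s₀ s : State} (h : r ≤ d) :
    Keeps r K s₀ (s.setReg d x) ↔ Keeps r K s₀ s := by
  refine and_congr (forall₂_congr fun i hi => ?_) Iff.rfl
  rw [State.setReg_reg, if_neg (by omega)]

@[simp] theorem keeps_setArr {r k a x : ℕ} {K : List ℕ} {s₀ s : State} (h : k ∈ K) :
    Keeps r K s₀ (s.setArr k a x) ↔ Keeps r K s₀ s := by
  refine and_congr Iff.rfl (forall₂_congr fun i hi => forall_congr' fun b => ?_)
  rw [State.setArr_arr, if_neg (by rintro rfl; exact hi h)]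

/-- The powers of two and the sizes of rows and tables. -/
def constants : Prog :=
  .seq (block [.op 5 .add (.reg 1) (.const 1), .op 6 .add (.reg 0) (.const 1),
      .op 2 .add (.const 0) (.const 1), .op 3 .add (.const 0) (.const 1),
      .op 7 .add (.const 0) (.const 0)])
    (.seq (loop 7 (.reg 1) (block [.store 9 (.reg 7) (.reg 2), .op 2 .mul (.reg 2) (.const 2),
        .op 3 .mul (.reg 3) (.const 3)]))
      (.op 4 .mul (.reg 2) (.reg 5)))

/-- The two masks of the ternary number in register 7. -/
def digitsBody : Prog :=
  block [.op 8 .div (.reg 7) (.const 3), .op 9 .mod (.reg 7) (.const 3),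
    .load 10 5 (.reg 8), .op 10 .mul (.const 2) (.reg 10), .op 11 .mod (.reg 9) (.const 2),
    .op 10 .add (.reg 10) (.reg 11), .store 5 (.reg 7) (.reg 10),
    .load 10 6 (.reg 8), .op 10 .mul (.const 2) (.reg 10), .op 11 .div (.reg 9) (.const 2),
    .op 10 .add (.reg 10) (.reg 11), .store 6 (.reg 7) (.reg 10)]

def digits : Prog :=
  .seq (.op 7 .add (.const 0) (.const 0)) (loop 7 (.reg 3) digitsBody)

/-- The vertex in register 10 is compared with the best candidate, in register 9. -/
def searchFindBody : Prog :=
  .seq (.load 11 15 (.reg 10)) (.ite (.eq (.reg 11) (.const 0))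
    (block [.load 12 10 (.reg 10), .op 12 .add (.reg 12) (.const 1),
      .ite (.lt (.reg 8) (.reg 12)) (block [.op 8 .add (.reg 12) (.const 0),
        .op 9 .add (.reg 10) (.const 0)]) .skip]) .skip)

/-- The visited neighbors of the vertex in register 10 are counted anew. -/
def searchCountBody : Prog :=
  block [.op 11 .add (.reg 12) (.reg 10), .load 11 2 (.reg 11), .load 13 10 (.reg 10),
    .op 13 .add (.reg 13) (.reg 11), .store 10 (.reg 10) (.reg 13)]

/-- One step of the search. -/
def searchBody : Prog :=
  .seq (block [.op 8 .add (.const 0) (.const 0), .op 9 .add (.const 0) (.const 0),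
      .op 10 .add (.const 0) (.const 0)])
    (.seq (loop 10 (.reg 0) searchFindBody)
      (.seq (block [.op 11 .add (.reg 7) (.const 1), .store 4 (.reg 11) (.reg 9),
          .store 15 (.reg 9) (.const 1), .op 12 .mul (.reg 9) (.reg 0),
          .op 10 .add (.const 0) (.const 0)])
        (loop 10 (.reg 0) searchCountBody)))

/-- Maximum cardinality search. -/
def search : Prog :=
  .seq (.op 7 .add (.const 0) (.const 0)) (loop 7 (.reg 0) searchBody)

/-- The pair of the vertices in registers 7 and 10 is treated. -/
def parentsStep : Prog :=
  block [.load 11 4 (.reg 10), .op 11 .add (.reg 8) (.reg 11), .load 11 2 (.reg 11),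
    .op 12 .add (.reg 9) (.reg 10), .store 8 (.reg 12) (.reg 11),
    .ite (.lt (.const 0) (.reg 11)) (.store 7 (.reg 7) (.reg 10)) .skip]

def parentsBody : Prog :=
  .seq (block [.load 8 4 (.reg 7), .op 8 .mul (.reg 8) (.reg 0), .op 9 .mul (.reg 7) (.reg 6),
      .op 10 .add (.const 0) (.const 1)])
    (loop 10 (.reg 7) parentsStep)

/-- The adjacency matrix in search order, and the parents. -/
def parents : Prog :=
  .seq (.op 7 .add (.const 0) (.const 1)) (loop 7 (.reg 6) parentsBody)

/-! ### Constants and ternary digits -/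

section
variable {L n c : ℕ} {s₀ : State}

theorem constants_runs {W : ℕ} (hB : Bounds L n c W) (h0 : s₀.reg 0 = n) (h1 : s₀.reg 1 = c) :
    Runs L constants s₀ (c * 6 + 8) fun s => Keeps 2 [9] s₀ s ∧ s.reg 2 = 2 ^ c ∧
      s.reg 3 = 3 ^ c ∧ s.reg 4 = 2 ^ c * (c + 1) ∧ s.reg 5 = c + 1 ∧ s.reg 6 = n + 1 ∧
      ∀ j < c, s.arr 9 j = 2 ^ j := by
  have hnL : n + 1 < 2 ^ L := hB.lt (by nlinarith)
  obtain ⟨h2L, hcL⟩ := hB.size_lt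
  have hML := hB.id (m := 0) (Nat.zero_le _)
  rw [zero_add, one_mul] at hML
  let I : ℕ → State → Prop := fun k s => s.reg 7 = k ∧ Keeps 2 [9] s₀ s ∧ s.reg 2 = 2 ^ k ∧
    s.reg 3 = 3 ^ k ∧ s.reg 5 = c + 1 ∧ s.reg 6 = n + 1 ∧ ∀ j < k, s.arr 9 j = 2 ^ j
  have a : Runs L (block [.op 5 .add (.reg 1) (.const 1), .op 6 .add (.reg 0) (.const 1),
      .op 2 .add (.const 0) (.const 1), .op 3 .add (.const 0) (.const 1),
      .op 7 .add (.const 0) (.const 0)]) s₀ 6 (I 0) := by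
    refine (Runs.of_wp ?_).mono (by simp [block, cost]) fun _ h => h
    have hL : L ≠ 0 := by rintro rfl; simp at hnL
    simp [block, wp, Op.eval, h0, h1, I, Keeps.refl]
    omega
  refine (a.seq (T' := c * 6 + 2) fun s₁ h₁ => Runs.seq (T := c * 6 + 1) (T' := 1) (R := I c) ?_
    fun s₂ ⟨_, b1, b2, b3, b4, b5, b6⟩ => ?_).mono (by omega) fun _ h => h
  · refine (Runs.loop (T := 4) I (by omega : c < 2 ^ L) ?_ ?_ (Nat.zero_le _) h₁).mono (by omega)
      fun _ h => h
    · rintro k s ⟨hk, hk', _⟩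
      exact ⟨hk, by simp [hk'.1, h1]⟩
    · rintro k s hkc ⟨b0, b1, b2, b3, b4, b5, b6⟩
      refine (Runs.of_wp ?_).mono (by simp [block, cost]) fun _ h => h
      have e2 : 2 ^ (k + 1) ≤ 2 ^ c := Nat.pow_le_pow_right (by norm_num) hkc
      have e3 : 3 ^ (k + 1) ≤ 3 ^ c := Nat.pow_le_pow_right (by norm_num) hkc
      have hp := hB.pow
      rw [pow_succ] at e2 e3
      simp [block, wp, Op.eval, b0, b2, b3, b4, b5, I, pow_succ, b1]
      refine ⟨by omega, by omega, by omega, fun j hj => ?_⟩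
      split_ifs with e
      · rw [e]
      · exact b6 j (by omega)
  · refine (Runs.of_wp ?_).mono (by simp [cost]) fun _ h => h
    simp [wp, Op.eval, b1, b2, b3, b4, b5, hML]
    exact b6

/-- The masks of `t` extend those of `t / 3`, found in an earlier cell. For `t = 0` that cell is the
one being written; its initial zero is the right value, which is why the invariant keeps the
remaining cells zero. -/
theorem digits_runs {W : ℕ} (hB : Bounds L n c W) (h3 : s₀.reg 3 = 3 ^ c)
    (h5 : ∀ a, s₀.arr 5 a = 0) (h6 : ∀ a, s₀.arr 6 a = 0) :
    Runs L digits s₀ (3 ^ c * 15 + 2) fun s => Keeps 7 [5, 6] s₀ s ∧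
      ∀ t < 3 ^ c, s.arr 5 t = ternFst t ∧ s.arr 6 t = ternSnd t := by
  obtain ⟨h2L, hcL⟩ := hB.size_lt
  have hp := hB.pow
  have h3L : 3 < 2 ^ L := by
    refine lt_of_le_of_lt ?_ (hB.lt le_rfl)
    nlinarith
  let I : ℕ → State → Prop := fun k s => s.reg 7 = k ∧ Keeps 7 [5, 6] s₀ s ∧
    (∀ t < k, s.arr 5 t = ternFst t ∧ s.arr 6 t = ternSnd t) ∧
    ∀ t ≥ k, s.arr 5 t = 0 ∧ s.arr 6 t = 0
  have a : Runs L (.op 7 .add (.const 0) (.const 0)) s₀ 1 (I 0) := by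
    refine (Runs.of_wp ?_).mono (by simp [cost]) fun _ h => h
    simp [wp, Op.eval, I, Keeps.refl, h5, h6]
  refine (a.seq (T' := 3 ^ c * 15 + 1) fun s₁ h₁ => ?_).mono (by omega) fun _ h => h
  refine (Runs.loop (T := 13) I hp ?_ ?_ (Nat.zero_le _) h₁).mono (by omega)
      fun s ⟨_, b1, b2, _⟩ => ⟨b1, b2⟩
  · rintro k s ⟨hk, hk', _⟩
    exact ⟨hk, by simp [hk'.1, h3]⟩
  · rintro k s hkc ⟨b0, b1, b2, b3⟩
    refine (Runs.of_wp (?_ : wp L digitsBody _ s)).mono (by simp [digitsBody, block, cost])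
      fun _ h => h
    have hd : s.arr 5 (k / 3) = ternFst (k / 3) ∧ s.arr 6 (k / 3) = ternSnd (k / 3) := by
      by_cases hk : k = 0
      · subst hk
        simpa [ternFst_zero, ternSnd_zero] using b3 0 le_rfl
      · exact b2 _ (by omega)
    have hlt := tern_add_lt hkc
    have hf := ternFst_eq k
    have hs := ternSnd_eq k
    have hm : k % 3 < 3 := Nat.mod_lt _ (by norm_num)
    simp [digitsBody, block, wp, Op.eval, b0, hd, ← hf, ← hs, I, b1]
    refine ⟨by omega, by omega, by omega, by omega, by omega, by omega, by omega, by omega,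
      by omega, by omega, ?_, ?_⟩
    · intro t ht
      by_cases e : t = k
      · simp [e]
      · simpa [e] using b2 t (by omega)
    · intro t ht
      have e : t ≠ k := by omega
      simpa [e] using b3 t (by omega)

end
-- Maximum cardinality search
section
variable {L n c : ℕ} {s₀ : State}

/-- The number of neighbors of `x` among `o 1, ..., o k`; the entries of the adjacency matrix are
given by `A`. -/
def nbrCount (A : ℕ → ℕ → ℕ) (o : ℕ → ℕ) (k x : ℕ) : ℕ :=
  ∑ i ∈ Finset.range k, A (o (i + 1)) x

/-- `o 1, ..., o k` are the vertices found in the first `k` steps of a maximum cardinality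
search. -/
structure IsSearch (A : ℕ → ℕ → ℕ) (n : ℕ) (o : ℕ → ℕ) (k : ℕ) : Prop where
  lt : ∀ i < k, o (i + 1) < n
  inj : ∀ i < k, ∀ j < k, o (i + 1) = o (j + 1) → i = j
  max : ∀ i < k, ∀ x < n, (∀ j < i, o (j + 1) ≠ x) → nbrCount A o i x ≤ nbrCount A o i (o (i + 1))

/-- The adjacency matrix in memory 2. -/
def State.adj (s : State) (n x y : ℕ) : ℕ := s.arr 2 (x * n + y)

/-- The state of the search after `k` steps. -/
structure SearchInv (s₀ : State) (n k : ℕ) (s : State) : Prop where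
  keeps : Keeps 7 [4, 10, 15] s₀ s
  r7 : s.reg 7 = k
  search : IsSearch (s₀.adj n) n (s.arr 4) k
  vis : ∀ x < n, s.arr 15 x ≠ 0 ↔ ∃ i < k, s.arr 4 (i + 1) = x
  vis_le : ∀ x, s.arr 15 x ≤ 1
  cnt : ∀ x < n, s.arr 10 x = nbrCount (s₀.adj n) (s.arr 4) k x

theorem nbrCount_le {A : ℕ → ℕ → ℕ} (hA : ∀ x y, A x y ≤ 1) (o : ℕ → ℕ) (k x : ℕ) :
    nbrCount A o k x ≤ k := by
  simpa [nbrCount] using Finset.sum_le_card_nsmul (Finset.range k) (fun i => A (o (i + 1)) x) 1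
    fun i _ => hA _ _

theorem nbrCount_congr {A : ℕ → ℕ → ℕ} {o o' : ℕ → ℕ} {k x : ℕ}
    (h : ∀ i < k, o (i + 1) = o' (i + 1)) : nbrCount A o k x = nbrCount A o' k x :=
  Finset.sum_congr rfl fun i hi => by rw [h i (Finset.mem_range.1 hi)]

theorem exists_not_visited {o : ℕ → ℕ} {k : ℕ} (hk : k < n) :
    ∃ x < n, ∀ i < k, o (i + 1) ≠ x := by
  by_contra! h
  have : Finset.range n ⊆ (Finset.range k).image fun i => o (i + 1) := by
    intro x hx
    obtain ⟨i, hi, e⟩ := h x (Finset.mem_range.1 hx)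
    exact Finset.mem_image.2 ⟨i, Finset.mem_range.2 hi, e⟩
  have := (Finset.card_le_card this).trans Finset.card_image_le
  simp at this
  omega

/-- Register 8 holds the best count plus one, so that `0` means no candidate yet. Since an unvisited
vertex exists, a candidate is found. -/
theorem searchFind_runs (hnL : n + 1 < 2 ^ L) (h0 : s₀.reg 0 = n)
    (hA : ∀ x y, s₀.adj n x y ≤ 1) {s : State} {k : ℕ} (hk : k < n) (hs : SearchInv s₀ n k s)
    {s₁ : State} (hs₁ : Keeps 8 [] s s₁) (h8 : s₁.reg 8 = 0) (h10 : s₁.reg 10 = 0) :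
    Runs L (loop 10 (.reg 0) searchFindBody) s₁ (n * 12 + 1) fun s' => Keeps 8 [] s s' ∧
      s'.reg 9 < n ∧ (∀ i < k, s.arr 4 (i + 1) ≠ s'.reg 9) ∧
      ∀ x < n, (∀ i < k, s.arr 4 (i + 1) ≠ x) →
        nbrCount (s₀.adj n) (s.arr 4) k x ≤ nbrCount (s₀.adj n) (s.arr 4) k (s'.reg 9) := by
  let I : ℕ → State → Prop := fun j s' => s'.reg 10 = j ∧ Keeps 8 [] s s' ∧
    (s'.reg 8 = 0 ∨ (s'.reg 9 < n ∧ s.arr 15 (s'.reg 9) = 0 ∧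
      s'.reg 8 = s.arr 10 (s'.reg 9) + 1)) ∧
    ∀ x < j, s.arr 15 x = 0 → s.arr 10 x + 1 ≤ s'.reg 8
  have hcnt : ∀ x < n, s.arr 10 x ≤ k := fun x hx => by
    rw [hs.cnt x hx]; exact nbrCount_le hA _ _ _
  refine (Runs.loop (T := 10) I (by omega : n < 2 ^ L) ?_ ?_ (Nat.zero_le _) ⟨h10, hs₁, .inl h8,
    by simp⟩).mono (by omega) ?_
  · rintro j s' ⟨hj, hj', _⟩
    exact ⟨hj, by simp [hj'.1, hs.keeps.1, h0]⟩
  · rintro j s' hjn ⟨b0, b1, b2, b3⟩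
    refine (Runs.of_wp (?_ : wp L searchFindBody _ s')).mono
      (by simp [searchFindBody, block, cost]) fun _ h => h
    have hv := hs.vis_le j
    have hc := hcnt j hjn
    have e15 := b1.2 15 (by simp)
    have e10 := b1.2 10 (by simp)
    simp [searchFindBody, block, wp, Op.eval, b0, I, b1, Test.Holds, e15, e10]
    refine ⟨by omega, fun hvis => ⟨by omega, by omega, fun hlt => ⟨by omega, by omega, ⟨hjn, hvis⟩,
      fun x hx hx0 => ?_⟩, fun hge => ⟨b2, fun x hx hx0 => ?_⟩⟩, fun hvis => ⟨b2, fun x hx hx0 => ?_⟩⟩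
    · rcases hx.lt_or_eq with hx | rfl
      · have := b3 x hx hx0
        omega
      · exact le_rfl
    · rcases hx.lt_or_eq with hx | rfl
      · exact b3 x hx hx0
      · omega
    · rcases hx.lt_or_eq with hx | rfl
      · exact b3 x hx hx0
      · exact (hvis hx0).elim
  · rintro s' ⟨b0, b1, b2, b3⟩
    have hvis : ∀ x < n, s.arr 15 x = 0 ↔ ∀ i < k, s.arr 4 (i + 1) ≠ x := by
      intro x hx
      have := hs.vis x hx
      rw [← not_iff_not, ← ne_eq, this]
      push Not
      rfl
    obtain ⟨y, hy, hy'⟩ := exists_not_visited (o := s.arr 4) hk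
    have hpos := b3 y hy ((hvis y hy).2 hy')
    obtain ⟨c1, c2, c3⟩ := b2.resolve_left (by omega)
    refine ⟨b1, c1, (hvis _ c1).1 c2, fun x hx hx' => ?_⟩
    have := b3 x hx ((hvis x hx).2 hx')
    rw [c3, hs.cnt x hx, hs.cnt _ c1] at this
    omega

theorem searchBody_runs (hnL : (n + 1) * (n + 3) < 2 ^ L) (h0 : s₀.reg 0 = n)
    (hA : ∀ x y, s₀.adj n x y ≤ 1) {s : State} {k : ℕ} (hk : k < n) (hs : SearchInv s₀ n k s) :
    Runs L searchBody s (n * 20 + 20) fun s' => s'.reg 7 = k ∧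
      SearchInv s₀ n (k + 1) (s'.setReg 7 (k + 1)) := by
  have hnL' : n + 1 < 2 ^ L := lt_of_le_of_lt (by nlinarith) hnL
  have hL : L ≠ 0 := by rintro rfl; simp at hnL'
  have a : Runs L (block [.op 8 .add (.const 0) (.const 0), .op 9 .add (.const 0) (.const 0),
      .op 10 .add (.const 0) (.const 0)]) s 4 fun s' => Keeps 8 [] s s' ∧ s'.reg 8 = 0 ∧
        s'.reg 10 = 0 := by
    refine (Runs.of_wp ?_).mono (by simp [block, cost]) fun _ h => h
    simp [block, wp, Op.eval, Keeps.refl]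
  refine (a.seq (T' := (n * 12 + 1) + (n * 8 + 15)) fun s₁ ⟨a1, a2, a3⟩ =>
    Runs.seq (searchFind_runs hnL' h0 hA hk hs a1 a2 a3)
    fun s₂ ⟨b1, b2, b3, b4⟩ => ?_).mono (by omega) fun _ h => h
  obtain ⟨x, hx⟩ : ∃ x, x = s₂.reg 9 := ⟨_, rfl⟩
  rw [← hx] at b2 b3 b4
  have hxn : x * n + n ≤ (n + 1) * (n + 3) := by nlinarith
  have e7 : s₂.reg 7 = k := by rw [b1.1 7 (by norm_num), hs.r7]
  have e0 : s₂.reg 0 = n := by rw [b1.1 0 (by norm_num), hs.keeps.1 0 (by norm_num), h0]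
  have d : Runs L (block [.op 11 .add (.reg 7) (.const 1), .store 4 (.reg 11) (.reg 9),
      .store 15 (.reg 9) (.const 1), .op 12 .mul (.reg 9) (.reg 0),
      .op 10 .add (.const 0) (.const 0)]) s₂ 6 fun s' => Keeps 8 [4, 15] s s' ∧
        s'.reg 12 = x * n ∧ s'.reg 10 = 0 ∧
        (∀ a, s'.arr 4 a = if a = k + 1 then x else s.arr 4 a) ∧
        ∀ a, s'.arr 15 a = if a = x then 1 else s.arr 15 a := by
    refine (Runs.of_wp ?_).mono (by simp [block, cost]) fun _ h => h
    have hk2 : Keeps 8 [4, 15] s s₂ := b1.trans (Keeps.refl 8 [] _) le_rfl le_rfl (by simp) (by simp)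
    simp [block, wp, Op.eval, e7, e0, ← hx, hk2, b1.2, hL]
    omega
  refine (d.seq (T' := n * 8 + 1) fun s₃ ⟨d1, d2, d3, d4, d5⟩ => ?_).mono (by omega)
    fun _ h => h
  have e03 : s₃.reg 0 = n := by rw [d1.1 0 (by norm_num), hs.keeps.1 0 (by norm_num), h0]
  -- The row of the new vertex `x` is added to the counts, as far as column `j`.
  let I : ℕ → State → Prop := fun j s' => s'.reg 10 = j ∧ Keeps 10 [10] s₃ s' ∧
    s'.reg 12 = x * n ∧ ∀ y, s'.arr 10 y = s.arr 10 y + if y < j then s₀.adj n x y else 0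
  refine (Runs.loop (T := 6) I (by omega : n < 2 ^ L) ?_ ?_ (Nat.zero_le _)
    ⟨d3, Keeps.refl _ _ _, d2, by simp [d1.2]⟩).mono (by omega) ?_
  · rintro j s' ⟨hj, hj', _⟩
    exact ⟨hj, by simp [hj'.1, e03]⟩
  · rintro j s' hjn ⟨f0, f1, f2, f3⟩
    have ha : s'.arr 2 (x * n + j) = s₀.adj n x j := by
      rw [f1.2 2 (by simp), d1.2 2 (by simp), hs.keeps.2 2 (by simp), State.adj]
    have hA' := hA x j
    have hc : s.arr 10 j ≤ k := by rw [hs.cnt j hjn]; exact nbrCount_le hA _ _ _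
    refine (Runs.of_wp (?_ : wp L searchCountBody _ s')).mono
      (by simp [searchCountBody, block, cost]) fun _ h => h
    simp [searchCountBody, block, wp, Op.eval, f0, f2, f3, ha, I, f1]
    refine ⟨by omega, by omega, by omega, by omega, fun y => ?_⟩
    rcases Nat.lt_trichotomy y j with h | rfl | h
    · simp [h.ne, h]
      intro h'
      omega
    · simp
    · simp [h.ne', show ¬ y < j by omega]
      intro h'
      omega
  · rintro s' ⟨f0, f1, f2, f3⟩
    have e4 : ∀ a, s'.arr 4 a = if a = k + 1 then x else s.arr 4 a := fun a => by
      rw [f1.2 4 (by simp), d4]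
    have e4' : ∀ i < k, s'.arr 4 (i + 1) = s.arr 4 (i + 1) := fun i hi => by
      rw [e4, if_neg (by omega)]
    have e4k : s'.arr 4 (k + 1) = x := by rw [e4, if_pos rfl]
    have e15 : ∀ a, s'.arr 15 a = if a = x then 1 else s.arr 15 a := fun a => by
      rw [f1.2 15 (by simp), d5]
    have hex : ∀ y, (∃ i < k + 1, s'.arr 4 (i + 1) = y) ↔ y = x ∨ ∃ i < k, s.arr 4 (i + 1) = y := by
      intro y
      constructor
      · rintro ⟨i, hi, e⟩
        rcases Nat.lt_succ_iff_lt_or_eq.1 hi with hi | rfl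
        · exact .inr ⟨i, hi, by rw [← e4' i hi, e]⟩
        · exact .inl (by rw [← e, e4k])
      · rintro (rfl | ⟨i, hi, e⟩)
        · exact ⟨k, by omega, e4k⟩
        · exact ⟨i, by omega, by rw [e4' i hi, e]⟩
    refine ⟨by rw [f1.1 7 (by norm_num), d1.1 7 (by norm_num), hs.r7], ?_⟩
    have hkeep := (hs.keeps.trans d1 (r'' := 7) (K'' := [4, 10, 15]) (by norm_num) (by norm_num)
      (by simp) (by simp)).trans f1 (r'' := 7) (K'' := [4, 10, 15]) (by norm_num) (by norm_num)
      (by simp) (by simp)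
    refine ⟨by simpa using hkeep, by simp, ?_, ?_, ?_, ?_⟩
    · simp only [State.setReg_arr]
      constructor
      · intro i hi
        rcases Nat.lt_succ_iff_lt_or_eq.1 hi with hi | rfl
        · rw [e4' i hi]; exact hs.search.lt i hi
        · rwa [e4k]
      · intro i hi j hj e
        rcases Nat.lt_succ_iff_lt_or_eq.1 hi with hi | rfl <;>
          rcases Nat.lt_succ_iff_lt_or_eq.1 hj with hj | rfl
        · rw [e4' i hi, e4' j hj] at e
          exact hs.search.inj i hi j hj e
        · rw [e4' i hi, e4k] at e
          exact (b3 i hi e).elim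
        · rw [e4' j hj, e4k] at e
          exact (b3 j hj e.symm).elim
        · rfl
      · intro i hi y hy hne
        -- Counts at step `i` involve only the first `i` entries, which the new entry leaves alone.
        have hcg : ∀ z, nbrCount (s₀.adj n) (s'.arr 4) i z = nbrCount (s₀.adj n) (s.arr 4) i z :=
          fun z => nbrCount_congr fun j hj => e4' j (by omega)
        have hne' : ∀ j < i, s.arr 4 (j + 1) ≠ y := fun j hj => by
          rw [← e4' j (by omega)]; exact hne j hj
        rw [hcg, hcg]
        rcases Nat.lt_succ_iff_lt_or_eq.1 hi with hi | rfl
        · rw [e4' i hi]; exact hs.search.max i hi y hy hne'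
        · rw [e4k]; exact b4 y hy hne'
    · intro y hy
      simp only [State.setReg_arr]
      rw [hex, e15, ← hs.vis y hy]
      by_cases e : y = x <;> simp [e]
    · intro y
      simp only [State.setReg_arr, e15]
      split_ifs
      · exact le_rfl
      · exact hs.vis_le y
    · intro y hy
      simp only [State.setReg_arr]
      rw [f3, if_pos hy, hs.cnt y hy, nbrCount, nbrCount, Finset.sum_range_succ, e4k]
      exact congrArg (· + _) (nbrCount_congr fun i hi => (e4' i hi).symm)

theorem search_runs (hnL : (n + 1) * (n + 3) < 2 ^ L) (h0 : s₀.reg 0 = n)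
    (hA : ∀ x y, s₀.adj n x y ≤ 1) (h10 : ∀ a, s₀.arr 10 a = 0) (h15 : ∀ a, s₀.arr 15 a = 0) :
    Runs L search s₀ (n * (n * 20 + 22) + 2) fun s => Keeps 7 [4, 10, 15] s₀ s ∧
      IsSearch (s₀.adj n) n (s.arr 4) n := by
  have a : Runs L (.op 7 .add (.const 0) (.const 0)) s₀ 1 (SearchInv s₀ n 0) := by
    refine (Runs.of_wp ?_).mono (by simp [cost]) fun _ h => h
    simp only [wp, Op.eval, Atom.val_const]
    refine ⟨by positivity, ⟨by simp [Keeps.refl], by simp, ⟨by simp, by simp, by simp⟩, ?_, ?_, ?_⟩⟩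
    · simp [h15]
    · simp [h15]
    · simp [h10, nbrCount]
  refine (a.seq (T' := n * (n * 20 + 22) + 1) fun s₁ h₁ => ?_).mono (by omega) fun _ h => h
  refine (Runs.loop (T := n * 20 + 20) (SearchInv s₀ n) (lt_of_le_of_lt (by nlinarith) hnL : n < 2 ^ L)
    ?_ ?_ (Nat.zero_le _) h₁).mono (by simp) fun s hs => ⟨hs.keeps, hs.search⟩
  · intro k s hs
    exact ⟨hs.r7, by rw [Atom.val_reg, hs.keeps.1 0 (by norm_num), h0]⟩
  · intro k s hk hs
    exact searchBody_runs hnL h0 hA hk hs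

end
-- The elimination tree and the reordered adjacency matrix
section
variable {L n c : ℕ} {s₀ : State}

theorem row_inj {n a b a' b' : ℕ} (hb : b ≤ n) (hb' : b' ≤ n) :
    a * (n + 1) + b = a' * (n + 1) + b' ↔ a = a' ∧ b = b' := by
  have := addr_inj (N := 0) (x := 0) (C := a) (C' := a') hb hb'
  simpa only [addr, Nat.add_left_cancel_iff] using this

/-- The pairs that precede `(i, j)` in the loops over the pairs. -/
def Before (i j a b : ℕ) : Prop := a < i ∨ (a = i ∧ b < j)

/-- The state before the pair `(i, j)` is treated; `A` is the adjacency matrix in search order. -/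
structure ParentsInv (s₀ : State) (A : ℕ → ℕ → ℕ) (n i j : ℕ) (s : State) : Prop where
  keeps : Keeps 7 [7, 8] s₀ s
  r7 : s.reg 7 = i
  adj : ∀ a b, 0 < b → b < a → a ≤ n → Before i j a b → s.arr 8 (a * (n + 1) + b) = A a b
  adj_zero : ∀ a, s.arr 8 (a * (n + 1) + 0) = 0
  par : ∀ a, s.arr 7 a = 0 ∨ (s.arr 7 a < a ∧ A a (s.arr 7 a) ≠ 0)
  le_par : ∀ a b, 0 < b → b < a → a ≤ n → Before i j a b → A a b ≠ 0 → b ≤ s.arr 7 a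

/-- The candidates `j < i` are scanned in increasing order, so the last neighbor stored as parent is
the largest. -/
theorem parentsBody_runs (hnL : (n + 1) * (n + 3) < 2 ^ L) (h0 : s₀.reg 0 = n)
    (h6 : s₀.reg 6 = n + 1) {A : ℕ → ℕ → ℕ} (hA1 : ∀ i j, A i j ≤ 1)
    (ho : ∀ i, 0 < i → i ≤ n → s₀.arr 4 i < n)
    (hA : ∀ i j, s₀.arr 2 (s₀.arr 4 i * n + s₀.arr 4 j) = A i j)
    {s : State} {i : ℕ} (hi : 0 < i) (hin : i ≤ n) (hs : ParentsInv s₀ A n i 1 s) :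
    Runs L parentsBody s (n * 10 + 6) fun s' => s'.reg 7 = i ∧
      ParentsInv s₀ A n (i + 1) 1 (s'.setReg 7 (i + 1)) := by
  have hnL' : n + 1 < 2 ^ L := lt_of_le_of_lt (by nlinarith) hnL
  have hL : L ≠ 0 := by rintro rfl; simp at hnL'
  have hmul : ∀ a b, a ≤ n → b ≤ n → a * (n + 1) + b < (n + 1) * (n + 3) := by
    intro a b ha hb; nlinarith
  have hmul' : ∀ a b, a ≤ n → b ≤ n → a * n + b < (n + 1) * (n + 3) := by
    intro a b ha hb; nlinarith
  let I : ℕ → State → Prop := fun j s => s.reg 10 = j ∧ 0 < j ∧ s.reg 8 = s₀.arr 4 i * n ∧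
    s.reg 9 = i * (n + 1) ∧ ParentsInv s₀ A n i j s
  have a : Runs L (block [.load 8 4 (.reg 7), .op 8 .mul (.reg 8) (.reg 0),
      .op 9 .mul (.reg 7) (.reg 6), .op 10 .add (.const 0) (.const 1)]) s 5 (I 1) := by
    refine (Runs.of_wp ?_).mono (by simp [block, cost]) fun _ h => h
    have e4 := hs.keeps.2 4 (by simp) i
    have hoi := ho i hi hin
    have h1 := hmul i 0 hin (by omega)
    have h2 := hmul' (s₀.arr 4 i) 0 hoi.le (by omega)
    simp [block, wp, Op.eval, hs.r7, e4, hs.keeps.1, h0, h6, I, hL]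
    refine ⟨by omega, by omega, by omega, ⟨?_, ?_, ?_, ?_, ?_, ?_⟩⟩
    · simpa using hs.keeps
    · simpa using hs.r7
    · exact hs.adj
    · exact hs.adj_zero
    · exact hs.par
    · exact hs.le_par
  refine (a.seq (T' := n * 10 + 1) fun s₁ h₁ => ?_).mono (by omega) fun _ h => h
  refine (Runs.loop (T := 8) I (by omega : i < 2 ^ L) ?_ ?_ hi h₁).mono ?_ ?_
  · rintro j s ⟨hj, _, _, _, h⟩
    exact ⟨hj, h.r7⟩
  · rintro j s hj ⟨b0, b1, b2, b3, b4⟩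
    have e4 := b4.keeps.2 4 (by simp) j
    have e2 := b4.keeps.2 2 (by simp) (s₀.arr 4 i * n + s₀.arr 4 j)
    rw [hA] at e2
    have hoi := ho i hi hin
    have hoj := ho j b1 (by omega)
    have h1 := hmul i j hin (by omega)
    have h2 := hmul' (s₀.arr 4 i) (s₀.arr 4 j) hoi.le hoj.le
    have h3 := hA1 i j
    have hadj : ∀ a b, 0 < b → b < a → a ≤ n → Before i (j + 1) a b →
        (if a * (n + 1) + b = i * (n + 1) + j then A i j else s.arr 8 (a * (n + 1) + b)) =
          A a b := by
      intro a b hb hba han hbef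
      simp only [row_inj (show b ≤ n by omega) (show j ≤ n by omega)]
      split_ifs with e
      · rw [e.1, e.2]
      · refine b4.adj a b hb hba han ?_
        unfold Before at hbef ⊢
        omega
    -- Column `0` belongs to the artificial root and is never written, as `j` starts at `1`.
    have hadj0 : ∀ a, (if a * (n + 1) + 0 = i * (n + 1) + j then A i j
        else s.arr 8 (a * (n + 1) + 0)) = 0 := by
      intro a
      simp only [row_inj (Nat.zero_le n) (show j ≤ n by omega)]
      rw [if_neg (by omega), b4.adj_zero]
    refine (Runs.of_wp (?_ : wp L parentsStep _ s)).mono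
      (by simp [parentsStep, block, cost]) fun _ h => h
    simp [parentsStep, block, wp, Op.eval, b0, b2, b3, e4, e2, b4.r7, I, Test.Holds]
    refine ⟨by omega, by omega, by omega, by omega, by omega, fun hpos => ⟨by omega, ?_⟩,
      fun hzero => ?_⟩
    · refine ⟨?_, ?_, ?_, ?_, ?_, ?_⟩
      · simpa using b4.keeps
      · simpa using b4.r7
      · simpa using hadj
      · simpa using hadj0
      · intro a
        by_cases e : a = i
        · subst e
          simp [hj, hpos.ne']
        · simpa [e] using b4.par a
      · intro a b hb hba han hbef hne
        by_cases e : a = i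
        · subst e
          simp only [State.setReg_arr, State.setArr_arr, if_true]
          unfold Before at hbef
          omega
        · have : Before i j a b := by unfold Before at hbef ⊢; omega
          simpa [e] using b4.le_par a b hb hba han this hne
    · refine ⟨?_, ?_, ?_, ?_, ?_, ?_⟩
      · simpa using b4.keeps
      · simpa using b4.r7
      · simpa using hadj
      · simpa using hadj0
      · simpa using b4.par
      · intro a b hb hba han hbef hne
        have : Before i j a b := by
          by_contra hn
          have : a = i ∧ b = j := by unfold Before at hbef hn; omega
          rw [this.1, this.2] at hne
          exact hne hzero
        simpa using b4.le_par a b hb hba han this hne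
  · have : i - 1 ≤ n := by omega
    omega
  · rintro s ⟨_, _, _, _, h⟩
    refine ⟨h.r7, ?_, ?_, ?_, ?_, ?_, ?_⟩
    · simpa using h.keeps
    · simp
    · intro a b hb hba han hbef
      exact h.adj a b hb hba han (by unfold Before at hbef ⊢; omega)
    · exact h.adj_zero
    · exact h.par
    · intro a b hb hba han hbef
      exact h.le_par a b hb hba han (by unfold Before at hbef ⊢; omega)

theorem parents_runs (hn : 0 < n) (hnL : (n + 1) * (n + 3) < 2 ^ L) (h0 : s₀.reg 0 = n)
    (h6 : s₀.reg 6 = n + 1) {A : ℕ → ℕ → ℕ} (hA1 : ∀ i j, A i j ≤ 1)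
    (ho : ∀ i, 0 < i → i ≤ n → s₀.arr 4 i < n)
    (hA : ∀ i j, s₀.arr 2 (s₀.arr 4 i * n + s₀.arr 4 j) = A i j)
    (h7 : ∀ a, s₀.arr 7 a = 0) (h8 : ∀ a, s₀.arr 8 a = 0) :
    Runs L parents s₀ (n * (n * 10 + 8) + 2) (ParentsInv s₀ A n (n + 1) 1) := by
  have hnL' : n + 1 < 2 ^ L := lt_of_le_of_lt (by nlinarith) hnL
  have hL : L ≠ 0 := by rintro rfl; simp at hnL'
  have a : Runs L (.op 7 .add (.const 0) (.const 1)) s₀ 1 (ParentsInv s₀ A n 1 1) := by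
    refine (Runs.of_wp ?_).mono (by simp [cost]) fun _ h => h
    simp only [wp, Op.eval, Atom.val_const]
    refine ⟨by omega, by simp [Keeps.refl], by simp, ?_, ?_, ?_, ?_⟩
    · intro a b hb hba han hbef
      unfold Before at hbef; omega
    · simp [h8]
    · simp [h7]
    · intro a b hb hba han hbef
      unfold Before at hbef; omega
  refine (a.seq (T' := n * (n * 10 + 8) + 1) fun s₁ h₁ => ?_).mono (by omega) fun _ h => h
  refine (Runs.loop (T := n * 10 + 6) (fun i s => 0 < i ∧ ParentsInv s₀ A n i 1 s) hnL' ?_ ?_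
    (by omega) ⟨by omega, h₁⟩).mono (by simp) fun s hs => hs.2
  · rintro i s ⟨_, hs⟩
    exact ⟨hs.r7, by rw [Atom.val_reg, hs.keeps.1 6 (by norm_num), h6]⟩
  · rintro i s hi ⟨hi0, hs⟩
    exact (parentsBody_runs hnL h0 h6 hA1 ho hA hi0 (by omega) hs).mono le_rfl
      fun s' h => ⟨h.1, by omega, h.2⟩

end

/-! ### The complete program -/

/-- A nonzero slot is a number in search order; memory 4 turns it into an input vertex. -/
def outputBody : Prog :=
  block [.op 9 .add (.reg 8) (.reg 7), .load 9 12 (.reg 9),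
    .ite (.lt (.const 0) (.reg 9)) (block [.load 9 4 (.reg 9), .store 3 (.reg 9) (.const 1)]) .skip]

/-- The vertices in the last row of the table of the root are written to memory 3. -/
def output : Prog :=
  .seq (block [.load 8 11 (.const 0), .op 8 .mul (.reg 8) (.reg 4), .op 9 .sub (.reg 2) (.const 1),
      .op 9 .mul (.reg 9) (.reg 5), .op 8 .add (.reg 8) (.reg 9), .op 7 .add (.const 0) (.const 0)])
    (loop 7 (.reg 1) outputBody)

/-- Max-Weight Colorful Independent Set on chordal graphs. -/
def colorfulIndepSetProgram : Prog :=
  .ite (.lt (.const 0) (.reg 0)) (.seq constants (.seq digits (.seq search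
    (.seq parents (.seq solve output))))) .skip

/-! ### Reading off the solution -/

section
variable {L n c : ℕ} {s₀ : State}

theorem output_runs {W x : ℕ} {r : ℕ → ℕ} (hB : Bounds L n c W) (h1 : s₀.reg 1 = c)
    (h2 : s₀.reg 2 = 2 ^ c) (h4 : s₀.reg 4 = 2 ^ c * (c + 1)) (h5 : s₀.reg 5 = c + 1)
    (hx : s₀.arr 11 0 = x) (hxn : x ≤ (n + 1) * (n + 3))
    (hr : ∀ j < c, s₀.table (2 ^ c) c x (2 ^ c - 1) j = r j) (hrn : ∀ j < c, r j ≤ n)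
    (ho : ∀ v, 0 < v → v ≤ n → s₀.arr 4 v < n) (h3 : ∀ a, s₀.arr 3 a = 0) :
    Runs L output s₀ (c * 9 + 8) fun s =>
      (∀ a, (∃ j < c, r j ≠ 0 ∧ s₀.arr 4 (r j) = a) → s.arr 3 a = 1) ∧
      ∀ a, (¬ ∃ j < c, r j ≠ 0 ∧ s₀.arr 4 (r j) = a) → s.arr 3 a = 0 := by
  obtain ⟨h2L, hcL⟩ := hB.size_lt
  have hnL : n + 1 < 2 ^ L := hB.lt (by nlinarith)
  have hL : L ≠ 0 := by rintro rfl; simp at hcL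
  have hxL : x < 2 ^ L := hB.lt (by omega)
  have hp : 1 ≤ 2 ^ c := Nat.one_le_two_pow
  have haddr : ∀ j ≤ c, addr (2 ^ c) c x (2 ^ c - 1) j < 2 ^ L := fun j hj =>
    (addr_lt (by omega) hj).trans (hB.id hxn)
  have h0 := haddr 0 (Nat.zero_le _)
  unfold addr at h0
  -- This is the address of the row of the mask of all colors.
  let b := x * (2 ^ c * (c + 1)) + (2 ^ c - 1) * (c + 1)
  let I : ℕ → State → Prop := fun k s => s.reg 7 = k ∧ s.reg 1 = c ∧ s.reg 8 = b ∧
    (∀ k, k ≠ 3 → ∀ a, s.arr k a = s₀.arr k a) ∧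
    (∀ a, (∃ j < k, r j ≠ 0 ∧ s₀.arr 4 (r j) = a) → s.arr 3 a = 1) ∧
    ∀ a, (¬ ∃ j < k, r j ≠ 0 ∧ s₀.arr 4 (r j) = a) → s.arr 3 a = 0
  have ha : Runs L (block [.load 8 11 (.const 0), .op 8 .mul (.reg 8) (.reg 4),
      .op 9 .sub (.reg 2) (.const 1), .op 9 .mul (.reg 9) (.reg 5), .op 8 .add (.reg 8) (.reg 9),
      .op 7 .add (.const 0) (.const 0)]) s₀ 7 (I 0) := by
    refine (Runs.of_wp ?_).mono (by simp [block, cost]) fun _ h => h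
    simp [block, wp, Op.eval, hx, h1, h2, h4, h5, I, b, h3]
    omega
  refine (ha.seq (T' := c * 9 + 1) fun s₁ h₁ => ?_).mono (by omega) fun _ h => h
  refine (Runs.loop (T := 7) I (by omega : c < 2 ^ L) ?_ ?_ (Nat.zero_le _) h₁).mono (by omega)
    fun s ⟨_, _, _, _, hs⟩ => hs
  · rintro k s ⟨hk, hk', _⟩
    exact ⟨hk, hk'⟩
  · rintro k s hkc ⟨b0, b1, b2, b3, b4, b5⟩
    have hak := haddr k hkc.le
    have hb : b + k = addr (2 ^ c) c x (2 ^ c - 1) k := Nat.add_assoc _ _ _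
    have e12 : s.arr 12 (addr (2 ^ c) c x (2 ^ c - 1) k) = r k := by
      rw [b3 12 (by norm_num)]; exact hr k hkc
    have hrk := hrn k hkc
    have hsucc : ∀ a, (∃ j < k + 1, r j ≠ 0 ∧ s₀.arr 4 (r j) = a) ↔
        (∃ j < k, r j ≠ 0 ∧ s₀.arr 4 (r j) = a) ∨ (r k ≠ 0 ∧ s₀.arr 4 (r k) = a) := by
      intro a
      constructor
      · rintro ⟨j, hj, h⟩
        rcases Nat.lt_succ_iff_lt_or_eq.1 hj with hj | rfl
        · exact .inl ⟨j, hj, h⟩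
        · exact .inr h
      · rintro (⟨j, hj, h⟩ | h)
        · exact ⟨j, by omega, h⟩
        · exact ⟨k, by omega, h⟩
    refine (Runs.of_wp (?_ : wp L outputBody _ s)).mono
      (by simp [outputBody, block, cost]) fun _ h => h
    simp only [outputBody, block, wp, Op.eval, Atom.val_reg, Atom.val_const, b0, b2, hb, e12,
      State.setReg_reg, State.setReg_arr, if_true, Test.Holds, I, State.setArr_reg, hsucc]
    refine ⟨hak, by omega, fun hpos => ⟨?_, by omega, ?_⟩, fun hz => ?_⟩
    · rw [b3 4 (by norm_num)]
      have := ho (r k) hpos hrk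
      omega
    · refine ⟨by simp, by simp, by simp [b1], by simp, ?_, ?_, ?_⟩
      · intro k' hk' a
        simp [hk', b3 k' hk']
      · intro a ha
        rw [b3 4 (by norm_num), State.setArr_arr, if_pos rfl]
        split_ifs with e
        · rfl
        · exact b4 a (ha.resolve_right fun h => e h.2.symm)
      · intro a ha
        rw [not_or] at ha
        rw [b3 4 (by norm_num), State.setArr_arr, if_pos rfl,
          if_neg fun e => ha.2 ⟨hpos.ne', e.symm⟩]
        exact b5 a ha.1
    · have hrz : r k = 0 := by omega
      simp only [hrz, ne_eq, not_true, false_and, or_false]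
      exact ⟨by simp, by simp, by simp [b1], by simp, by simpa using b3, b4, b5⟩

end

/-! ### Transfer to the graph -/

section
variable {n c : ℕ} {G : SimpleGraph (Fin n)} {w : Fin n → ℕ} {col : Fin n → Fin c}

theorem instanceState_adj (u v : Fin n) [Decidable (G.Adj u v)] :
    (instanceState G w col).adj n u v = if G.Adj u v then 1 else 0 := by
  simp only [State.adj, instanceState, if_neg (show ¬ (2 = 0) by norm_num),
    if_neg (show ¬ (2 = 1) by norm_num), if_true]
  have key : (∃ u' v' : Fin n, (u : ℕ) * n + v = u' * n + v' ∧ G.Adj u' v') ↔ G.Adj u v := ?_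
  · by_cases h : G.Adj u v
    · rw [if_pos h, if_pos (key.2 h)]
    · rw [if_neg h, if_neg fun h' => h (key.1 h')]
  refine ⟨?_, fun h => ⟨u, v, rfl, h⟩⟩
  rintro ⟨u', v', e, h⟩
  have hn : 0 < n := u.pos
  have e1 := congrArg (· / n) e
  have e2 := congrArg (· % n) e
  simp only [mul_comm _ n, Nat.mul_add_div hn, Nat.div_eq_of_lt v.2, Nat.div_eq_of_lt v'.2,
    add_zero, Nat.mul_add_mod, Nat.mod_eq_of_lt v.2, Nat.mod_eq_of_lt v'.2] at e1 e2
  rwa [Fin.ext e1, Fin.ext e2]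

theorem instanceState_adj_le (x y : ℕ) : (instanceState G w col).adj n x y ≤ 1 := by
  simp only [State.adj, instanceState, if_neg (show ¬ (2 = 0) by norm_num),
    if_neg (show ¬ (2 = 1) by norm_num), if_true]
  split_ifs <;> omega

/-- The positions of the vertices in a search. -/
theorem IsSearch.exists_embedding {A : ℕ → ℕ → ℕ} {o : ℕ → ℕ} (h : IsSearch A n o n) :
    ∃ e : Fin n ↪ ℕ, (∀ v, 0 < e v ∧ e v ≤ n ∧ o (e v) = v) ∧
      ∀ i, 0 < i → i ≤ n → ∃ v, e v = i := by
  let σ : Fin n → Fin n := fun i => ⟨o (i + 1), h.lt i i.2⟩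
  have hσ : σ.Injective := fun i j e => Fin.ext (h.inj i i.2 j j.2 (Fin.ext_iff.1 e))
  have hb : σ.Bijective := Finite.injective_iff_bijective.1 hσ
  let τ := Equiv.ofBijective σ hb
  refine ⟨⟨fun v => τ.symm v + 1, fun u v e => ?_⟩, fun v => ⟨Nat.succ_pos _, (τ.symm v).2, ?_⟩,
    fun i h0 hi => ⟨σ ⟨i - 1, by omega⟩, ?_⟩⟩
  · exact τ.symm.injective (Fin.ext (Nat.succ_injective e))
  · exact congrArg Fin.val (τ.apply_symm_apply v)
  · have : τ.symm (σ ⟨i - 1, by omega⟩) = ⟨i - 1, by omega⟩ := τ.symm_apply_apply _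
    change (τ.symm (σ ⟨i - 1, by omega⟩) : ℕ) + 1 = i
    rw [this]
    exact Nat.succ_pred_eq_of_pos h0

/-- Otherwise every neighbor of `b` visited before `b` is a neighbor of `d` too, and `a` is one of
`d` only. Then `d` had the larger count when `b` was chosen. -/
theorem IsSearch.isSearchOrder {o : ℕ → ℕ}
    (h : IsSearch ((instanceState G w col).adj n) n o n) {e : Fin n ↪ ℕ}
    (he : ∀ v, 0 < e v ∧ e v ≤ n ∧ o (e v) = v) (he' : ∀ i, 0 < i → i ≤ n → ∃ v, e v = i) :
    IsSearchOrder G e := by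
  classical
  intro a b d hab hbd had hnab
  by_contra! hno
  have hb := he b
  have hd := he d
  have ha := he a
  have hmax := h.max (e b - 1) (by omega) d d.2 fun j hj e' => by
    have : j + 1 = e d := by
      have h1 := h.inj j (by omega) (e d - 1) (by omega)
        (by rw [e', Nat.sub_add_cancel hd.1, hd.2.2])
      omega
    omega
  rw [Nat.sub_add_cancel hb.1, hb.2.2] at hmax
  refine absurd hmax (not_le.2 (Finset.sum_lt_sum (fun i hi => ?_) ⟨e a - 1, ?_, ?_⟩))
  · rw [Finset.mem_range] at hi
    obtain ⟨v, hv⟩ := he' (i + 1) (by omega) (by omega)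
    rw [← hv, (he v).2.2, instanceState_adj, instanceState_adj]
    by_cases hvb : G.Adj v b
    · rw [if_pos hvb, if_pos (hno v (by omega) hvb)]
    · rw [if_neg hvb]; exact Nat.zero_le _
  · rw [Finset.mem_range]; omega
  · rw [Nat.sub_add_cancel ha.1, ha.2.2, instanceState_adj, instanceState_adj, if_neg hnab,
      if_pos had]
    exact one_pos

theorem map_adj_iff {e : Fin n ↪ ℕ} {u v : Fin n} : (G.map e).Adj (e u) (e v) ↔ G.Adj u v :=
  SimpleGraph.map_adj_apply

theorem isElimTree_map (hG : IsChordal G) {e : Fin n ↪ ℕ} (he : ∀ v, 0 < e v ∧ e v ≤ n)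
    (hs : IsSearchOrder G e) {par : ℕ → ℕ}
    (hpar : ∀ i, par i = 0 ∨ (par i < i ∧ (G.map e).Adj (par i) i))
    (hle : ∀ i j, (G.map e).Adj j i → j < i → j ≤ par i) : IsElimTree (G.map e) par where
  par_lt i hi := by rcases hpar i with h | h <;> omega
  adj_par i hi := ((hpar i).resolve_left hi).2
  le_par := hle
  clique i j k hj hk hji hki hjk := by
    obtain ⟨_, u, v, huv, rfl, rfl⟩ := hji
    obtain ⟨_, u', v', huv', rfl, e'⟩ := hki
    obtain rfl := e.injective e'
    exact map_adj_iff.2 (hs.adj_of_adj hG e.injective hj hk huv huv' fun h => hjk (h ▸ rfl))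
  pos i j h := by
    obtain ⟨_, u, v, _, rfl, _⟩ := h
    exact (he u).1

/-- The mask `2 ^ c - 1` excludes no color, so its feasible sets are exactly the images under `e` of
the colorful independent sets of `G`. -/
theorem isMaxWeight_of_row {e : Fin n ↪ ℕ} (he : ∀ v, 0 < e v ∧ e v ≤ n)
    (he' : ∀ i, 0 < i → i ≤ n → ∃ v, e v = i) {cl wt : ℕ → ℕ} (hcl : ∀ v, cl (e v) = col v)
    (hwt : ∀ v, wt (e v) = w v) {X : ℕ → ℕ → ℕ}
    (hX : Solves (G.map e) cl wt c {x | 0 < x ∧ x ≤ n} X) :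
    ∃ S : Finset (Fin n), IsMaxWeightColorfulIndepSet G w col S ∧
      (∀ j < c, X (2 ^ c - 1) j ≤ n) ∧
      ∀ v, v ∈ S ↔ ∃ j < c, X (2 ^ c - 1) j ≠ 0 ∧ X (2 ^ c - 1) j = e v := by
  classical
  have hC : 2 ^ c - 1 < 2 ^ c := Nat.sub_lt (by positivity) one_pos
  obtain ⟨S', ⟨h1, h2, h3⟩, h4⟩ := hX.1 _ hC
  have hS : (Finset.univ.filter fun v => e v ∈ S').map e = S' := by
    ext i
    simp only [Finset.mem_map, Finset.mem_filter, Finset.mem_univ, true_and]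
    constructor
    · rintro ⟨v, hv, rfl⟩; exact hv
    · intro hi
      obtain ⟨v, rfl⟩ := he' i (h1 hi).1 (h1 hi).2
      exact ⟨v, hi, rfl⟩
  refine ⟨Finset.univ.filter fun v => e v ∈ S', ⟨⟨?_, ?_⟩, ?_⟩, ?_, ?_⟩
  · intro u hu v hv huv hadj
    simp only [Finset.coe_filter, Finset.mem_univ, true_and, Set.mem_ofPred_eq] at hu hv
    exact h2.1 hu hv (e.injective.ne huv) (map_adj_iff.2 hadj)
  · intro u hu v hv huv
    simp only [Finset.coe_filter, Finset.mem_univ, true_and, Set.mem_ofPred_eq] at hu hv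
    exact e.injective (h2.2 hu hv (by rw [hcl, hcl, huv]))
  · intro T hT
    have hsum : ∀ T : Finset (Fin n), ∑ v ∈ T, w v = ∑ i ∈ T.map e, wt i := fun T => by
      rw [Finset.sum_map]
      exact Finset.sum_congr rfl fun v _ => (hwt v).symm
    rw [hsum, hsum, hS, ← h4.2]
    refine hX.2 _ hC _ ⟨?_, ⟨?_, ?_⟩, ?_⟩
    · intro i hi
      obtain ⟨v, _, rfl⟩ := Finset.mem_map.1 hi
      exact he v
    · intro i hi j hj hij hadj
      obtain ⟨u, hu, rfl⟩ := Finset.mem_map.1 hi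
      obtain ⟨v, hv, rfl⟩ := Finset.mem_map.1 hj
      exact hT.1 hu hv (fun h => hij (h ▸ rfl)) (map_adj_iff.1 hadj)
    · intro i hi j hj hij
      obtain ⟨u, hu, rfl⟩ := Finset.mem_map.1 hi
      obtain ⟨v, hv, rfl⟩ := Finset.mem_map.1 hj
      rw [hcl, hcl] at hij
      rw [hT.2 hu hv (Fin.ext hij)]
    · intro i hi
      obtain ⟨v, _, rfl⟩ := Finset.mem_map.1 hi
      rw [hcl, Nat.testBit_two_pow_sub_one]
      exact decide_eq_true (col v).2
  · intro j hj
    by_cases h0 : X (2 ^ c - 1) j = 0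
    · omega
    · exact (h1 ((h4.1 j hj _ h0).1 rfl).1).2
  · intro v
    simp only [Finset.mem_filter, Finset.mem_univ, true_and]
    constructor
    · intro hv
      have := (h4.1 (col v) (col v).2 (e v) (he v).1.ne').2 ⟨hv, hcl v⟩
      exact ⟨col v, (col v).2, by rw [this]; exact (he v).1.ne', this⟩
    · rintro ⟨j, hj, h0, h⟩
      exact ((h4.1 j hj _ (he v).1.ne').1 h).1

end

/-! ### Running time and word length -/

theorem succ_mul_two_pow_le (c : ℕ) : (c + 1) * 2 ^ c ≤ 2 * 3 ^ c := by
  induction c with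
  | zero => norm_num
  | succ c ih =>
    have h : 2 ^ c ≤ 3 ^ c := Nat.pow_le_pow_left (by norm_num) c
    calc (c + 1 + 1) * 2 ^ (c + 1) = 2 * ((c + 1) * 2 ^ c) + 2 * 2 ^ c := by ring
      _ ≤ 2 * (2 * 3 ^ c) + 2 * 3 ^ c := by omega
      _ = 2 * 3 ^ (c + 1) := by ring

/-- The constant is `44 + 9 + 20 + 10`, with `44 = 22 * 2` from `succ_mul_two_pow_le`. -/
theorem convTime_le (c : ℕ) : convTime c ≤ 83 * 3 ^ c := by
  have h1 := succ_mul_two_pow_le c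
  have h2 : 2 ^ c ≤ 3 ^ c := Nat.pow_le_pow_left (by norm_num) c
  have h3 : 1 ≤ 3 ^ c := Nat.one_le_pow _ _ (by norm_num)
  rw [mul_comm] at h1
  unfold convTime
  omega

theorem time_le {n : ℕ} (c : ℕ) (hn : 0 < n) :
    1 + ((c * 6 + 8) + ((3 ^ c * 15 + 2) + ((n * (n * 20 + 22) + 2) + ((n * (n * 10 + 8) + 2) +
      (((n + 1) * (n * (convTime c + 22) + convTime c + 27) + 4) + (c * 9 + 8)))))) ≤
      1000 * (3 ^ c * n ^ 2) := by
  have h1 := convTime_le c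
  have h3 : 1 ≤ 3 ^ c := Nat.one_le_pow _ _ (by norm_num)
  have h4 : c < 3 ^ c := Nat.lt_pow_self (by norm_num)
  generalize 3 ^ c = x at *
  generalize convTime c = y at *
  have hnn : n ≤ n ^ 2 := Nat.le_self_pow (by norm_num) n
  have hA : n ^ 2 ≤ x * n ^ 2 := Nat.le_mul_of_pos_left _ h3
  have hB : x ≤ x * n ^ 2 := Nat.le_mul_of_pos_right _ (by positivity)
  -- The main term: at most `2 * n` rounds of at most `237 * n * 3 ^ c` steps each.
  have hC : (n + 1) * (n * (y + 22) + y + 27) ≤ (2 * n) * (n * (237 * x)) := by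
    refine Nat.mul_le_mul (by omega) ?_
    calc n * (y + 22) + y + 27 ≤ n * (105 * x) + 110 * x := by
          have : n * (y + 22) ≤ n * (105 * x) := Nat.mul_le_mul_left _ (by omega)
          omega
      _ ≤ n * (105 * x) + n * (110 * x) := Nat.add_le_add_left (Nat.le_mul_of_pos_left _ hn) _
      _ ≤ n * (237 * x) := by rw [← mul_add]; exact Nat.mul_le_mul_left _ (by omega)
  have hD : (2 * n) * (n * (237 * x)) = 474 * (x * n ^ 2) := by ring
  have hE : n * (n * 20 + 22) = 20 * n ^ 2 + 22 * n := by ring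
  have hF : n * (n * 10 + 8) = 10 * n ^ 2 + 8 * n := by ring
  omega

/-- All quantities to be stored are polynomial in `x = 2 ^ instanceBits c w`, at most `x ^ 6`; the
factor `1000` in the exponent leaves ample room. -/
theorem bounds_instanceBits {n c : ℕ} (w : Fin n → ℕ) :
    Bounds (1000 * instanceBits c w) n c (∑ v, w v) := by
  have hn : n < 2 ^ Nat.size n := Nat.lt_size_self n
  have hW : ∑ v, w v < 2 ^ Nat.size (∑ v, w v) := Nat.lt_size_self _
  have hc : c < 2 ^ c := Nat.lt_two_pow_self
  generalize hb : instanceBits c w = b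
  have hle : ∀ m, m + 1 ≤ b → 2 * 2 ^ m ≤ 2 ^ b := fun m hm => by
    rw [← pow_succ']; exact Nat.pow_le_pow_right (by norm_num) hm
  unfold instanceBits at hb
  have h1 := hle c (by omega)
  have h2 := hle (Nat.size n) (by omega)
  have h3 := hle (Nat.size (∑ v, w v)) (by omega)
  have h4 := hle 0 (by omega)
  have hlt : (2 ^ b) ^ 6 < 2 ^ (1000 * b) := by
    rw [← pow_mul]; exact Nat.pow_lt_pow_right (by norm_num) (by omega)
  have h33 : 3 ^ c ≤ 2 ^ c * 2 ^ c := by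
    rw [← mul_pow]; exact Nat.pow_le_pow_left (by norm_num) c
  generalize 2 ^ b = x at *
  have hx : ∀ k ≤ 6, x ^ k ≤ x ^ 6 := fun k hk => Nat.pow_le_pow_right (by omega) hk
  constructor
  · refine lt_of_le_of_lt ?_ hlt
    have e1 : (n + 1) * (n + 3) ≤ x * (2 * x) := Nat.mul_le_mul (by omega) (by omega)
    have e2 : (n + 1) * (n + 3) + 1 ≤ x ^ 4 := by
      have : 4 ≤ x * x := Nat.mul_le_mul (by omega : 2 ≤ x) (by omega : 2 ≤ x)
      have : 4 * (x * x) ≤ x * x * (x * x) := Nat.mul_le_mul_right _ this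
      have : x ^ 4 = x * x * (x * x) := by ring
      have : x * (2 * x) = 2 * (x * x) := by ring
      omega
    calc _ ≤ x ^ 4 * (x * x) := Nat.mul_le_mul e2 (Nat.mul_le_mul (by omega) (by omega))
      _ = x ^ 6 := by ring
  · refine lt_of_le_of_lt (h33.trans ((Nat.mul_le_mul (by omega : _ ≤ x) (by omega : _ ≤ x)).trans
      ?_)) hlt
    rw [← pow_two]; exact hx 2 (by norm_num)
  · refine lt_of_le_of_lt ?_ hlt
    have : 2 * x ≤ x * x := Nat.mul_le_mul_right _ (by omega)
    have := hx 2 (by norm_num)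
    rw [pow_two] at this
    omega

theorem program_runs {n c : ℕ} {G : SimpleGraph (Fin n)} {w : Fin n → ℕ} {col : Fin n → Fin c}
    (hG : IsChordal G) (hn : 0 < n) :
    Runs (1000 * instanceBits c w) colorfulIndepSetProgram (instanceState G w col)
      (1000 * (3 ^ c * n ^ 2)) fun s => ∃ S, OutputsSet s S ∧
        IsMaxWeightColorfulIndepSet G w col S := by
  classical
  have hB := bounds_instanceBits (c := c) w
  have hnL : (n + 1) * (n + 3) < 2 ^ (1000 * instanceBits c w) := hB.lt (by omega)
  generalize 1000 * instanceBits c w = L at *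
  obtain ⟨s₀, hs₀⟩ : ∃ s, s = instanceState G w col := ⟨_, rfl⟩
  have i0 : s₀.reg 0 = n := by simp [hs₀, instanceState]
  have i1 : s₀.reg 1 = c := by simp [hs₀, instanceState]
  have iarr : ∀ k, 2 < k → ∀ a, s₀.arr k a = 0 := fun k hk a => by
    simp only [hs₀, instanceState]
    rw [if_neg (by omega), if_neg (by omega), if_neg (by omega)]
  rw [← hs₀]
  refine (Runs.ite (fun _ => ?_) (fun h => ?_)).mono (time_le c hn) fun _ h => h
  swap
  · exact (h (by simpa [Test.Holds, i0] using hn)).elim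
  refine (constants_runs hB i0 i1).seq fun s₁ ⟨k₁, a2, a3, a4, a5, a6, a9⟩ => ?_
  refine (digits_runs hB a3 (fun a => by rw [k₁.2 5 (by simp), iarr 5 (by norm_num)])
    (fun a => by rw [k₁.2 6 (by simp), iarr 6 (by norm_num)])).seq fun s₂ ⟨k₂, d₂⟩ => ?_
  have k₀₂ : Keeps 2 [5, 6, 9] s₀ s₂ := k₁.trans k₂ (by norm_num) (by norm_num) (by simp) (by simp)
  have adj₂ : s₂.adj n = s₀.adj n := by
    funext x y; exact k₀₂.2 2 (by simp) _
  refine (search_runs hnL (by rw [k₀₂.1 0 (by norm_num), i0])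
    (by rw [adj₂, hs₀]; exact instanceState_adj_le)
    (fun a => by rw [k₀₂.2 10 (by simp), iarr 10 (by norm_num)])
    (fun a => by rw [k₀₂.2 15 (by simp), iarr 15 (by norm_num)])).seq fun s₃ ⟨k₃, hs₃⟩ => ?_
  have k₀₃ : Keeps 2 [4, 5, 6, 9, 10, 15] s₀ s₃ :=
    k₀₂.trans k₃ (by norm_num) (by norm_num) (by simp) (by simp)
  have k₁₃ : Keeps 7 [4, 5, 6, 10, 15] s₁ s₃ :=
    k₂.trans k₃ (by norm_num) (by norm_num) (by simp) (by simp)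
  rw [adj₂, hs₀] at hs₃
  set o := s₃.arr 4 with ho
  obtain ⟨e, he, he'⟩ := hs₃.exists_embedding
  have horder := hs₃.isSearchOrder he he'
  have hen : ∀ v, 0 < e v ∧ e v ≤ n := fun v => ⟨(he v).1, (he v).2.1⟩
  have hon : ∀ i, 0 < i → i ≤ n → o i < n := fun i h0 hi => by
    obtain ⟨v, rfl⟩ := he' i h0 hi
    rw [(he v).2.2]; exact v.2
  have hA : ∀ u v, s₀.adj n (o (e u)) (o (e v)) = if G.Adj u v then 1 else 0 := fun u v => by
    rw [(he u).2.2, (he v).2.2, hs₀, instanceState_adj]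
  have hA' : ∀ i j, 0 < i → i ≤ n → 0 < j → j ≤ n →
      s₀.adj n (o i) (o j) = if (G.map e).Adj i j then 1 else 0 := by
    intro i j hi hin hj hjn
    obtain ⟨u, rfl⟩ := he' i hi hin
    obtain ⟨v, rfl⟩ := he' j hj hjn
    rw [hA]
    exact if_congr map_adj_iff.symm rfl rfl
  have hmem : ∀ i j, (G.map e).Adj i j → 0 < i ∧ i ≤ n := by
    rintro i j ⟨_, u, v, _, rfl, _⟩
    exact hen u
  refine (parents_runs (A := fun i j => s₀.adj n (o i) (o j)) hn hnL
    (by rw [k₀₃.1 0 (by norm_num), i0]) (by rw [k₁₃.1 6 (by norm_num), a6])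
    (fun i j => by rw [hs₀]; exact instanceState_adj_le _ _) hon
    (fun i j => k₀₃.2 2 (by simp) _)
    (fun a => by rw [k₀₃.2 7 (by simp), iarr 7 (by norm_num)])
    (fun a => by rw [k₀₃.2 8 (by simp), iarr 8 (by norm_num)])).seq fun s₄ hs₄ => ?_
  have k₀₄ : Keeps 2 [4, 5, 6, 7, 8, 9, 10, 15] s₀ s₄ :=
    k₀₃.trans hs₄.keeps (by norm_num) (by norm_num) (by simp) (by simp)
  have k₁₄ : Keeps 7 [4, 5, 6, 7, 8, 10, 15] s₁ s₄ :=
    k₁₃.trans hs₄.keeps (by norm_num) (by norm_num) (by simp) (by simp)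
  have k₂₄ : Keeps 7 [4, 7, 8, 10, 15] s₂ s₄ :=
    k₃.trans hs₄.keeps (by norm_num) (by norm_num) (by simp) (by simp)
  have o₄ : s₄.arr 4 = o := funext fun a => hs₄.keeps.2 4 (by simp) a
  -- Positions beyond `n` carry no vertices, but `IsElimTree` speaks of all numbers; there the
  -- parent is set to `0`.
  let par : ℕ → ℕ := fun i => if i ≤ n then s₄.arr 7 i else 0
  have hbefore : ∀ a b, a ≤ n → Before (n + 1) 1 a b := fun a b h => .inl (by omega)
  have hpar : ∀ i, par i = 0 ∨ (par i < i ∧ (G.map e).Adj (par i) i) := by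
    intro i
    by_cases hi : i ≤ n
    · simp only [par, if_pos hi]
      rcases hs₄.par i with h | ⟨h, h'⟩
      · exact .inl h
      · by_cases h0 : s₄.arr 7 i = 0
        · exact .inl h0
        · refine .inr ⟨h, ?_⟩
          by_contra hn'
          rw [hA' _ _ (by omega) hi (by omega) (by omega), if_neg fun h => hn' h.symm] at h'
          exact h' rfl
    · exact .inl (if_neg hi)
  have hle : ∀ i j, (G.map e).Adj j i → j < i → j ≤ par i := by
    intro i j h hji
    have h1 := hmem j i h
    have h2 := hmem i j h.symm
    simp only [par, if_pos h2.2]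
    refine hs₄.le_par i j h1.1 hji h2.2 (hbefore _ _ h2.2) ?_
    rw [hA' _ _ h2.1 h2.2 h1.1 h1.2, if_pos h.symm]
    exact one_ne_zero
  have hcol : ∀ v, s₀.arr 1 (o (e v)) = col v := fun v => by
    rw [(he v).2.2]
    simp [hs₀, instanceState]
  have hwt : ∀ v, s₀.arr 0 (o (e v)) = w v := fun v => by
    rw [(he v).2.2]
    simp [hs₀, instanceState]
  have hsum : ∑ i ∈ Finset.Icc 1 n, s₀.arr 0 (o i) = ∑ v, w v := by
    have : Finset.Icc 1 n = Finset.univ.map e := by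
      ext i
      simp only [Finset.mem_Icc, Finset.mem_map, Finset.mem_univ, true_and]
      constructor
      · rintro ⟨h, h'⟩; exact he' i h h'
      · rintro ⟨v, rfl⟩; exact hen v
    rw [this, Finset.sum_map]
    exact Finset.sum_congr rfl fun v _ => hwt v
  have hready : Ready L n c (G.map e) par (fun i => s₀.arr 1 (o i)) (fun i => s₀.arr 0 (o i)) s₄ :=
    { bounds := by rw [hsum]; exact hB
      tree := isElimTree_map hG hen horder hpar hle
      r0 := by rw [k₀₄.1 0 (by norm_num), i0]
      r1 := by rw [k₀₄.1 1 (by norm_num), i1]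
      r2 := by rw [k₁₄.1 2 (by norm_num), a2]
      r3 := by rw [k₁₄.1 3 (by norm_num), a3]
      r4 := by rw [k₁₄.1 4 (by norm_num), a4]
      r5 := by rw [k₁₄.1 5 (by norm_num), a5]
      r6 := by rw [k₁₄.1 6 (by norm_num), a6]
      fst := fun t ht => by rw [k₂₄.2 5 (by simp), (d₂ t ht).1]
      snd := fun t ht => by rw [k₂₄.2 6 (by simp), (d₂ t ht).2]
      par := fun u _ hu => (if_pos hu).symm
      adj := fun i j hi hji h => by
        have h1 := hmem j i h.symm
        rw [hs₄.adj i j h1.1 hji hi (hbefore _ _ hi), hA' _ _ (by omega) hi h1.1 h1.2, if_pos h]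
      not_adj := fun i j hi hji h => by
        -- Column `0` is also read, when the artificial root is treated; it is zero because that
        -- root has no neighbors.
        rcases Nat.eq_zero_or_pos j with rfl | hj
        · exact hs₄.adj_zero i
        · rw [hs₄.adj i j hj hji hi (hbefore _ _ hi), hA' _ _ (by omega) hi hj (by omega),
            if_neg h]
      pow := fun j hj => by rw [k₁₄.2 9 (by simp), a9 j hj]
      ord := by rw [o₄]; exact hon
      col := fun v _ _ => by rw [o₄, k₀₄.2 1 (by simp)]
      weight := fun v _ _ => by rw [o₄, k₀₄.2 0 (by simp)]
      col_lt := fun i h0 hi => by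
        obtain ⟨v, rfl⟩ := he' i h0 hi
        rw [hcol]; exact (col v).2
      tables := fun a => by rw [k₀₄.2 12 (by simp), iarr 12 (by norm_num)] }
  refine (solve_runs hready).seq fun s₅ ⟨f₅, hid, hsol⟩ => ?_
  obtain ⟨S, hS, hrow, hmemS⟩ := isMaxWeight_of_row hen he' hcol hwt hsol
  have o₅ : ∀ v, s₅.arr 4 v = o v := fun v => by rw [f₅.2 4 (by norm_num), o₄]
  refine (output_runs (r := s₅.table (2 ^ c) c (s₅.arr 11 0) (2 ^ c - 1)) hB
    (by rw [f₅.1 1 (by norm_num), hready.r1]) (by rw [f₅.1 2 (by norm_num), hready.r2])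
    (by rw [f₅.1 4 (by norm_num), hready.r4]) (by rw [f₅.1 5 (by norm_num), hready.r5]) rfl hid.le
    (fun _ _ => rfl) hrow (fun v h0 hv => by rw [o₅]; exact hon v h0 hv)
    (fun a => by rw [f₅.2 3 (by norm_num), k₀₄.2 3 (by simp), iarr 3 (by norm_num)])).mono le_rfl
    fun s₆ ⟨hone, hzero⟩ => ⟨S, fun v => ?_, hS⟩
  have hiff : v ∈ S ↔ ∃ j < c, s₅.table (2 ^ c) c (s₅.arr 11 0) (2 ^ c - 1) j ≠ 0 ∧
      s₅.arr 4 (s₅.table (2 ^ c) c (s₅.arr 11 0) (2 ^ c - 1) j) = v := by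
    rw [hmemS]
    refine exists_congr fun j => and_congr_right fun hj => and_congr_right fun h0 => ?_
    rw [o₅]
    obtain ⟨u, hu⟩ := he' _ (Nat.pos_of_ne_zero h0) (hrow j hj)
    rw [← hu, (he u).2.2]
    exact ⟨fun h => by rw [e.injective h], fun h => by rw [Fin.ext h]⟩
  split_ifs with hv
  · exact hone v (hiff.1 hv)
  · exact hzero v fun h => hv (hiff.2 h)

end WordRAM

theorem mainTheorem8 :
    ∃ (P : WordRAM.Prog) (K : ℕ), ∀ (n c : ℕ) (G : SimpleGraph (Fin n)) (w : Fin n → ℕ)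
      (col : Fin n → Fin c), IsChordal G →
      ∃ (t : ℕ) (s : WordRAM.State) (S : Finset (Fin n)),
        WordRAM.Exec (K * instanceBits c w) P (instanceState G w col) t s ∧
        OutputsSet s S ∧
        IsMaxWeightColorfulIndepSet G w col S ∧
        (0 < n → t ≤ K * (3 ^ c * n ^ 2)) := by
  refine ⟨WordRAM.colorfulIndepSetProgram, 1000, fun n c G w col hG => ?_⟩
  rcases Nat.eq_zero_or_pos n with rfl | hn
  · refine ⟨_, _, ∅, .ite_false ?_ (.skip _), fun v => v.elim0,
      ⟨⟨by simp [SimpleGraph.IsIndepSet], by simp⟩, fun S' _ => by simp [Finset.eq_empty_of_isEmpty]⟩,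
      fun h => absurd h (lt_irrefl 0)⟩
    simp [WordRAM.Test.Holds, instanceState]
  · obtain ⟨t, s, hex, ht, S, hout, hS⟩ := WordRAM.program_runs (w := w) (col := col) hG hn
    exact ⟨t, s, S, hex, hout, hS, fun _ => ht⟩
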